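/- **Setting.** A weighted digraph on the agents $\mathcal V=\{1,\dots,N\}$ is given by weights $a_{jk}\ge 0$ with $a_{kk}=0$; $(j,k)$ is an edge ($j$ sends information to $k$) iff $a_{jk}>0$, and the graph is undirected if $a_{jk}=a_{kj}$ for all $j,k$. The in-degree of $k$ is $d_k=\sum_j a_{jk}$; let $d_{\max}=\max_k d_k$ and $d_{\rm sum}=\sum_k d_k$. Let the communication graph $\mathbb G$ be fixed in time and be either (a) a directed rooted tree (there is a root from which every vertex is reached by exactly one directed path; arbitrary positive weights), or (b) an undirected tree (arbitrary positive symmetric weights), or an equally weighted complete graph ($a_{jk}=c$ for all $j\ne k$, for some $c>0$), or any graph obtained from such undirected trees and complete graphs by repeated vertex-interconnection, where $\mathbb G$ is a vertex-interconnection of $\mathbb G_1$ and $\mathbb G_2$ if $\mathbb G_1,\mathbb G_2$ have exactly one vertex in common, and the vertices and (weighted) edges of $\mathbb G$ are those of $\mathbb G_1$ together with those of $\mathbb G_2$. The agents have angular positions $\theta_k\in S^1=\mathbb R/2\pi\mathbb Z$. They *synchronize* if there is $\bar\theta\in S^1$ with $\theta_k(t)\to\bar\theta$ as $t\to+\infty$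 for all $k$. "Almost all initial conditions" refers to Lebesgue measure on $(S^1)^N$. The value $\arg(0)$ may be chosen arbitrarily in $S^1$ whenever it occurs. **Statement.** 1. (Continuous time.) Let $\alpha>0$. For almost all initial conditions, the solution of $$\tfrac{d}{dt}\theta_k=2\alpha\sum_{j=1}^N a_{jk}\sin(\theta_j-\theta_k),\qquad k=1,\dots,N,$$ synchronizes. 2. (Discrete time, synchronous update.) Let $\beta>0$; in case (b) assume moreover that $\beta\ge d_{\max}\left(\tfrac{2}{M}+1\right)$, where $M>0$ is the solution of $\tfrac{e^{M}-1}{M}=1+\tfrac{d_{\max}}{d_{\rm sum}}$ (no condition beyond $\beta>0$ if $N=1$). For almost all initial conditions, every sequence with $$\theta_k(t+1)=\arg\Big(\sum_{j=1}^N a_{jk}e^{i\theta_j(t)}+\beta e^{i\theta_k(t)}\Big),\qquad k=1,\dots,N,\ t=0,1,2,\dots$$ synchronizes. 3. (Discrete time, locally asynchronous update.) Let $\beta>0$ be arbitrary. Let $\sigma(t)\subset\mathcal V$, $t=0,1,2,\dots$, be sets none of which contains two agents joined by an edge, and suppose that there are $T$ and $0=t_0<t_1<t_2<\cdots$ with $t_{n+1}-t_n<T$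 such that each agent belongs to some $\sigma(t)$ with $t\in[t_n,t_{n+1})$, for every $n$. If between $t$ and $t+1$ exactly the agents $k\in\sigma(t)$ apply the update law of part 2 and the others do not move, then for almost all initial conditions the agents synchronize. -/

import Mathlib

open Filter Topology MeasureTheory

noncomputable section

namespace CircleSync

/-! ### Communication graphs -/

/-- A weighted directed graph whose vertices lie in `V`: a set of vertices and weights `a_{jk} ≥ 0`,
where `a_{jk} ≠ 0` exactly when `(j, k)` is an edge (agent `j` sends information to agent `k`).
There are no self-loops. -/
structure WeightedDigraph (V : Type*) where
  /-- the vertices of the graph -/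
  verts : Set V
  /-- the weights `a_{jk}`, extended by zero to all pairs -/
  weight : V → V → ℝ
  weight_nonneg : ∀ j k, 0 ≤ weight j k
  weight_self : ∀ k, weight k k = 0
  mem_left_of_weight_ne_zero : ∀ j k, weight j k ≠ 0 → j ∈ verts
  mem_right_of_weight_ne_zero : ∀ j k, weight j k ≠ 0 → k ∈ verts

namespace WeightedDigraph

variable {V : Type*}

/-- `(j, k)` is an edge of `G`. -/
def Edge (G : WeightedDigraph V) (j k : V) : Prop := G.weight j k ≠ 0

/-- `G` is undirected: `a_{jk} = a_{kj}`. -/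
def IsUndirected (G : WeightedDigraph V) : Prop := ∀ j k, G.weight j k = G.weight k j

/-- The sequence of vertices `r, l₁, …, l_m` is a directed path of `G` from `r` to `k`. -/
def IsDirectedPath (G : WeightedDigraph V) (r k : V) (l : List V) : Prop :=
  List.IsChain G.Edge (r :: l) ∧ (r :: l).getLast (List.cons_ne_nil r l) = k

/-- `G` is a directed (rooted) tree: there is a root from which every vertex can be reached by
following one and only one directed path. -/
def IsDirectedTree (G : WeightedDigraph V) : Prop :=
  ∃ r ∈ G.verts, ∀ k ∈ G.verts, ∃! l : List V, G.IsDirectedPath r k l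

/-- The simple graph on the vertices of `G` in which two distinct vertices are adjacent
when there is an edge between them. -/
def toSimpleGraph (G : WeightedDigraph V) : SimpleGraph G.verts :=
  SimpleGraph.fromRel fun j k => G.Edge j k

/-- `G` is an undirected tree, with arbitrary (symmetric) positive weights on its edges. -/
def IsUndirectedTree (G : WeightedDigraph V) : Prop :=
  G.IsUndirected ∧ G.toSimpleGraph.IsTree

/-- `G` is an equally weighted complete graph. -/
def IsComplete (G : WeightedDigraph V) : Prop :=
  ∃ c : ℝ, 0 < c ∧ ∀ j ∈ G.verts, ∀ k ∈ G.verts, j ≠ k → G.weight j k = c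

/-- `G` is a vertex-interconnection of `G₁` and `G₂`: these share exactly one vertex, the vertices
of `G` are those of `G₁` and of `G₂`, and the edges of `G` are those of `G₁` and those of `G₂`, with
their weights. (An edge joins two distinct vertices, so no edge is common to `G₁` and `G₂`, and at
least one of the two summands below vanishes.) -/
def IsVertexInterconnection (G₁ G₂ G : WeightedDigraph V) : Prop :=
  (∃ k, G₁.verts ∩ G₂.verts = {k}) ∧ G.verts = G₁.verts ∪ G₂.verts ∧
    ∀ i j, G.weight i j = G₁.weight i j + G₂.weight i j

/-- `G` is an undirected tree, or a complete graph, or is obtained from undirected trees and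
complete graphs by (repeated) vertex-interconnection. -/
inductive IsTreeCompleteInterconnection : WeightedDigraph V → Prop
  | tree (G : WeightedDigraph V) (h : G.IsUndirectedTree) : IsTreeCompleteInterconnection G
  | complete (G : WeightedDigraph V) (h : G.IsComplete) : IsTreeCompleteInterconnection G
  | interconnection (G₁ G₂ G : WeightedDigraph V) (h : IsVertexInterconnection G₁ G₂ G)
      (h₁ : IsTreeCompleteInterconnection G₁) (h₂ : IsTreeCompleteInterconnection G₂) :
      IsTreeCompleteInterconnection G

variable [Fintype V]

/-- The in-degree `d_k = ∑_j a_{jk}`. -/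
def inDegree (G : WeightedDigraph V) (k : V) : ℝ := ∑ j, G.weight j k

/-- The largest in-degree. -/
def dMax (G : WeightedDigraph V) : ℝ := ⨆ k, G.inDegree k

/-- The sum of the in-degrees. -/
def dSum (G : WeightedDigraph V) : ℝ := ∑ k, G.inDegree k

/-- The bound on the inertia of the synchronous algorithm: `β > 0` and
`β ≥ d_max (2 / M + 1)`, where `M > 0` is given by `(e ^ M - 1) / M = 1 + d_max / d_sum`.
The equation for `M` is multiplied by `M * d_sum`, so that the condition reduces to `β > 0` for
a single agent, where all degrees are zero. -/
def InertiaBound (G : WeightedDigraph V) (β : ℝ) : Prop :=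
  0 < β ∧ ∃ M : ℝ, 0 < M ∧ (Real.exp M - 1) * G.dSum = M * (G.dSum + G.dMax) ∧
    G.dMax * (2 / M + 1) ≤ β

end WeightedDigraph

/-! ### The circle and the algorithms -/

instance factTwoPiPos : Fact (0 < 2 * Real.pi) := ⟨Real.two_pi_pos⟩

/-- The circle `S¹ = ℝ / 2πℤ` of angular positions, with Lebesgue (arc length) measure. -/
abbrev S1 : Type := AddCircle (2 * Real.pi)

/-- The point `e ^ (i θ)` of the complex plane. -/
def cexp (θ : S1) : ℂ := (AddCircle.toCircle θ : ℂ)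

theorem cexp_coe (x : ℝ) : cexp (x : S1) = Complex.exp (x * Complex.I) := by
  simp [cexp, AddCircle.toCircle_apply_mk, Circle.coe_exp]

/-- `φ` is a value of `arg z`, that is `z = ‖z‖ e ^ (i φ)`; any `φ` is a value of `arg 0`. -/
def IsArg (z : ℂ) (φ : S1) : Prop := z = (‖z‖ : ℂ) * cexp φ

variable {V : Type*} [Fintype V]

/-- The curve `θ` (real lifts of the angular positions, in dependence on time `t ≥ 0`) solves
`dθ_k/dt = 2 α ∑_j a_{jk} sin (θ_j - θ_k)` for all agents `k`. -/
def IsContinuousTimeSolution (G : WeightedDigraph V) (α : ℝ) (θ : ℝ → V → ℝ) : Prop :=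
  ∀ k, ∀ t, 0 ≤ t → HasDerivWithinAt (fun s => θ s k)
    (2 * α * ∑ j, G.weight j k * Real.sin (θ t j - θ t k)) (Set.Ici 0) t

/-- `θ` evolves in discrete time, where between `t` and `t + 1` the agents `k ∈ σ t` apply
`θ_k(t+1) = arg (∑_j a_{jk} e ^ (i θ_j(t)) + β e ^ (i θ_k(t)))` and the others do not move. -/
def IsDiscreteTimeSolution (G : WeightedDigraph V) (β : ℝ) (σ : ℕ → Set V) (θ : ℕ → V → S1) :
    Prop :=
  ∀ t k, (k ∈ σ t →
      IsArg (∑ j, (G.weight j k : ℂ) * cexp (θ t j) + (β : ℂ) * cexp (θ t k)) (θ (t + 1) k)) ∧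
    (k ∉ σ t → θ (t + 1) k = θ t k)

/-- The update sets `σ t` never contain two agents connected by an edge. -/
def IsLocallyAsynchronous (G : WeightedDigraph V) (σ : ℕ → Set V) : Prop :=
  ∀ t, ∀ j ∈ σ t, ∀ k ∈ σ t, ¬ G.Edge j k

/-- There are a finite time span `T` and a partition of discrete time into intervals
`[τ n, τ (n + 1))` of length less than `T`, in each of which every agent is updated. -/
def UpdatesRegularly (σ : ℕ → Set V) : Prop :=
  ∃ (T : ℕ) (τ : ℕ → ℕ), τ 0 = 0 ∧ StrictMono τ ∧ (∀ n, τ (n + 1) < τ n + T) ∧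
    ∀ k n, ∃ t, τ n ≤ t ∧ t < τ (n + 1) ∧ k ∈ σ t

/-- Along the time filter `l`, all agents converge to a common position (the consensus value). -/
def Synchronizes {ι : Type*} (l : Filter ι) (x : ι → V → S1) : Prop :=
  ∃ φ : S1, ∀ k, Tendsto (fun t => x t k) l (𝓝 φ)

end CircleSync

end

/-!
The argument is carried out for real lifts of the angular positions; `ae_circle_of_ae_lift`
transfers null sets of lifted initial conditions to null sets in `(S¹)^N`.

*Undirected graphs.* The torque is the gradient of the potential `½ ∑ a_{jk} cos (θ_j - θ_k)`, and
all dynamics ascend it: in continuous time because it is a gradient flow, in discrete time because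
an update maximizes a linearization of the potential with an inertia term. The only facts about the
graph that enter are those in `HasSyncLandscape`: a Łojasiewicz inequality with exponent `3 / 4` and
finitely many critical values, and the existence of a direction of strict increase at each
equilibrium that is not synchronized. Both are checked by hand for complete graphs, where the
potential is determined by the modulus of the sum of the positions in the complex plane, and both
pass to vertex-interconnections, because the torques on the two parts of an equilibrium vanish
separately (`IsTreeCompleteInterconnection.hasSyncLandscape`). The Łojasiewicz inequality makes
every trajectory one of finite length (`summable_of_lojasiewicz`), so it converges to an
equilibrium `p`. No stable manifold theorem is needed to see that an unstable `p` attracts a null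
set only. Near `p`, differences `u` of two trajectories grow in the cone
`η ‖u‖² < u ⬝ H u`, where `H` is the Hessian (`exists_cone_growth`, `exists_cone_rate`). So the
positions from which a trajectory stays near `p` have differences outside an open cone
and form a null set (`volume_eq_zero_of_sub_mem`); pulling it back to the initial time preserves
this, as the steps of the algorithms reflect null sets. In discrete time, convergence and growth
are uniform under a coercivity condition (`IsCoerciveOn`) on the agents that are updated
simultaneously; it holds if no two of them are connected, and also under the bound on the inertia,
which implies `7 d_max < 2 β`.

*Directed trees.* The root does not move, and each other agent sees its parent only. By induction
from the root, an agent whose ancestors approach the root's position approaches this position or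
its antipode. The second case is unstable: if two trajectories have an agent trapped near the
antipode, with the agents above it near the root, then the differences of the agents above it do
not increase, whereas the difference at the trapped agent would grow forever if it were larger than
twice their sum. So, again by `volume_eq_zero_of_sub_mem`, the trapped positions are a null set.
-/

namespace CircleSync

/-! ### Null sets -/

variable {V : Type*} [Fintype V]

/-- A set whose differences all lie in a closed set `C` avoiding the punctured line `ℝ v` is
(contained in) a graph in the direction of `v`: the translates of its closure by multiples of `v`
are pairwise disjoint, so it is a null set. -/
theorem volume_eq_zero_of_sub_mem {S C : Set (V → ℝ)} (hC : IsClosed C) {v : V → ℝ}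
    (hv : ∀ t : ℝ, t ≠ 0 → t • v ∉ C) (hS : ∀ x ∈ S, ∀ y ∈ S, x - y ∈ C) :
    volume S = 0 := by
  have hcl : ∀ x ∈ closure S, ∀ y ∈ closure S, x - y ∈ C := by
    intro x hx y hy
    have h := map_mem_closure₂ (f := fun a b : V → ℝ => a - b) continuous_sub hx hy hS
    rwa [hC.closure_eq] at h
  refine measure_mono_null subset_closure ?_
  refine Measure.addHaar_eq_zero_of_disjoint_translates volume
    (fun n : ℕ => ((n : ℝ) + 1)⁻¹ • v) ?_ ?_ isClosed_closure.measurableSet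
  · refine (Metric.isBounded_closedBall (x := (0 : V → ℝ)) (r := ‖v‖)).subset ?_
    rintro _ ⟨n, rfl⟩
    simp only [Metric.mem_closedBall, dist_zero_right, norm_smul]
    have h1 : ‖((n : ℝ) + 1)⁻¹‖ ≤ 1 := by
      rw [norm_inv, Real.norm_of_nonneg (by positivity)]
      exact inv_le_one_of_one_le₀ (by linarith [n.cast_nonneg (α := ℝ)])
    nlinarith [norm_nonneg v]
  · intro m n hmn
    rw [Function.onFun, Set.disjoint_left]
    rintro _ ⟨_, rfl, x, hx, rfl⟩ ⟨_, rfl, y, hy, hxy⟩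
    have hne : ((n : ℝ) + 1)⁻¹ - ((m : ℝ) + 1)⁻¹ ≠ 0 := by
      rw [sub_ne_zero]
      intro h
      have h2 := inv_injective h
      apply hmn
      exact_mod_cast (add_right_cancel h2).symm
    apply hv _ hne
    have : (((n : ℝ) + 1)⁻¹ - ((m : ℝ) + 1)⁻¹) • v = x - y := by
      have h3 : ((n : ℝ) + 1)⁻¹ • v + y = ((m : ℝ) + 1)⁻¹ • v + x := hxy
      rw [sub_smul]
      linear_combination (exp := 1) h3
    rw [this]
    exact hcl x hx y hy

/-- The relation `R` ("`x` moves to `y`") reflects null sets: only a null set of points moves into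
a given null set. -/
def ReflectsNull (R : (V → ℝ) → (V → ℝ) → Prop) : Prop :=
  ∀ N : Set (V → ℝ), volume N = 0 → volume {x | ∃ y ∈ N, R x y} = 0

theorem ReflectsNull.mono {R R' : (V → ℝ) → (V → ℝ) → Prop} (h : ReflectsNull R)
    (hR : ∀ x y, R' x y → R x y) : ReflectsNull R' := fun N hN =>
  measure_mono_null (by rintro x ⟨y, hy, hxy⟩; exact ⟨y, hy, hR _ _ hxy⟩) (h N hN)

theorem ReflectsNull.comp {R R' : (V → ℝ) → (V → ℝ) → Prop} (h : ReflectsNull R)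
    (h' : ReflectsNull R') : ReflectsNull fun x z => ∃ y, R x y ∧ R' y z := fun N hN =>
  measure_mono_null (by rintro x ⟨z, hz, y, hxy, hyz⟩; exact ⟨y, ⟨z, hz, hyz⟩, hxy⟩)
    (h _ (h' N hN))

/-- Lipschitz maps of a subset of `V → ℝ` preserve null sets. -/
theorem volume_image_eq_zero_of_lipschitzOnWith {K : NNReal} {f : (V → ℝ) → V → ℝ}
    {N : Set (V → ℝ)} (hf : LipschitzOnWith K f N) (hN : volume N = 0) :
    volume (f '' N) = 0 := by
  have h := hf.hausdorffMeasure_image_le (d := Fintype.card V) (by positivity)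
  rw [← hausdorffMeasure_pi_real] at hN ⊢
  rw [hN, mul_zero] at h
  exact le_antisymm h bot_le

theorem reflectsNull_of_dist_le {R : (V → ℝ) → (V → ℝ) → Prop} (K : ℝ)
    (hR : ∀ x x' y y', R x x' → R y y' → dist x y ≤ K * dist x' y') : ReflectsNull R := by
  intro N hN
  classical
  let f : (V → ℝ) → V → ℝ := fun y => if h : ∃ x, R x y then h.choose else 0
  have hf : ∀ x y, R x y → R (f y) y := by
    intro x y h
    have h' : ∃ x, R x y := ⟨x, h⟩
    simp only [f, dif_pos h']
    exact h'.choose_spec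
  have hfx : ∀ x y, R x y → f y = x := by
    intro x y h
    have h1 := hR _ _ _ _ (hf x y h) h
    rw [dist_self, mul_zero] at h1
    exact dist_le_zero.1 h1
  have hsub : {x | ∃ y ∈ N, R x y} ⊆ f '' (N ∩ {y | ∃ x, R x y}) := by
    rintro x ⟨y, hy, hxy⟩
    exact ⟨y, ⟨hy, x, hxy⟩, hfx x y hxy⟩
  refine measure_mono_null hsub (volume_image_eq_zero_of_lipschitzOnWith (K := K.toNNReal) ?_
    (measure_mono_null Set.inter_subset_left hN))
  refine LipschitzOnWith.of_dist_le_mul ?_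
  rintro y ⟨-, x, hx⟩ y' ⟨-, x', hx'⟩
  rw [hfx _ _ hx, hfx _ _ hx']
  exact (hR _ _ _ _ hx hx').trans
    (mul_le_mul_of_nonneg_right (Real.le_coe_toNNReal K) dist_nonneg)

/-- Only a null set of initial conditions has a sequence of moves that reaches a null set at the
given time. -/
theorem volume_initial_eq_zero {R : ℕ → (V → ℝ) → (V → ℝ) → Prop} (hR : ∀ t, ReflectsNull (R t))
    (n : ℕ) {N : Set (V → ℝ)} (hN : volume N = 0) :
    volume {x₀ | ∃ x : ℕ → V → ℝ, x 0 = x₀ ∧ (∀ t, R t (x t) (x (t + 1))) ∧ x n ∈ N} = 0 := by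
  induction n generalizing N with
  | zero =>
    refine measure_mono_null ?_ hN
    rintro _ ⟨x, rfl, -, h⟩
    exact h
  | succ n ih =>
    refine measure_mono_null ?_ (ih (hR n N hN))
    rintro _ ⟨x, rfl, h1, h⟩
    exact ⟨x, rfl, h1, _, h, h1 n⟩

/-- A property of almost all real lifts of angular positions holds for almost all positions. -/
theorem ae_circle_of_ae_lift {P : (V → S1) → Prop}
    (h : ∀ᵐ x : V → ℝ, P fun k => (x k : S1)) : ∀ᵐ θ : V → S1, P θ := by
  let e := AddCircle.measurableEquivIoc (2 * Real.pi) 0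
  let g : S1 → ℝ := fun θ => (e θ : ℝ)
  have hmk : ∀ θ : S1, ((g θ : ℝ) : S1) = θ := fun θ => e.symm_apply_apply θ
  have hg : MeasurePreserving g volume
      (volume.restrict (Set.Ioc (0 : ℝ) (0 + 2 * Real.pi))) := by
    have h1 := AddCircle.measurePreserving_mk (2 * Real.pi) 0
    have hgm : Measurable g := measurable_subtype_coe.comp e.measurable
    refine ⟨hgm, ?_⟩
    rw [← h1.map_eq, Measure.map_map hgm h1.measurable]
    have : (g ∘ fun x : ℝ => (x : S1))
        =ᵐ[volume.restrict (Set.Ioc (0 : ℝ) (0 + 2 * Real.pi))] id := by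
      filter_upwards [ae_restrict_mem measurableSet_Ioc] with x hx
      exact congrArg Subtype.val (e.apply_symm_apply ⟨x, hx⟩)
    rw [Measure.map_congr this, Measure.map_id]
  have hp := measurePreserving_pi (fun _ : V => (volume : Measure S1)) _ fun _ => hg
  rw [← Measure.restrict_pi_pi] at hp
  have h2 := hp.quasiMeasurePreserving.ae (ae_restrict_of_ae h)
  filter_upwards [h2] with θ hθ
  simpa only [hmk] using hθ

end CircleSync

namespace CircleSync

/-! ### The potential and its landscape -/

namespace WeightedDigraph

variable {V : Type*}

theorem weight_eq_zero_left (G : WeightedDigraph V) {j k : V} (h : j ∉ G.verts) :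
    G.weight j k = 0 := by
  by_contra h'
  exact h (G.mem_left_of_weight_ne_zero j k h')

theorem weight_eq_zero_right (G : WeightedDigraph V) {j k : V} (h : k ∉ G.verts) :
    G.weight j k = 0 := by
  by_contra h'
  exact h (G.mem_right_of_weight_ne_zero j k h')

variable [Fintype V]

/-- The coupling torque `∑_j a_{jk} sin (x_j - x_k)` on agent `k`. -/
noncomputable def torque (G : WeightedDigraph V) (x : V → ℝ) (k : V) : ℝ :=
  ∑ j, G.weight j k * Real.sin (x j - x k)

/-- The potential `½ ∑_{j,k} a_{jk} cos (x_j - x_k)`, whose gradient is the torque if the graph is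
undirected. -/
noncomputable def potential (G : WeightedDigraph V) (x : V → ℝ) : ℝ :=
  1 / 2 * ∑ k, ∑ j, G.weight j k * Real.cos (x j - x k)

/-- The linearization of the torque at `p`, which is the Hessian of the potential if the graph is
undirected. -/
noncomputable def linTorque (G : WeightedDigraph V) (p : V → ℝ) : (V → ℝ) →ₗ[ℝ] (V → ℝ) where
  toFun u k := ∑ j, G.weight j k * (Real.cos (p j - p k) * (u j - u k))
  map_add' u v := by
    ext k
    simp only [Pi.add_apply, ← Finset.sum_add_distrib]
    exact Finset.sum_congr rfl fun j _ => by ring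
  map_smul' c u := by
    ext k
    simp only [Pi.smul_apply, smul_eq_mul, RingHom.id_apply, Finset.mul_sum]
    exact Finset.sum_congr rfl fun j _ => by ring

theorem linTorque_apply (G : WeightedDigraph V) (p u : V → ℝ) (k : V) :
    G.linTorque p u k = ∑ j, G.weight j k * (Real.cos (p j - p k) * (u j - u k)) := rfl

/-- In an undirected graph, the linearized torque is the negative of the graph Laplacian with
weights `a_{jk} cos (p_j - p_k)`. -/
theorem two_mul_dotProduct_linTorque {G : WeightedDigraph V} (hG : G.IsUndirected)
    (p d u : V → ℝ) : 2 * (d ⬝ᵥ G.linTorque p u) =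
      -∑ k, ∑ j, G.weight j k * (Real.cos (p j - p k) * ((d j - d k) * (u j - u k))) := by
  have h1 : d ⬝ᵥ G.linTorque p u =
      ∑ k, ∑ j, G.weight j k * (Real.cos (p j - p k) * (d k * (u j - u k))) := by
    simp only [dotProduct, linTorque_apply, Finset.mul_sum]
    exact Finset.sum_congr rfl fun k _ => Finset.sum_congr rfl fun j _ => by ring
  have h2 : d ⬝ᵥ G.linTorque p u =
      ∑ k, ∑ j, G.weight j k * (Real.cos (p j - p k) * (d j * (u k - u j))) := by
    rw [h1, Finset.sum_comm]
    refine Finset.sum_congr rfl fun k _ => Finset.sum_congr rfl fun j _ => ?_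
    rw [hG k j, ← Real.cos_neg, neg_sub]
  rw [two_mul]
  nth_rw 1 [h1]
  rw [h2, ← Finset.sum_add_distrib, ← Finset.sum_neg_distrib]
  refine Finset.sum_congr rfl fun k _ => ?_
  rw [← Finset.sum_add_distrib, ← Finset.sum_neg_distrib]
  exact Finset.sum_congr rfl fun j _ => by ring

theorem dotProduct_linTorque_comm {G : WeightedDigraph V} (hG : G.IsUndirected)
    (p d u : V → ℝ) : d ⬝ᵥ G.linTorque p u = u ⬝ᵥ G.linTorque p d := by
  have h1 := two_mul_dotProduct_linTorque hG p d u
  have h2 := two_mul_dotProduct_linTorque hG p u d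
  have : 2 * (d ⬝ᵥ G.linTorque p u) = 2 * (u ⬝ᵥ G.linTorque p d) := by
    rw [h1, h2]
    refine congrArg _ (Finset.sum_congr rfl fun k _ => Finset.sum_congr rfl fun j _ => by ring)
  linarith

theorem sum_torque_eq_zero {G : WeightedDigraph V} (hG : G.IsUndirected) (x : V → ℝ) :
    ∑ k, G.torque x k = 0 := by
  have h : ∑ k, G.torque x k = -∑ k, G.torque x k := by
    simp only [torque]
    conv_lhs => rw [Finset.sum_comm]
    rw [← Finset.sum_neg_distrib]
    refine Finset.sum_congr rfl fun k _ => ?_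
    rw [← Finset.sum_neg_distrib]
    refine Finset.sum_congr rfl fun j _ => ?_
    rw [hG k j, ← neg_sub (x j) (x k), Real.sin_neg]
    ring
  linarith

theorem torque_eq_zero (G : WeightedDigraph V) {k : V} (h : k ∉ G.verts) (x : V → ℝ) :
    G.torque x k = 0 :=
  Finset.sum_eq_zero fun j _ => by rw [G.weight_eq_zero_right h, zero_mul]

/-- The two properties of the potential on which convergence to consensus rests: it satisfies a
Łojasiewicz inequality with exponent `3 / 4` with respect to finitely many critical values, and all
its critical points other than the synchronized ones have a direction of strict increase to second
order. -/
structure HasSyncLandscape (G : WeightedDigraph V) : Prop where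
  isUndirected : G.IsUndirected
  lojasiewicz : ∃ (crit : Finset ℝ) (C : ℝ), ∀ x, ∃ v ∈ crit,
    |G.potential x - v| ^ 3 ≤ C * (∑ k, G.torque x k ^ 2) ^ 2
  saddle : ∀ x, (∀ k, G.torque x k = 0) →
    (∃ j ∈ G.verts, ∃ k ∈ G.verts, Real.cos (x j - x k) ≠ 1) →
      ∃ v : V → ℝ, 0 < v ⬝ᵥ G.linTorque x v

/-- The elementary inequality behind the exponent `3 / 4`. Here `ρ` is the modulus of the sum of
the positions in the complex plane, `S` measures the distance of the positions from a line, and `m`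
is the value `ρ` would take if they were on that line. -/
theorem exists_int_abs_sq_sub_sq_le {n ρ S : ℝ} {m : ℤ} (hn : 0 ≤ n) (hρ : 0 ≤ ρ) (hρn : ρ ≤ n)
    (hS : 0 ≤ S) (hm : |ρ - m| ≤ S) (hmn : |(m : ℝ)| ≤ n) :
    ∃ m' : ℤ, |(m' : ℝ)| ≤ n ∧
      |ρ ^ 2 - (m' : ℝ) ^ 2| ^ 3 ≤ (128 * n ^ 4 + 1) * (ρ ^ 4 * S ^ 2) := by
  rcases le_or_gt ρ S with h | h
  · refine ⟨0, by simpa using hn, ?_⟩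
    have h2 : ρ ^ 2 ≤ S ^ 2 := pow_le_pow_left₀ hρ h 2
    have h3 : ρ ^ 4 * ρ ^ 2 ≤ ρ ^ 4 * S ^ 2 := mul_le_mul_of_nonneg_left h2 (by positivity)
    have h4 : (0 : ℝ) ≤ 128 * n ^ 4 * (ρ ^ 4 * S ^ 2) := by positivity
    have h5 : |ρ ^ 2 - ((0 : ℤ) : ℝ) ^ 2| = ρ ^ 2 := by
      simp
    rw [h5]
    nlinarith
  · refine ⟨m, hmn, ?_⟩
    have hm0 : m ≠ 0 := by
      rintro rfl
      simp only [Int.cast_zero, sub_zero, abs_of_nonneg hρ] at hm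
      linarith
    have hm1 : (1 : ℝ) ≤ |(m : ℝ)| := by exact_mod_cast Int.one_le_abs hm0
    have hρ2 : 1 / 2 ≤ ρ := by
      have := abs_sub_abs_le_abs_sub (m : ℝ) ρ
      rw [abs_sub_comm] at hm
      rw [abs_of_nonneg hρ] at this
      linarith
    have h1 : |ρ ^ 2 - (m : ℝ) ^ 2| ≤ S * (2 * n) := by
      have : ρ ^ 2 - (m : ℝ) ^ 2 = (ρ - m) * (ρ + m) := by ring
      rw [this, abs_mul]
      refine mul_le_mul hm ?_ (abs_nonneg _) hS
      have := abs_add_le ρ m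
      rw [abs_of_nonneg hρ] at this
      linarith
    have h2 : |ρ ^ 2 - (m : ℝ) ^ 2| ^ 3 ≤ (S * (2 * n)) ^ 3 :=
      pow_le_pow_left₀ (abs_nonneg _) h1 3
    have h3 : (S * (2 * n)) ^ 3 ≤ 8 * n ^ 4 * S ^ 2 := by
      have : (0 : ℝ) ≤ 8 * n ^ 3 * S ^ 2 * (n - S) :=
        mul_nonneg (by positivity) (by linarith)
      nlinarith
    have h4 : (1 / 2) ^ 4 ≤ ρ ^ 4 := pow_le_pow_left₀ (by norm_num) hρ2 4
    have h5 : 8 * n ^ 4 * S ^ 2 * 1 ≤ 8 * n ^ 4 * S ^ 2 * (16 * ρ ^ 4) :=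
      mul_le_mul_of_nonneg_left (by linarith) (by positivity)
    have h6 : (0 : ℝ) ≤ ρ ^ 4 * S ^ 2 := by positivity
    nlinarith

/-- For a complete graph the potential is `c / 2 * (ρ² - n)`, where `ρ` is the modulus of the sum
`R` of the positions in the complex plane, and the torque on `k` is `c` times the component of `R`
normal to the position of `k`. At an equilibrium with `R ≠ 0` all positions lie on one line, which
makes `ρ` an integer; an agent opposite to `R`, or any agent if `R = 0`, provides the direction of
increase. -/
theorem hasSyncLandscape_of_isComplete {G : WeightedDigraph V} (hG : G.IsComplete) :
    G.HasSyncLandscape := by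
  classical
  obtain ⟨c, hc, hw⟩ := hG
  let s : Finset V := Finset.univ.filter (· ∈ G.verts)
  have hs : ∀ k, k ∈ s ↔ k ∈ G.verts := by simp [s]
  set n : ℝ := (s.card : ℝ) with hn
  -- `R = Rc + i Rs` is the sum of the positions in the complex plane, seen from agent `k` as
  -- `a + i b`
  let Rc : (V → ℝ) → ℝ := fun x => ∑ j ∈ s, Real.cos (x j)
  let Rs : (V → ℝ) → ℝ := fun x => ∑ j ∈ s, Real.sin (x j)
  let a : (V → ℝ) → V → ℝ := fun x k => ∑ j ∈ s, Real.cos (x j - x k)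
  let b : (V → ℝ) → V → ℝ := fun x k => ∑ j ∈ s, Real.sin (x j - x k)
  have ha : ∀ x k, a x k = Rc x * Real.cos (x k) + Rs x * Real.sin (x k) := by
    intro x k
    simp only [a, Rc, Rs, Real.cos_sub, Finset.sum_add_distrib, Finset.sum_mul]
  have hb : ∀ x k, b x k = Rs x * Real.cos (x k) - Rc x * Real.sin (x k) := by
    intro x k
    simp only [b, Rc, Rs, Real.sin_sub, Finset.sum_sub_distrib, Finset.sum_mul]
  have hab : ∀ x k, a x k ^ 2 + b x k ^ 2 = Rc x ^ 2 + Rs x ^ 2 := by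
    intro x k
    rw [ha, hb]
    linear_combination (Rc x ^ 2 + Rs x ^ 2) * Real.sin_sq_add_cos_sq (x k)
  have hsum_a : ∀ x, ∑ k ∈ s, a x k = Rc x ^ 2 + Rs x ^ 2 := by
    intro x
    simp only [ha, Finset.sum_add_distrib, ← Finset.mul_sum]
    simp only [Rc, Rs]
    ring
  have hsymm : G.IsUndirected := by
    intro j k
    by_cases hj : j ∈ G.verts
    · by_cases hk : k ∈ G.verts
      · rcases eq_or_ne j k with rfl | hjk
        · rfl
        · rw [hw j hj k hk hjk, hw k hk j hj hjk.symm]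
      · rw [G.weight_eq_zero_right hk, G.weight_eq_zero_left hk]
    · rw [G.weight_eq_zero_right hj, G.weight_eq_zero_left hj]
  -- sums against the weights
  have hwsum : ∀ (f : V → ℝ) (k : V), k ∈ s →
      ∑ j, G.weight j k * f j = c * (∑ j ∈ s, f j - f k) := by
    intro f k hk
    have h1 : ∑ j, G.weight j k * f j = ∑ j ∈ s, G.weight j k * f j := by
      refine (Finset.sum_subset (Finset.subset_univ s) fun j _ hj => ?_).symm
      rw [G.weight_eq_zero_left (by rwa [hs] at hj), zero_mul]
    rw [h1, ← Finset.add_sum_erase s _ hk, ← Finset.add_sum_erase s f hk, G.weight_self, zero_mul,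
      zero_add, add_sub_cancel_left, Finset.mul_sum]
    refine Finset.sum_congr rfl fun j hj => ?_
    rw [hw j ((hs j).1 (Finset.mem_of_mem_erase hj)) k ((hs k).1 hk) (Finset.ne_of_mem_erase hj)]
  have htorque : ∀ x k, k ∈ s → G.torque x k = c * b x k := by
    intro x k hk
    rw [torque, hwsum (fun j => Real.sin (x j - x k)) k hk]
    simp [b]
  have hpot : ∀ x, G.potential x = c / 2 * ((Rc x ^ 2 + Rs x ^ 2) - n) := by
    intro x
    have h1 : ∑ k, ∑ j, G.weight j k * Real.cos (x j - x k)
        = ∑ k ∈ s, ∑ j, G.weight j k * Real.cos (x j - x k) := by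
      refine (Finset.sum_subset (Finset.subset_univ s) fun k _ hk => ?_).symm
      refine Finset.sum_eq_zero fun j _ => ?_
      rw [G.weight_eq_zero_right (by rwa [hs] at hk), zero_mul]
    have h2 : ∑ k ∈ s, ∑ j, G.weight j k * Real.cos (x j - x k) = ∑ k ∈ s, c * (a x k - 1) := by
      refine Finset.sum_congr rfl fun k hk => ?_
      rw [hwsum (fun j => Real.cos (x j - x k)) k hk]
      simp [a]
    rw [potential, h1, h2, ← Finset.mul_sum, Finset.sum_sub_distrib, hsum_a, Finset.sum_const,
      nsmul_eq_mul, mul_one]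
    ring
  refine ⟨hsymm, ?_, ?_⟩
  · have hn0 : 0 ≤ n := by positivity
    refine ⟨(Finset.Icc (-(s.card : ℤ)) s.card).image fun m : ℤ => c / 2 * ((m : ℝ) ^ 2 - n),
      (c / 2) ^ 3 * (128 * n ^ 4 + 1) / c ^ 4, fun x => ?_⟩
    set ρ := Real.sqrt (Rc x ^ 2 + Rs x ^ 2) with hρdef
    have hρ0 : 0 ≤ ρ := Real.sqrt_nonneg _
    have hρ2 : ρ ^ 2 = Rc x ^ 2 + Rs x ^ 2 := Real.sq_sqrt (by positivity)
    have htsum : ∑ k, G.torque x k ^ 2 = c ^ 2 * ∑ k ∈ s, b x k ^ 2 := by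
      rw [Finset.mul_sum]
      symm
      refine (Finset.sum_congr rfl fun k hk => ?_).trans
        (Finset.sum_subset (Finset.subset_univ s) fun k _ hk => ?_)
      · rw [htorque x k hk]; ring
      · rw [G.torque_eq_zero (by rwa [hs] at hk)]; simp
    -- it suffices to estimate the square of the modulus
    have key : ∃ m' : ℤ, |(m' : ℝ)| ≤ n ∧ |ρ ^ 2 - (m' : ℝ) ^ 2| ^ 3
        ≤ (128 * n ^ 4 + 1) * (∑ k ∈ s, b x k ^ 2) ^ 2 := by
      rcases eq_or_lt_of_le hρ0 with h0 | hpos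
      · refine ⟨0, by simpa using hn0, ?_⟩
        have h1 : |ρ ^ 2 - ((0 : ℤ) : ℝ) ^ 2| ^ 3 = 0 := by rw [← h0]; simp
        rw [h1]
        positivity
      have hck : ∀ k, (a x k / ρ) ^ 2 + (b x k / ρ) ^ 2 = 1 := by
        intro k
        rw [div_pow, div_pow, ← add_div, hab, ← hρ2, div_self (by positivity)]
      -- `ε k = ±1` is the component along `R` of the nearest position on the line spanned by `R`
      let ε : V → ℤ := fun k => if 0 ≤ a x k / ρ then 1 else -1
      have hε : ∀ k, |(ε k : ℝ)| = 1 := by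
        intro k
        simp only [ε]
        split_ifs <;> simp
      have hdiff : ∀ k, |a x k / ρ - ε k| ≤ (b x k / ρ) ^ 2 := by
        intro k
        have h1 := hck k
        have h2 : (a x k / ρ) ^ 2 ≤ 1 := by nlinarith [sq_nonneg (b x k / ρ)]
        have h3 := abs_le.1 ((sq_le_one_iff_abs_le_one _).1 h2)
        simp only [ε]
        split_ifs with h
        · rw [abs_le]; push_cast; constructor <;> nlinarith
        · rw [abs_le]; push_cast; constructor <;> nlinarith
      have hsumρ : ∑ k ∈ s, a x k / ρ = ρ := by
        rw [← Finset.sum_div, hsum_a, ← hρ2]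
        field_simp
      have hSeq : ∑ k ∈ s, (b x k / ρ) ^ 2 = (∑ k ∈ s, b x k ^ 2) / ρ ^ 2 := by
        rw [Finset.sum_div]
        exact Finset.sum_congr rfl fun k _ => by rw [div_pow]
      have hcard : ∀ f : V → ℝ, (∀ k, f k ≤ 1) → ∑ k ∈ s, f k ≤ n := by
        intro f hf
        refine (Finset.sum_le_card_nsmul s f 1 fun k _ => hf k).trans ?_
        simp [hn]
      have h1 : ρ ≤ n := by
        rw [← hsumρ]
        refine hcard _ fun k => ?_
        nlinarith [hck k, sq_nonneg (b x k / ρ)]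
      have h2 : |ρ - ((∑ k ∈ s, ε k : ℤ) : ℝ)| ≤ ∑ k ∈ s, (b x k / ρ) ^ 2 := by
        nth_rw 1 [← hsumρ]
        push_cast
        rw [← Finset.sum_sub_distrib]
        exact (Finset.abs_sum_le_sum_abs _ _).trans (Finset.sum_le_sum fun k _ => hdiff k)
      have h3 : |((∑ k ∈ s, ε k : ℤ) : ℝ)| ≤ n := by
        push_cast
        exact (Finset.abs_sum_le_sum_abs _ _).trans (hcard _ fun k => (hε k).le)
      obtain ⟨m', hm', hle⟩ := exists_int_abs_sq_sub_sq_le hn0 hρ0 h1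
        (Finset.sum_nonneg fun _ _ => sq_nonneg _) h2 h3
      refine ⟨m', hm', hle.trans (le_of_eq ?_)⟩
      rw [hSeq]
      field_simp
    obtain ⟨m, hm, hle⟩ := key
    refine ⟨_, Finset.mem_image_of_mem _ (show m ∈ _ from Finset.mem_Icc.2 ?_), ?_⟩
    · rw [hn, abs_le] at hm
      exact ⟨by exact_mod_cast hm.1, by exact_mod_cast hm.2⟩
    · rw [hpot, ← hρ2, htsum]
      have h1 : c / 2 * (ρ ^ 2 - n) - c / 2 * ((m : ℝ) ^ 2 - n) =
          c / 2 * (ρ ^ 2 - (m : ℝ) ^ 2) := by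
        ring
      rw [h1, abs_mul, abs_of_pos (by positivity : 0 < c / 2), mul_pow]
      refine (mul_le_mul_of_nonneg_left hle (by positivity)).trans (le_of_eq ?_)
      field_simp
  · rintro x hx ⟨j₀, hj₀, k₀, hk₀, hne⟩
    have hb0 : ∀ k ∈ s, b x k = 0 := by
      intro k hk
      have := htorque x k hk
      rw [hx k] at this
      exact (mul_eq_zero.1 this.symm).resolve_left hc.ne'
    -- if no agent is opposite to `R`, then all of them have the direction of `R`
    by_cases hneg : ∃ k ∈ s, a x k ≤ 0
    · obtain ⟨k, hk, hak⟩ := hneg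
      refine ⟨Pi.single k 1, ?_⟩
      rw [single_one_dotProduct, linTorque_apply,
        hwsum (fun j => Real.cos (x j - x k) *
          ((Pi.single k 1 : V → ℝ) j - (Pi.single k 1 : V → ℝ) k)) k hk]
      have h1 : ∑ j ∈ s, Real.cos (x j - x k) *
          ((Pi.single k 1 : V → ℝ) j - (Pi.single k 1 : V → ℝ) k) = 1 - a x k := by
        have : ∀ j, Real.cos (x j - x k) *
            ((Pi.single k 1 : V → ℝ) j - (Pi.single k 1 : V → ℝ) k)
            = (if j = k then 1 else 0) - Real.cos (x j - x k) := by
          intro j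
          rcases eq_or_ne j k with rfl | h
          · simp
          · simp [h]
        simp only [this, Finset.sum_sub_distrib, a]
        simp [hk]
      rw [h1]
      have h2 : 0 < 1 - a x k := by linarith
      simpa using mul_pos hc h2
    · push Not at hneg
      exfalso
      apply hne
      have hj := (hs j₀).2 hj₀
      have hk := (hs k₀).2 hk₀
      have e1 := ha x j₀
      have e2 := ha x k₀
      have e3 := hb x j₀
      have e4 := hb x k₀
      rw [hb0 _ hj] at e3
      rw [hb0 _ hk] at e4
      have e5 := hab x j₀
      have e6 := hab x k₀
      rw [hb0 _ hj] at e5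
      rw [hb0 _ hk] at e6
      have haeq : a x j₀ = a x k₀ := by
        have h : a x j₀ ^ 2 = a x k₀ ^ 2 := by linarith
        exact (sq_eq_sq₀ (hneg _ hj).le (hneg _ hk).le).1 h
      have hpos := hneg _ hk
      have i1 : Rc x = a x k₀ * Real.cos (x k₀) := by
        rw [e2]
        linear_combination (-Rc x) * Real.sin_sq_add_cos_sq (x k₀) + Real.sin (x k₀) * e4
      have i2 : Rs x = a x k₀ * Real.sin (x k₀) := by
        rw [e2]
        linear_combination (-Rs x) * Real.sin_sq_add_cos_sq (x k₀) - Real.cos (x k₀) * e4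
      have i3 : a x k₀ * Real.cos (x j₀ - x k₀) = a x k₀ := by
        rw [Real.cos_sub, ← haeq]
        conv_rhs => rw [e1]
        rw [i1, i2, haeq]
        ring
      exact mul_left_cancel₀ hpos.ne' (by rw [i3, mul_one])

end WeightedDigraph

end CircleSync

namespace CircleSync

/-! ### Vertex-interconnections and trees -/

namespace WeightedDigraph

variable {V : Type*}

theorem IsVertexInterconnection.symm {G₁ G₂ G : WeightedDigraph V}
    (h : IsVertexInterconnection G₁ G₂ G) : IsVertexInterconnection G₂ G₁ G := by
  obtain ⟨⟨k, hk⟩, hv, hw⟩ := h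
  exact ⟨⟨k, by rw [Set.inter_comm, hk]⟩, by rw [hv, Set.union_comm],
    fun i j => by rw [hw, add_comm]⟩

variable [Fintype V]

theorem IsVertexInterconnection.torque_eq {G₁ G₂ G : WeightedDigraph V}
    (h : IsVertexInterconnection G₁ G₂ G) (x : V → ℝ) (k : V) :
    G.torque x k = G₁.torque x k + G₂.torque x k := by
  simp only [torque, h.2.2, add_mul, Finset.sum_add_distrib]

/-- Off the common vertex, the torques in `G₁` are those in `G`; on the common vertex they are
determined by the fact that the torques in `G₁` sum to zero. -/
theorem IsVertexInterconnection.sum_torque_sq_le {G₁ G₂ G : WeightedDigraph V}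
    (h : IsVertexInterconnection G₁ G₂ G) (h₁ : G₁.IsUndirected) (x : V → ℝ) :
    ∑ k, G₁.torque x k ^ 2 ≤ (1 + Fintype.card V) * ∑ k, G.torque x k ^ 2 := by
  classical
  obtain ⟨k, hk⟩ := h.1
  have hkv : k ∈ G₁.verts ∩ G₂.verts := by rw [hk]; rfl
  have hsq : ∀ l, l ≠ k → G₁.torque x l ^ 2 ≤ G.torque x l ^ 2 := by
    intro l hl
    by_cases hl1 : l ∈ G₁.verts
    · have hl2 : l ∉ G₂.verts := fun hl2 => hl (by
        have : l ∈ G₁.verts ∩ G₂.verts := ⟨hl1, hl2⟩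
        rwa [hk] at this)
      rw [h.torque_eq, G₂.torque_eq_zero hl2, add_zero]
    · rw [G₁.torque_eq_zero hl1]
      nlinarith [sq_nonneg (G.torque x l)]
  have hsum : ∑ l ∈ Finset.univ.erase k, G₁.torque x l ^ 2 ≤ ∑ l, G.torque x l ^ 2 :=
    (Finset.sum_le_sum fun l hl => hsq l (Finset.ne_of_mem_erase hl)).trans
      (Finset.sum_le_sum_of_subset_of_nonneg (Finset.erase_subset _ _) fun _ _ _ => sq_nonneg _)
  have hk1 : G₁.torque x k = -∑ l ∈ Finset.univ.erase k, G₁.torque x l := by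
    have := sum_torque_eq_zero h₁ x
    rw [← Finset.add_sum_erase _ _ (Finset.mem_univ k)] at this
    linarith
  have hk2 : G₁.torque x k ^ 2 ≤ Fintype.card V * ∑ l, G.torque x l ^ 2 := by
    rw [hk1, neg_sq]
    refine sq_sum_le_card_mul_sum_sq.trans (mul_le_mul ?_ hsum
      (Finset.sum_nonneg fun _ _ => sq_nonneg _) (by positivity))
    exact_mod_cast Finset.card_le_univ _
  rw [← Finset.add_sum_erase _ _ (Finset.mem_univ k)]
  linarith

/-- At an equilibrium of `G`, the torques in each of the two parts vanish separately. -/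
theorem IsVertexInterconnection.torque_eq_zero_left {G₁ G₂ G : WeightedDigraph V}
    (h : IsVertexInterconnection G₁ G₂ G) (h₁ : G₁.IsUndirected) {x : V → ℝ}
    (hx : ∀ k, G.torque x k = 0) (k : V) : G₁.torque x k = 0 := by
  have h2 := h.sum_torque_sq_le h₁ x
  simp only [hx] at h2
  have h3 : ∑ k, G₁.torque x k ^ 2 = 0 :=
    le_antisymm (by simpa using h2) (Finset.sum_nonneg fun _ _ => sq_nonneg _)
  have h4 := (Finset.sum_eq_zero_iff_of_nonneg fun _ _ => sq_nonneg _).1 h3 k (Finset.mem_univ k)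
  exact pow_eq_zero_iff two_ne_zero |>.1 h4

/-- A direction of increase for `G₁` becomes one for `G` if all agents outside `G₁` follow the
common vertex, since the potential of `G₂` does not change under a rotation. -/
theorem IsVertexInterconnection.exists_direction {G₁ G₂ G : WeightedDigraph V}
    (h : IsVertexInterconnection G₁ G₂ G) (h₁ : G₁.HasSyncLandscape) (h₂ : G₂.IsUndirected)
    {x : V → ℝ} (hx : ∀ k, G.torque x k = 0)
    (hne : ∃ j ∈ G₁.verts, ∃ k ∈ G₁.verts, Real.cos (x j - x k) ≠ 1) :
    ∃ v : V → ℝ, 0 < v ⬝ᵥ G.linTorque x v := by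
  classical
  obtain ⟨v, hv⟩ := h₁.saddle x (h.torque_eq_zero_left h₁.isUndirected hx) hne
  obtain ⟨k₀, hk₀⟩ := h.1
  have hG : G.IsUndirected := fun j k => by rw [h.2.2, h.2.2, h₁.isUndirected, h₂]
  refine ⟨fun l => if l ∈ G₁.verts then v l else v k₀, ?_⟩
  set v' : V → ℝ := fun l => if l ∈ G₁.verts then v l else v k₀ with hv'
  have e1 := two_mul_dotProduct_linTorque hG x v' v'
  have e2 := two_mul_dotProduct_linTorque h₁.isUndirected x v v
  suffices hs : 2 * (v' ⬝ᵥ G.linTorque x v') = 2 * (v ⬝ᵥ G₁.linTorque x v) by linarith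
  have hin2 : ∀ l ∈ G₂.verts, v' l = v k₀ := by
    intro l hl
    by_cases hl1 : l ∈ G₁.verts
    · have : l ∈ G₁.verts ∩ G₂.verts := ⟨hl1, hl⟩
      rw [hk₀] at this
      rw [Set.mem_singleton_iff] at this
      subst this
      simp [hv']
    · simp [hv', hl1]
  rw [e1, e2]
  refine congrArg _ (Finset.sum_congr rfl fun k _ => Finset.sum_congr rfl fun j _ => ?_)
  rw [h.2.2, add_mul]
  have z2 : G₂.weight j k * (Real.cos (x j - x k) * ((v' j - v' k) * (v' j - v' k))) = 0 := by
    by_cases hw : G₂.weight j k = 0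
    · rw [hw, zero_mul]
    · rw [hin2 j (G₂.mem_left_of_weight_ne_zero j k hw),
        hin2 k (G₂.mem_right_of_weight_ne_zero j k hw)]
      simp
  rw [z2, add_zero]
  by_cases hw : G₁.weight j k = 0
  · rw [hw, zero_mul, zero_mul]
  · simp [hv', G₁.mem_left_of_weight_ne_zero j k hw, G₁.mem_right_of_weight_ne_zero j k hw]

theorem cos_sub_eq_one_trans {a b c : ℝ} (h₁ : Real.cos (a - b) = 1) (h₂ : Real.cos (b - c) = 1) :
    Real.cos (a - c) = 1 := by
  have h3 : Real.sin (a - b) = 0 := by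
    have := Real.sin_sq_add_cos_sq (a - b)
    rw [h₁] at this
    nlinarith
  rw [show a - c = (a - b) + (b - c) by ring, Real.cos_add, h₁, h₂, h3]
  ring

theorem IsVertexInterconnection.hasSyncLandscape {G₁ G₂ G : WeightedDigraph V}
    (h : IsVertexInterconnection G₁ G₂ G) (h₁ : G₁.HasSyncLandscape)
    (h₂ : G₂.HasSyncLandscape) : G.HasSyncLandscape := by
  classical
  refine ⟨fun j k => by rw [h.2.2, h.2.2, h₁.isUndirected, h₂.isUndirected], ?_, ?_⟩
  · obtain ⟨crit₁, C₁, hŁ₁⟩ := h₁.lojasiewicz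
    obtain ⟨crit₂, C₂, hŁ₂⟩ := h₂.lojasiewicz
    refine ⟨Finset.image₂ (· + ·) crit₁ crit₂,
      4 * (|C₁| + |C₂|) * (1 + Fintype.card V) ^ 2, fun x => ?_⟩
    obtain ⟨v₁, hv₁, hle₁⟩ := hŁ₁ x
    obtain ⟨v₂, hv₂, hle₂⟩ := hŁ₂ x
    refine ⟨v₁ + v₂, Finset.mem_image₂_of_mem hv₁ hv₂, ?_⟩
    have hpot : G.potential x = G₁.potential x + G₂.potential x := by
      simp only [potential, h.2.2, add_mul, Finset.sum_add_distrib, mul_add]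
    have b₁ := h.sum_torque_sq_le h₁.isUndirected x
    have b₂ := h.symm.sum_torque_sq_le h₂.isUndirected x
    have aux : ∀ {A C S S' : ℝ}, A ≤ C * S ^ 2 → 0 ≤ S → S ≤ S' → A ≤ |C| * S' ^ 2 := by
      intro A C S S' h1 h2 h3
      refine h1.trans ?_
      exact mul_le_mul (le_abs_self C) (pow_le_pow_left₀ h2 h3 2) (sq_nonneg _) (abs_nonneg _)
    have c₁ := aux hle₁ (Finset.sum_nonneg fun _ _ => sq_nonneg _) b₁
    have c₂ := aux hle₂ (Finset.sum_nonneg fun _ _ => sq_nonneg _) b₂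
    set A := G₁.potential x - v₁
    set B := G₂.potential x - v₂
    have e1 : |G.potential x - (v₁ + v₂)| ≤ |A| + |B| := by
      rw [hpot, show G₁.potential x + G₂.potential x - (v₁ + v₂) = A + B by
        simp only [A, B]; ring]
      exact abs_add_le A B
    have e2 : |G.potential x - (v₁ + v₂)| ^ 3 ≤ (|A| + |B|) ^ 3 :=
      pow_le_pow_left₀ (abs_nonneg _) e1 3
    have e3 : (|A| + |B|) ^ 3 ≤ 4 * (|A| ^ 3 + |B| ^ 3) := by
      have := mul_nonneg (add_nonneg (abs_nonneg A) (abs_nonneg B)) (sq_nonneg (|A| - |B|))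
      nlinarith
    calc |G.potential x - (v₁ + v₂)| ^ 3 ≤ 4 * (|A| ^ 3 + |B| ^ 3) := e2.trans e3
      _ ≤ _ := by linarith
  · rintro x hx ⟨j, hj, k, hk, hne⟩
    by_cases n₁ : ∃ j ∈ G₁.verts, ∃ k ∈ G₁.verts, Real.cos (x j - x k) ≠ 1
    · exact h.exists_direction h₁ h₂.isUndirected hx n₁
    by_cases n₂ : ∃ j ∈ G₂.verts, ∃ k ∈ G₂.verts, Real.cos (x j - x k) ≠ 1
    · exact h.symm.exists_direction h₂ h₁.isUndirected hx n₂
    exfalso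
    push Not at n₁ n₂
    obtain ⟨l, hl⟩ := h.1
    have hl' : l ∈ G₁.verts ∩ G₂.verts := by rw [hl]; rfl
    rw [h.2.1] at hj hk
    apply hne
    refine cos_sub_eq_one_trans (b := x l) ?_ ?_
    · rcases hj with hj | hj
      · exact n₁ j hj l hl'.1
      · exact n₂ j hj l hl'.2
    · rcases hk with hk | hk
      · exact n₁ l hl'.1 k hk
      · exact n₂ l hl'.2 k hk

/-- An undirected tree is built from single edges, which are complete graphs, by
vertex-interconnection. -/
theorem IsUndirectedTree.hasSyncLandscape {G : WeightedDigraph V} (hG : G.IsUndirectedTree) :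
    G.HasSyncLandscape := by
  classical
  induction hn : G.verts.ncard using Nat.strong_induction_on generalizing G with
  | _ n ih =>
  obtain ⟨hsymm, htree⟩ := hG
  rcases subsingleton_or_nontrivial G.verts with hsub | hnt
  · refine hasSyncLandscape_of_isComplete ⟨1, one_pos, fun j hj k hk hjk => ?_⟩
    exact absurd (congrArg Subtype.val (Subsingleton.elim (⟨j, hj⟩ : G.verts) ⟨k, hk⟩)) hjk
  -- remove a leaf `v`, attached to `u`
  obtain ⟨⟨v, hvG⟩, hdeg⟩ := htree.exists_vert_degree_one_of_nontrivial
  obtain ⟨⟨u, huG⟩, hvu, huniq⟩ := SimpleGraph.degree_eq_one_iff_existsUnique_adj.1 hdeg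
  have hadj : ∀ {j k : V} (hj : j ∈ G.verts) (hk : k ∈ G.verts),
      G.toSimpleGraph.Adj ⟨j, hj⟩ ⟨k, hk⟩ ↔ G.weight j k ≠ 0 := by
    intro j k hj hk
    simp only [toSimpleGraph, SimpleGraph.fromRel_adj, Edge, hsymm k j, or_self, ne_eq,
      Subtype.mk.injEq, and_iff_right_iff_imp]
    rintro h rfl
    exact h (G.weight_self j)
  have hleaf : ∀ j, G.weight j v ≠ 0 → j = u := by
    intro j hj
    have hjG := G.mem_left_of_weight_ne_zero _ _ hj
    have := huniq ⟨j, hjG⟩ ((hadj hvG hjG).2 (by rwa [hsymm]))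
    exact congrArg Subtype.val this
  have hvu' : G.weight v u ≠ 0 := (hadj hvG huG).1 hvu
  have huv : u ≠ v := by
    rintro rfl
    exact hvu' (G.weight_self u)
  let G' : WeightedDigraph V :=
    { verts := G.verts \ {v}
      weight := fun j k => if j = v ∨ k = v then 0 else G.weight j k
      weight_nonneg := fun j k => by
        split_ifs
        exacts [le_rfl, G.weight_nonneg j k]
      weight_self := fun k => by simp [G.weight_self]
      mem_left_of_weight_ne_zero := fun j k h => by
        have h' : ¬ (j = v ∨ k = v) ∧ G.weight j k ≠ 0 := by simpa [and_assoc] using h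
        exact ⟨G.mem_left_of_weight_ne_zero j k h'.2, fun e => h'.1 (Or.inl e)⟩
      mem_right_of_weight_ne_zero := fun j k h => by
        have h' : ¬ (j = v ∨ k = v) ∧ G.weight j k ≠ 0 := by simpa [and_assoc] using h
        exact ⟨G.mem_right_of_weight_ne_zero j k h'.2, fun e => h'.1 (Or.inr e)⟩ }
  have hKmem : ∀ j k, (if j = v ∨ k = v then G.weight j k else 0) ≠ 0 →
      (j = v ∧ k = u) ∨ (j = u ∧ k = v) := by
    intro j k h
    have h' : (j = v ∨ k = v) ∧ G.weight j k ≠ 0 := by simpa using h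
    rcases h' with ⟨rfl | rfl, h2⟩
    · exact Or.inl ⟨rfl, hleaf k (by rwa [hsymm])⟩
    · exact Or.inr ⟨hleaf j h2, rfl⟩
  let K : WeightedDigraph V :=
    { verts := {v, u}
      weight := fun j k => if j = v ∨ k = v then G.weight j k else 0
      weight_nonneg := fun j k => by
        split_ifs
        exacts [G.weight_nonneg j k, le_rfl]
      weight_self := fun k => by simp [G.weight_self]
      mem_left_of_weight_ne_zero := fun j k h => by
        rcases hKmem j k h with ⟨rfl, rfl⟩ | ⟨rfl, rfl⟩ <;> simp
      mem_right_of_weight_ne_zero := fun j k h => by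
        rcases hKmem j k h with ⟨rfl, rfl⟩ | ⟨rfl, rfl⟩ <;> simp }
  have hint : IsVertexInterconnection G' K G := by
    refine ⟨⟨u, ?_⟩, ?_, fun i j => ?_⟩
    · ext l
      simp only [G', K, Set.mem_inter_iff, Set.mem_sdiff, Set.mem_singleton_iff,
        Set.mem_insert_iff]
      constructor
      · rintro ⟨⟨-, h1⟩, h2⟩
        exact h2.resolve_left h1
      · rintro rfl
        exact ⟨⟨huG, huv⟩, Or.inr rfl⟩
    · ext l
      simp only [G', K, Set.mem_union, Set.mem_sdiff, Set.mem_singleton_iff, Set.mem_insert_iff]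
      constructor
      · intro hl
        by_cases e : l = v
        · exact Or.inr (Or.inl e)
        · exact Or.inl ⟨hl, e⟩
      · rintro (h | rfl | rfl)
        exacts [h.1, hvG, huG]
    · simp only [G', K]
      split_ifs <;> simp
  have hK : K.IsComplete := by
    refine ⟨G.weight v u, lt_of_le_of_ne (G.weight_nonneg _ _) hvu'.symm, ?_⟩
    intro j hj k hk hjk
    simp only [K, Set.mem_insert_iff, Set.mem_singleton_iff] at hj hk ⊢
    rcases hj with rfl | rfl <;> rcases hk with rfl | rfl
    · exact absurd rfl hjk
    · simp
    · simp [hsymm j k]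
    · exact absurd rfl hjk
  refine hint.hasSyncLandscape (ih _ ?_ ⟨?_, ?_⟩ rfl) (hasSyncLandscape_of_isComplete hK)
  · rw [← hn]
    exact Set.ncard_sdiff_singleton_lt_of_mem hvG
  · intro j k
    simp only [G', hsymm j k, or_comm]
  · have hconn := htree.connected.induce_compl_singleton_of_degree_eq_one hdeg
    have hw : ∀ {j k : V}, j ∈ G'.verts → k ∈ G'.verts → G'.weight j k = G.weight j k := by
      intro j k hj hk
      have h1 : j ≠ v := hj.2
      have h2 : k ≠ v := hk.2
      simp [G', h1, h2]
    have hadj' : ∀ {j k : V} (hj : j ∈ G'.verts) (hk : k ∈ G'.verts),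
        G'.toSimpleGraph.Adj ⟨j, hj⟩ ⟨k, hk⟩ ↔ G.weight j k ≠ 0 := by
      intro j k hj hk
      simp only [toSimpleGraph, SimpleGraph.fromRel_adj, Edge, hw hj hk, hw hk hj, hsymm k j,
        or_self, ne_eq, Subtype.mk.injEq, and_iff_right_iff_imp]
      rintro h rfl
      exact h (G.weight_self j)
    refine ⟨?_, ?_⟩
    · let f : G.toSimpleGraph.induce {⟨v, hvG⟩}ᶜ →g G'.toSimpleGraph :=
        { toFun := fun j => ⟨j.1.1, j.1.2, fun e => j.2 (Subtype.ext e)⟩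
          map_rel' := fun {j k} h => (hadj' _ _).2 ((hadj j.1.2 k.1.2).1 h) }
      refine hconn.map f ?_
      rintro ⟨j, hj⟩
      exact ⟨⟨⟨j, hj.1⟩, fun e => hj.2 (congrArg Subtype.val e)⟩, rfl⟩
    · let f : G'.toSimpleGraph →g G.toSimpleGraph :=
        { toFun := fun j => ⟨j.1, j.2.1⟩
          map_rel' := fun {j k} h => (hadj j.2.1 k.2.1).2 ((hadj' j.2 k.2).1 h) }
      refine htree.isAcyclic.comap f ?_
      intro j k h
      have h' : (f j).1 = (f k).1 := congrArg Subtype.val h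
      exact Subtype.ext h'

theorem IsTreeCompleteInterconnection.hasSyncLandscape {G : WeightedDigraph V}
    (hG : G.IsTreeCompleteInterconnection) : G.HasSyncLandscape := by
  induction hG with
  | tree G h => exact h.hasSyncLandscape
  | complete G h => exact hasSyncLandscape_of_isComplete h
  | interconnection G₁ G₂ G h _ _ ih₁ ih₂ => exact h.hasSyncLandscape ih₁ ih₂

end WeightedDigraph

end CircleSync

namespace CircleSync

/-! ### Finite length from a Łojasiewicz inequality -/

/-- If a bounded quantity `φ` gains at least `c D²` in each step, and satisfies the Łojasiewicz
inequality `|φ - v|³ ≤ C D⁴` with critical values `v` in a finite set, then the lengths `D` are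
summable: in the long run `v` is the limit of `φ`, and `D` is bounded by the decrease of
`(v - φ) ^ (1 / 4)`. -/
theorem summable_of_lojasiewicz {φ D : ℕ → ℝ} {crit : Finset ℝ} {c C B : ℝ} (hc : 0 < c)
    (hD : ∀ n, 0 ≤ D n) (hφ : ∀ n, c * D n ^ 2 ≤ φ (n + 1) - φ n) (hB : ∀ n, φ n ≤ B)
    (hL : ∀ n, ∃ v ∈ crit, |φ n - v| ^ 3 ≤ C * D n ^ 4) : Summable D := by
  have hmono : Monotone φ := monotone_nat_of_le_succ fun n => by
    have := hφ n
    have h2 : 0 ≤ c * D n ^ 2 := by positivity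
    linarith
  obtain ⟨L, hlim⟩ : ∃ L, Tendsto φ atTop (𝓝 L) :=
    ⟨_, tendsto_atTop_ciSup hmono ⟨B, by rintro _ ⟨n, rfl⟩; exact hB n⟩⟩
  have hφL : ∀ n, φ n ≤ L := hmono.ge_of_tendsto hlim
  have hD2 : Tendsto (fun n => D n ^ 2) atTop (𝓝 0) := by
    have h1 : Tendsto (fun n => (φ (n + 1) - φ n) / c) atTop (𝓝 0) := by
      simpa using ((hlim.comp (tendsto_add_atTop_nat 1)).sub hlim).div_const c
    refine squeeze_zero (fun n => sq_nonneg _) (fun n => ?_) h1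
    rw [le_div_iff₀ hc]
    linarith [hφ n]
  choose v hv hle using hL
  have hvlim : Tendsto v atTop (𝓝 L) := by
    have h1 : Tendsto (fun n => |φ n - v n| ^ 3) atTop (𝓝 0) := by
      have h2 : Tendsto (fun n => C * D n ^ 4) atTop (𝓝 0) := by
        have := (hD2.mul hD2).const_mul C
        simp only [mul_zero] at this
        exact this.congr fun n => by ring
      exact squeeze_zero (fun n => by positivity) hle h2
    have h3 : Tendsto (fun n => |φ n - v n|) atTop (𝓝 0) := by
      rw [Metric.tendsto_atTop] at h1 ⊢
      intro ε hε
      obtain ⟨N, hN⟩ := h1 (ε ^ 3) (by positivity)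
      refine ⟨N, fun n hn => ?_⟩
      have := hN n hn
      rw [Real.dist_eq, sub_zero, abs_of_nonneg (by positivity)] at this ⊢
      exact lt_of_pow_lt_pow_left₀ 3 hε.le this
    have h4 := hlim.sub ((tendsto_zero_iff_abs_tendsto_zero _).2 h3)
    simpa using h4
  -- critical values form a finite set, so those approached are eventually the limit
  have hev : ∀ᶠ n in atTop, v n = L := by
    have hcl : IsClosed ((crit.erase L : Finset ℝ) : Set ℝ) := (crit.erase L).finite_toSet.isClosed
    have := hvlim.eventually (hcl.isOpen_compl.mem_nhds (by simp))
    filter_upwards [this] with n hn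
    by_contra hne
    exact hn (by simp [hne, hv n])
  obtain ⟨N, hN⟩ := eventually_atTop.1 hev
  -- `D` is bounded by a telescoping difference of `w = (L - φ) ^ (1 / 4)`
  set w : ℕ → ℝ := fun n => Real.sqrt (Real.sqrt (L - φ n)) with hw
  have hw0 : ∀ n, 0 ≤ w n := fun n => Real.sqrt_nonneg _
  have hw4 : ∀ n, w n ^ 4 = L - φ n := fun n => by
    have h1 : w n ^ 4 = (w n ^ 2) ^ 2 := by ring
    rw [h1, hw]
    dsimp only
    rw [Real.sq_sqrt (Real.sqrt_nonneg _), Real.sq_sqrt (by linarith [hφL n])]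
  have hwanti : ∀ n, w (n + 1) ≤ w n := fun n =>
    Real.sqrt_le_sqrt (Real.sqrt_le_sqrt (by linarith [hmono n.le_succ]))
  set C' : ℝ := |C| + 1 with hC'
  have hC'1 : 1 ≤ C' := by rw [hC']; linarith [abs_nonneg C]
  have hw3 : ∀ n, N ≤ n → w n ^ 3 ≤ C' * D n := by
    intro n hn
    have h1 := hle n
    rw [hN n hn, abs_sub_comm, abs_of_nonneg (by linarith [hφL n]), ← hw4] at h1
    have h2 : (w n ^ 3) ^ 4 ≤ (C' * D n) ^ 4 := by
      calc (w n ^ 3) ^ 4 = (w n ^ 4) ^ 3 := by ring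
        _ ≤ C * D n ^ 4 := h1
        _ ≤ C' ^ 4 * D n ^ 4 := by
          refine mul_le_mul_of_nonneg_right ?_ (by have := hD n; positivity)
          have h3 : C ≤ C' := by rw [hC']; linarith [le_abs_self C]
          exact h3.trans (le_self_pow₀ hC'1 (by norm_num))
        _ = (C' * D n) ^ 4 := by ring
    exact le_of_pow_le_pow_left₀ (by norm_num) (by have := hD n; positivity) h2
  have hstep : ∀ n, N ≤ n → D n ≤ 4 * C' / c * (w n - w (n + 1)) := by
    intro n hn
    have h1 := hw3 n hn
    have h2 : c * D n ^ 2 ≤ w n ^ 4 - w (n + 1) ^ 4 := by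
      rw [hw4, hw4]; linarith [hφ n]
    have h3 : w n ^ 4 - w (n + 1) ^ 4 ≤ 4 * w n ^ 3 * (w n - w (n + 1)) := by
      have := hwanti n
      have h4 := hw0 (n + 1)
      have h5 : w (n + 1) ^ 3 ≤ w n ^ 3 := pow_le_pow_left₀ h4 this 3
      have h6 : w (n + 1) ^ 2 ≤ w n ^ 2 := pow_le_pow_left₀ h4 this 2
      have h7 : w n ^ 4 - w (n + 1) ^ 4 = (w n - w (n + 1)) *
        (w n ^ 3 + w n * (w n * w (n + 1)) + w n * w (n + 1) ^ 2 + w (n + 1) ^ 3) := by ring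
      rw [h7, mul_comm]
      refine mul_le_mul_of_nonneg_right ?_ (by linarith)
      have h8 := hw0 n
      have h9 : w n * (w n * w (n + 1)) ≤ w n * (w n * w n) := by gcongr
      have h10 : w n * w (n + 1) ^ 2 ≤ w n * w n ^ 2 := by gcongr
      nlinarith
    have h4 : 4 * w n ^ 3 * (w n - w (n + 1)) ≤ 4 * (C' * D n) * (w n - w (n + 1)) := by
      refine mul_le_mul_of_nonneg_right (by linarith) (by linarith [hwanti n])
    rcases eq_or_lt_of_le (hD n) with h0 | hpos
    · rw [← h0]
      exact mul_nonneg (by positivity) (by linarith [hwanti n])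
    · rw [div_mul_eq_mul_div, le_div_iff₀ hc]
      nlinarith
  rw [← summable_nat_add_iff N]
  refine summable_of_sum_range_le (fun n => hD _) (c := 4 * C' / c * w N) fun n => ?_
  calc ∑ i ∈ Finset.range n, D (i + N)
      ≤ ∑ i ∈ Finset.range n, 4 * C' / c * (w (i + N) - w (i + 1 + N)) :=
        Finset.sum_le_sum fun i _ => by
          have := hstep (i + N) (by omega)
          rwa [show i + N + 1 = i + 1 + N by omega] at this
    _ = 4 * C' / c * (w (0 + N) - w (n + N)) := by
        rw [← Finset.mul_sum, Finset.sum_range_sub' (fun i => w (i + N))]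
    _ ≤ 4 * C' / c * w N := by
        refine mul_le_mul_of_nonneg_left ?_ (by positivity)
        rw [zero_add]
        linarith [hw0 (n + N)]

/-! ### Growth in a cone -/

section Cone

variable {V : Type*} [Fintype V]

theorem abs_dotProduct_le (d e : V → ℝ) : |d ⬝ᵥ e| ≤ Fintype.card V * (‖d‖ * ‖e‖) := by
  calc |d ⬝ᵥ e| ≤ ∑ k, |d k * e k| := Finset.abs_sum_le_sum_abs _ _
    _ ≤ ∑ _k : V, ‖d‖ * ‖e‖ := Finset.sum_le_sum fun k _ => by
        rw [abs_mul]
        exact mul_le_mul (norm_le_pi_norm d k) (norm_le_pi_norm e k) (abs_nonneg _)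
          (norm_nonneg _)
    _ = _ := by simp

theorem exists_norm_linearMap_le (H : (V → ℝ) →ₗ[ℝ] (V → ℝ)) :
    ∃ K, 0 ≤ K ∧ ∀ u, ‖H u‖ ≤ K * ‖u‖ :=
  ⟨‖LinearMap.toContinuousLinearMap H‖, norm_nonneg _,
    fun u => (LinearMap.toContinuousLinearMap H).le_opNorm u⟩

/-- A symmetric form is bounded by `‖H u‖²`, since it depends on `u` only modulo the kernel of
`H`. -/
theorem exists_dotProduct_le_norm_sq (H : (V → ℝ) →ₗ[ℝ] (V → ℝ))
    (hH : ∀ d u, d ⬝ᵥ H u = u ⬝ᵥ H d) : ∃ C, 0 ≤ C ∧ ∀ u, u ⬝ᵥ H u ≤ C * ‖H u‖ ^ 2 := by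
  obtain ⟨g, hg⟩ := H.rangeRestrict.exists_rightInverse_of_surjective H.range_rangeRestrict
  let g' := LinearMap.toContinuousLinearMap g
  refine ⟨Fintype.card V * ‖g'‖, by positivity, fun u => ?_⟩
  have h1 : H (g (H.rangeRestrict u)) = H u := by
    have := LinearMap.congr_fun hg (H.rangeRestrict u)
    exact congrArg Subtype.val this
  have h2 : ‖g (H.rangeRestrict u)‖ ≤ ‖g'‖ * ‖H u‖ := g'.le_opNorm (H.rangeRestrict u)
  calc u ⬝ᵥ H u = g (H.rangeRestrict u) ⬝ᵥ H u := by rw [← h1, hH, h1]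
    _ ≤ Fintype.card V * (‖g (H.rangeRestrict u)‖ * ‖H u‖) :=
        (le_abs_self _).trans (abs_dotProduct_le _ _)
    _ ≤ Fintype.card V * ((‖g'‖ * ‖H u‖) * ‖H u‖) := by gcongr
    _ = _ := by ring

/-- Growth in the cone `η ‖u‖² ≤ u ⬝ H u`. The form `u ⬝ H u` grows by `c D²` in a step of length
at most `D`, up to errors controlled by `δ`. As `‖H u‖` is bounded by `D`, so is `u ⬝ H u`, and
therefore `‖u‖` is at most of order `D / √η` in the cone; this makes the change of `η ‖u‖²` of order
`√η D²`, less than `c D²` for small `η`. -/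
theorem exists_cone_growth (H : (V → ℝ) →ₗ[ℝ] (V → ℝ)) (hH : ∀ d u, d ⬝ᵥ H u = u ⬝ᵥ H d)
    {c K : ℝ} (hc : 0 < c) (hK : 0 ≤ K) :
    ∃ η₀ > 0, ∀ η, 0 < η → η ≤ η₀ → ∃ δ₀ > 0, ∃ κ > 1, ∀ δ u₀ u₁ D, 0 ≤ δ → δ ≤ δ₀ → 0 ≤ D →
      u₀ ⬝ᵥ H u₀ + c * D ^ 2 - δ * K * D * (‖u₀‖ + D) ≤ u₁ ⬝ᵥ H u₁ →
      ‖u₁ - u₀‖ ≤ D → ‖H u₀‖ ≤ K * (D + δ * (‖u₀‖ + D)) →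
      0 ≤ u₀ ⬝ᵥ H u₀ - η * ‖u₀‖ ^ 2 →
        κ * (u₀ ⬝ᵥ H u₀ - η * ‖u₀‖ ^ 2) ≤ u₁ ⬝ᵥ H u₁ - η * ‖u₁‖ ^ 2 := by
  obtain ⟨C₀, hC₀, hq⟩ := exists_dotProduct_le_norm_sq H hH
  set A := C₀ * K ^ 2 with hA
  have hA0 : 0 ≤ A := by positivity
  set M := 4 * Real.sqrt A with hM
  have hM0 : 0 ≤ M := by positivity
  have hM2 : M ^ 2 = 16 * A := by rw [hM, mul_pow, Real.sq_sqrt hA0]; norm_num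
  set ζ₀ := min 1 (c / (4 * (2 * M + 1))) with hζ₀
  have hζ₀pos : 0 < ζ₀ := lt_min one_pos (by positivity)
  refine ⟨ζ₀ ^ 2, by positivity, fun η hη hηle => ?_⟩
  obtain ⟨ζ, hζ, rfl⟩ : ∃ ζ, 0 < ζ ∧ ζ ^ 2 = η :=
    ⟨Real.sqrt η, Real.sqrt_pos.2 hη, Real.sq_sqrt hη.le⟩
  have hζle : ζ ≤ ζ₀ := le_of_pow_le_pow_left₀ two_ne_zero hζ₀pos.le hηle
  have hζ1 : ζ ≤ 1 := hζle.trans (min_le_left _ _)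
  have hζM : ζ * (2 * M + 1) ≤ c / 4 := by
    have h1 : ζ ≤ c / (4 * (2 * M + 1)) := hζle.trans (min_le_right _ _)
    rw [le_div_iff₀ (by positivity)] at h1
    linarith
  set E := K * (M / ζ + 1) with hE
  have hE0 : 0 ≤ E := by positivity
  refine ⟨min 1 (min (ζ / (M + 1)) (c / (4 * (E + 1)))),
    lt_min one_pos (lt_min (by positivity) (by positivity)), 1 + c / 2 / (M ^ 2 + 1),
    by have : 0 < c / 2 / (M ^ 2 + 1) := by positivity
       linarith, ?_⟩
  intro δ u₀ u₁ D hδ hδle hD h1 h2 h3 h4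
  set U := ‖u₀‖ with hU
  have hU0 : 0 ≤ U := norm_nonneg _
  set q₀ := u₀ ⬝ᵥ H u₀
  set q₁ := u₁ ⬝ᵥ H u₁
  have hδ1 : δ ≤ 1 := hδle.trans (min_le_left _ _)
  have hδM : δ * (M + 1) ≤ ζ := by
    have : δ ≤ ζ / (M + 1) := hδle.trans ((min_le_right _ _).trans (min_le_left _ _))
    rwa [le_div_iff₀ (by positivity)] at this
  have hδE : δ * (E + 1) ≤ c / 4 := by
    have : δ ≤ c / (4 * (E + 1)) := hδle.trans ((min_le_right _ _).trans (min_le_right _ _))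
    rw [le_div_iff₀ (by positivity)] at this
    linarith
  -- the form is bounded by the step
  have h5 : ‖H u₀‖ ≤ K * (2 * D + δ * U) := by
    refine h3.trans (mul_le_mul_of_nonneg_left ?_ hK)
    have := mul_le_of_le_one_left hD hδ1
    linarith
  have h6 : q₀ ≤ A * (8 * D ^ 2 + 2 * (δ * U) ^ 2) := by
    calc q₀ ≤ C₀ * ‖H u₀‖ ^ 2 := hq u₀
      _ ≤ C₀ * (K * (2 * D + δ * U)) ^ 2 := by gcongr
      _ = A * (2 * D + δ * U) ^ 2 := by rw [hA]; ring
      _ ≤ A * (8 * D ^ 2 + 2 * (δ * U) ^ 2) := by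
        refine mul_le_mul_of_nonneg_left ?_ hA0
        have := sq_nonneg (2 * D - δ * U)
        linarith
  have h7 : A * (2 * (δ * U) ^ 2) ≤ ζ ^ 2 * U ^ 2 / 2 := by
    have h8 : (δ * M) ^ 2 ≤ ζ ^ 2 := by
      refine pow_le_pow_left₀ (by positivity) ?_ 2
      linarith
    have h9 : A * (2 * (δ * U) ^ 2) = (δ * M) ^ 2 * U ^ 2 / 8 := by
      rw [mul_pow δ M, hM2]; ring
    rw [h9]
    have e1 := mul_le_mul_of_nonneg_right h8 (sq_nonneg U)
    have e2 := mul_nonneg (sq_nonneg ζ) (sq_nonneg U)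
    linarith
  have h8 : (ζ * U) ^ 2 ≤ (M * D) ^ 2 := by
    rw [mul_pow, mul_pow, hM2]
    linarith
  have h9 : ζ * U ≤ M * D := le_of_pow_le_pow_left₀ two_ne_zero (by positivity) h8
  have h10 : U ≤ M / ζ * D := by
    rw [div_mul_eq_mul_div, le_div_iff₀ hζ]
    linarith
  have h11 : q₀ ≤ M ^ 2 * D ^ 2 := by
    rw [mul_pow, mul_pow] at h8
    rw [hM2] at h8 ⊢
    linarith
  -- the change of `‖u‖²` is dominated by the growth of the form
  have h12 : ‖u₁‖ ^ 2 ≤ (U + D) ^ 2 := by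
    refine pow_le_pow_left₀ (norm_nonneg _) ?_ 2
    have := norm_le_norm_add_norm_sub' u₁ u₀
    linarith
  have h13 : ζ ^ 2 * ‖u₁‖ ^ 2 ≤ ζ ^ 2 * U ^ 2 + c / 4 * D ^ 2 := by
    have e1 : ζ ^ 2 * ‖u₁‖ ^ 2 ≤ ζ ^ 2 * (U + D) ^ 2 :=
      mul_le_mul_of_nonneg_left h12 (sq_nonneg ζ)
    have e2 : ζ * D * (ζ * U) ≤ ζ * D * (M * D) :=
      mul_le_mul_of_nonneg_left h9 (by positivity)
    have e3 : ζ ^ 2 * D ^ 2 ≤ ζ * D ^ 2 :=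
      mul_le_mul_of_nonneg_right (by rw [sq]; exact mul_le_of_le_one_right hζ.le hζ1)
        (sq_nonneg D)
    have e4 := mul_le_mul_of_nonneg_right hζM (sq_nonneg D)
    linarith
  have h14 : δ * K * D * (U + D) ≤ c / 4 * D ^ 2 := by
    have e1 : δ * K * D * (U + D) ≤ δ * K * D * (M / ζ * D + D) :=
      mul_le_mul_of_nonneg_left (by linarith) (by positivity)
    have e2 : δ * K * D * (M / ζ * D + D) = δ * E * D ^ 2 := by rw [hE]; ring
    have e3 : δ * E * D ^ 2 ≤ c / 4 * D ^ 2 :=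
      mul_le_mul_of_nonneg_right (by linarith) (sq_nonneg D)
    linarith
  have h15 : c / 2 / (M ^ 2 + 1) * (q₀ - ζ ^ 2 * U ^ 2) ≤ c / 2 * D ^ 2 := by
    rw [div_mul_eq_mul_div, div_le_iff₀ (by positivity), mul_assoc]
    refine mul_le_mul_of_nonneg_left ?_ (by positivity)
    have e1 := mul_nonneg (sq_nonneg ζ) (sq_nonneg U)
    have e2 : 0 ≤ D ^ 2 := sq_nonneg D
    linarith
  linarith

theorem not_bddAbove_of_growth {f : ℕ → ℝ} {κ B : ℝ} (hκ : 1 < κ) (h0 : 0 < f 0)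
    (hf : ∀ n, 0 ≤ f n → κ * f n ≤ f (n + 1)) (hB : ∀ n, f n ≤ B) : False := by
  have h : ∀ n, κ ^ n * f 0 ≤ f n := by
    intro n
    induction n with
    | zero => simp
    | succ n ih =>
      have h1 : 0 ≤ κ ^ n * f 0 := by positivity
      have h2 := hf n (h1.trans ih)
      calc κ ^ (n + 1) * f 0 = κ * (κ ^ n * f 0) := by ring
        _ ≤ κ * f n := by gcongr
        _ ≤ _ := h2
  obtain ⟨n, hn⟩ := pow_unbounded_of_one_lt (B / f 0) hκ
  rw [div_lt_iff₀ h0] at hn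
  linarith [h n, hB n]

end Cone

end CircleSync

namespace CircleSync

/-! ### Real lifts of the discrete-time algorithm -/

variable {V : Type*} [Fintype V]

/-- A step of the discrete-time algorithm from `x` to `x'` in real lifts of the angular positions,
in which each lift moves by at most `π`: the new position `y = x'_k` of an updated agent maximizes
`∑_j a_{jk} cos (x_j - y) + β cos (x_k - y)` and, in particular, is a critical point. -/
structure IsLiftedStep (G : WeightedDigraph V) (β : ℝ) (s : Set V) (x x' : V → ℝ) : Prop where
  critical : ∀ k ∈ s, β * Real.sin (x' k - x k) = ∑ j, G.weight j k * Real.sin (x j - x' k)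
  maximal : ∀ k ∈ s, ∀ y : ℝ, ∑ j, G.weight j k * Real.cos (x j - y) + β * Real.cos (x k - y) ≤
    ∑ j, G.weight j k * Real.cos (x j - x' k) + β * Real.cos (x k - x' k)
  abs_sub_le : ∀ k, |x' k - x k| ≤ Real.pi
  eq_of_notMem : ∀ k ∉ s, x' k = x k

/-- A sequence of lifted steps. -/
def IsLiftedSolution (G : WeightedDigraph V) (β : ℝ) (σ : ℕ → Set V) (x : ℕ → V → ℝ) : Prop :=
  ∀ t, IsLiftedStep G β (σ t) (x t) (x (t + 1))

theorem exists_lift_abs_le_pi (s : S1) : ∃ r : ℝ, (r : S1) = s ∧ |r| ≤ Real.pi := by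
  have h := (AddCircle.equivIoc (2 * Real.pi) (-Real.pi) s).2
  refine ⟨_, (AddCircle.equivIoc (2 * Real.pi) (-Real.pi)).symm_apply_apply s, ?_⟩
  rw [abs_le]
  exact ⟨h.1.le, by linarith [h.2]⟩

/-- The complex number whose argument is taken by agent `k`, seen from the angle `y`. -/
theorem update_mul_exp (a : V → ℝ) (x : V → ℝ) (β : ℝ) (k : V) (y : ℝ) :
    (∑ j, (a j : ℂ) * cexp (x j) + (β : ℂ) * cexp (x k)) * Complex.exp (-(y * Complex.I)) =
      ((∑ j, a j * Real.cos (x j - y) + β * Real.cos (x k - y) : ℝ) : ℂ) +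
      ((∑ j, a j * Real.sin (x j - y) + β * Real.sin (x k - y) : ℝ) : ℂ) * Complex.I := by
  have h : ∀ z : ℝ, cexp z * Complex.exp (-(y * Complex.I)) =
      (Real.cos (z - y) : ℂ) + (Real.sin (z - y) : ℂ) * Complex.I := by
    intro z
    rw [cexp_coe, ← Complex.exp_add, show (z : ℂ) * Complex.I + -(y * Complex.I) =
      ((z - y : ℝ) : ℂ) * Complex.I by push_cast; ring, Complex.exp_mul_I, Complex.ofReal_cos,
      Complex.ofReal_sin]
  rw [add_mul, Finset.sum_mul, mul_assoc, h]
  simp only [mul_assoc, h]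
  push_cast
  simp only [mul_add, Finset.sum_add_distrib, add_mul, Finset.sum_mul]
  simp only [mul_assoc]
  ring

theorem IsArg.critical_and_maximal {a x : V → ℝ} {β : ℝ} {k : V} {y : ℝ}
    (h : IsArg (∑ j, (a j : ℂ) * cexp (x j) + (β : ℂ) * cexp (x k)) y) :
    β * Real.sin (y - x k) = ∑ j, a j * Real.sin (x j - y) ∧
    ∀ y' : ℝ, ∑ j, a j * Real.cos (x j - y') + β * Real.cos (x k - y') ≤
      ∑ j, a j * Real.cos (x j - y) + β * Real.cos (x k - y) := by
  set z := ∑ j, (a j : ℂ) * cexp (x j) + (β : ℂ) * cexp (x k) with hz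
  have h1 : z * Complex.exp (-(y * Complex.I)) = (‖z‖ : ℂ) := by
    rw [IsArg, cexp_coe] at h
    conv_lhs => rw [h]
    rw [mul_assoc, ← Complex.exp_add, add_neg_cancel, Complex.exp_zero, mul_one]
  have h2 := update_mul_exp a x β k y
  rw [← hz, h1] at h2
  have hre := congrArg Complex.re h2
  have him := congrArg Complex.im h2
  simp only [Complex.ofReal_re, Complex.ofReal_im, Complex.add_re, Complex.add_im,
    Complex.re_ofReal_mul, Complex.im_ofReal_mul, Complex.I_re, Complex.I_im, mul_zero, mul_one,
    add_zero, zero_add] at hre him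
  refine ⟨?_, fun y' => ?_⟩
  · rw [← neg_sub (x k) y, Real.sin_neg]
    linarith
  · rw [← hre]
    have h3 := update_mul_exp a x β k y'
    rw [← hz] at h3
    have hre' := congrArg Complex.re h3
    simp only [Complex.ofReal_re, Complex.add_re,
      Complex.re_ofReal_mul, Complex.I_re, mul_zero, add_zero] at hre'
    rw [← hre']
    refine (Complex.re_le_norm _).trans ?_
    have h4 : -(y' * Complex.I) = ((-y' : ℝ) : ℂ) * Complex.I := by push_cast; ring
    rw [norm_mul, h4, Complex.norm_exp_ofReal_mul_I, mul_one]

theorem IsDiscreteTimeSolution.exists_lift {G : WeightedDigraph V} {β : ℝ} {σ : ℕ → Set V}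
    {θ : ℕ → V → S1} (h : IsDiscreteTimeSolution G β σ θ) {x₀ : V → ℝ}
    (h₀ : ∀ k, (x₀ k : S1) = θ 0 k) :
    ∃ x : ℕ → V → ℝ, x 0 = x₀ ∧ (∀ t k, (x t k : S1) = θ t k) ∧ IsLiftedSolution G β σ x := by
  classical
  choose r hr hr' using exists_lift_abs_le_pi
  obtain ⟨x, hx0, hsucc⟩ : ∃ x : ℕ → V → ℝ, x 0 = x₀ ∧ ∀ t k, x (t + 1) k =
      if θ (t + 1) k = θ t k then x t k else x t k + r (θ (t + 1) k - θ t k) :=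
    ⟨fun t => Nat.rec x₀ (fun t y k =>
      if θ (t + 1) k = θ t k then y k else y k + r (θ (t + 1) k - θ t k)) t, rfl,
      fun _ _ => rfl⟩
  have hx : ∀ (t : ℕ) (k : V), ((x t k : ℝ) : S1) = θ t k := by
    intro t
    induction t with
    | zero => rw [hx0]; exact h₀
    | succ t ih =>
      intro k
      rw [hsucc]
      split_ifs with hk
      · rw [ih, hk]
      · rw [AddCircle.coe_add, hr, ih, add_sub_cancel]
  refine ⟨x, hx0, hx, fun t => ?_⟩
  have harg : ∀ k ∈ σ t, IsArg (∑ j, (G.weight j k : ℂ) * cexp ((x t j : ℝ) : S1) +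
      (β : ℂ) * cexp ((x t k : ℝ) : S1)) ((x (t + 1) k : ℝ) : S1) := by
    intro k hk
    simpa only [hx] using (h t k).1 hk
  refine ⟨fun k hk => (harg k hk).critical_and_maximal.1,
    fun k hk => (harg k hk).critical_and_maximal.2, fun k => ?_, fun k hk => ?_⟩
  · rw [hsucc]
    split_ifs
    · simpa using Real.pi_pos.le
    · simpa using hr' _
  · rw [hsucc, if_pos ((h t k).2 hk)]

theorem tendsto_coe_of_tendsto_cos {ι : Type*} {l : Filter ι} {w : ι → ℝ} {φ : ℝ}
    (h : Tendsto (fun t => Real.cos (w t - φ)) l (𝓝 1)) :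
    Tendsto (fun t => (w t : S1)) l (𝓝 (φ : S1)) := by
  have hsin : Tendsto (fun t => Real.sin (w t - φ)) l (𝓝 0) := by
    have h1 : Tendsto (fun t => Real.sqrt (1 - Real.cos (w t - φ) ^ 2)) l (𝓝 0) := by
      have := (Real.continuous_sqrt.tendsto _).comp ((h.pow 2).const_sub 1)
      simpa [Function.comp_def] using this
    refine (tendsto_zero_iff_abs_tendsto_zero _).2 (h1.congr fun t => ?_)
    rw [← Real.sin_sq, Real.sqrt_sq_eq_abs]; rfl
  have hc : Tendsto (fun t => Circle.exp (w t - φ)) l (𝓝 (Circle.exp 0)) := by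
    refine (Topology.IsInducing.subtypeVal
      (t := (Submonoid.unitSphere ℂ : Set ℂ))).tendsto_nhds_iff.2 ?_
    have h1 : Tendsto (fun t => (Real.cos (w t - φ) : ℂ) + (Real.sin (w t - φ) : ℂ) * Complex.I) l
        (𝓝 (((1 : ℝ) : ℂ) + ((0 : ℝ) : ℂ) * Complex.I)) :=
      ((Complex.continuous_ofReal.tendsto _).comp h).add
        (((Complex.continuous_ofReal.tendsto _).comp hsin).mul_const _)
    have h2 : (((1 : ℝ) : ℂ) + ((0 : ℝ) : ℂ) * Complex.I) = ((Circle.exp 0 : Circle) : ℂ) := by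
      simp
    rw [← h2]
    refine h1.congr fun t => ?_
    change _ = ((Circle.exp (w t - φ) : Circle) : ℂ)
    rw [Circle.coe_exp, Complex.exp_mul_I, Complex.ofReal_cos,
      Complex.ofReal_sin]
  have h3 : Tendsto (fun t => ((w t - φ : ℝ) : S1)) l (𝓝 ((0 : ℝ) : S1)) := by
    have := (AddCircle.homeomorphCircle'.symm.continuous.tendsto _).comp hc
    have e : ∀ y : ℝ, AddCircle.homeomorphCircle'.symm (Circle.exp y) = (y : S1) := fun y => by
      rw [← AddCircle.homeomorphCircle'_apply_mk]
      exact Homeomorph.symm_apply_apply _ _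
    rw [e] at this
    exact this.congr fun t => e _
  have h4 := h3.add_const (φ : S1)
  simpa only [← AddCircle.coe_add, sub_add_cancel, zero_add] using h4

/-- It suffices to prove synchronization for almost all lifted initial conditions. -/
theorem ae_synchronizes_of_lifted {G : WeightedDigraph V} {β : ℝ} {σ : ℕ → Set V}
    (h : ∀ᵐ x₀ : V → ℝ, ∀ x : ℕ → V → ℝ, IsLiftedSolution G β σ x → x 0 = x₀ →
      ∃ φ : ℝ, ∀ k, Tendsto (fun t => Real.cos (x t k - φ)) atTop (𝓝 1)) :
    ∀ᵐ θ₀ : V → S1, ∀ θ : ℕ → V → S1, IsDiscreteTimeSolution G β σ θ → θ 0 = θ₀ →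
      Synchronizes atTop θ := by
  refine ae_circle_of_ae_lift ?_
  filter_upwards [h] with x₀ hx₀ θ hθ h0
  obtain ⟨x, hx0, hx, hsol⟩ := hθ.exists_lift (x₀ := x₀) fun k => (congrFun h0 k).symm
  obtain ⟨φ, hφ⟩ := hx₀ x hsol hx0
  refine ⟨φ, fun k => ?_⟩
  simpa only [hx] using tendsto_coe_of_tendsto_cos (hφ k)

/-! ### Discrete-time steps reflect null sets -/

/-- The part of a lifted step by which `x` is determined by `x'` up to countably many choices. -/
def IsImplicitStep (G : WeightedDigraph V) (β : ℝ) (s : Finset V) (x x' : V → ℝ) : Prop :=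
  (∀ k ∈ s, β * Real.sin (x' k - x k) = ∑ j, G.weight j k * Real.sin (x j - x' k)) ∧
    ∀ k ∉ s, x' k = x k

/-- If only agent `k` moves, then `x_k` is recovered from `x'` by an arcsine, which is
differentiable unless its argument is `±1`, in which case `x` is a translate of `x'`. -/
theorem reflectsNull_isImplicitStep_singleton (G : WeightedDigraph V) {β : ℝ} (hβ : 0 < β)
    (k : V) : ReflectsNull (IsImplicitStep G β {k}) := by
  classical
  intro N hN
  let A : (V → ℝ) → ℝ := fun x => G.torque x k / β
  let e : V → ℝ := Pi.single k 1
  let f₀ : ℤ → (V → ℝ) → V → ℝ := fun m x => x - ((2 * m + 1) * Real.pi / 2) • e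
  let f₁ : ℤ → (V → ℝ) → V → ℝ := fun m x => x - (2 * m * Real.pi + Real.arcsin (A x)) • e
  let f₂ : ℤ → (V → ℝ) → V → ℝ := fun m x => x - ((2 * m + 1) * Real.pi - Real.arcsin (A x)) • e
  let N₁ : Set (V → ℝ) := N ∩ {x | A x ≠ -1 ∧ A x ≠ 1}
  have hN₁ : volume N₁ = 0 := measure_mono_null Set.inter_subset_left hN
  have hA : Differentiable ℝ A := by
    simp only [A, WeightedDigraph.torque]
    fun_prop
  have harc : ∀ x ∈ N₁, DifferentiableWithinAt ℝ (fun x => Real.arcsin (A x)) N₁ x := fun x hx =>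
    ((Real.differentiableAt_arcsin.2 hx.2).comp x (hA x)).differentiableWithinAt
  have h₀ : ∀ m, volume (f₀ m '' N) = 0 := fun m =>
    addHaar_image_eq_zero_of_differentiableOn_of_addHaar_eq_zero _
      (Differentiable.differentiableOn (by simp only [f₀]; fun_prop)) hN
  have h₁ : ∀ m, volume (f₁ m '' N₁) = 0 := fun m =>
    addHaar_image_eq_zero_of_differentiableOn_of_addHaar_eq_zero _
      (fun x hx => differentiableWithinAt_id.sub (((harc x hx).const_add _).smul_const e)) hN₁
  have h₂ : ∀ m, volume (f₂ m '' N₁) = 0 := fun m =>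
    addHaar_image_eq_zero_of_differentiableOn_of_addHaar_eq_zero _
      (fun x hx => differentiableWithinAt_id.sub (((harc x hx).const_sub _).smul_const e)) hN₁
  refine measure_mono_null (t := ⋃ m : ℤ, (f₀ m '' N ∪ f₁ m '' N₁ ∪ f₂ m '' N₁)) ?_
    (measure_iUnion_null fun m => measure_union_null (measure_union_null (h₀ m) (h₁ m)) (h₂ m))
  rintro x ⟨x', hx', hcrit, hstay⟩
  have hx : ∀ c, x' k - x k = c → x' - c • e = x := by
    intro c hc
    ext j
    rcases eq_or_ne j k with rfl | hj
    · simp [e, ← hc]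
    · simp [e, hj, hstay j (by simpa using hj)]
  have hsin : Real.sin (x' k - x k) = A x' := by
    simp only [A]
    rw [eq_div_iff hβ.ne', mul_comm, hcrit k (by simp)]
    refine Finset.sum_congr rfl fun j _ => ?_
    rcases eq_or_ne j k with rfl | hj
    · rw [G.weight_self, zero_mul, zero_mul]
    · rw [hstay j (by simpa using hj)]
  simp only [Set.mem_iUnion, Set.mem_union, Set.mem_image]
  by_cases hcos : Real.cos (x' k - x k) = 0
  · obtain ⟨m, hm⟩ := Real.cos_eq_zero_iff.1 hcos
    exact ⟨m, Or.inl (Or.inl ⟨x', hx', hx _ hm⟩)⟩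
  · have hsq := Real.sin_sq_add_cos_sq (x' k - x k)
    have hpos : 0 < Real.cos (x' k - x k) ^ 2 := by positivity
    have hN' : x' ∈ N₁ := by
      refine ⟨hx', fun h => ?_, fun h => ?_⟩ <;>
      · rw [hsin, h] at hsq
        linarith
    have hsin2 : Real.sin (Real.arcsin (A x')) = Real.sin (x' k - x k) := by
      rw [hsin]
      exact Real.sin_arcsin (by rw [← hsin]; exact Real.neg_one_le_sin _)
        (by rw [← hsin]; exact Real.sin_le_one _)
    obtain ⟨m, hm | hm⟩ := Real.sin_eq_sin_iff.1 hsin2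
    · exact ⟨m, Or.inl (Or.inr ⟨x', hN', hx _ hm⟩)⟩
    · exact ⟨m, Or.inr ⟨x', hN', hx _ hm⟩⟩

/-- If there is no cycle among the agents in `s`, then their simultaneous update amounts to
successive updates of single agents, each one after those it influences. -/
theorem reflectsNull_isImplicitStep (G : WeightedDigraph V) {β : ℝ} (hβ : 0 < β) (s : Finset V)
    (hs : ∀ t ⊆ s, t.Nonempty → ∃ k ∈ t, ∀ j ∈ t, ¬ G.Edge j k) :
    ReflectsNull (IsImplicitStep G β s) := by
  classical
  induction s using Finset.strongInduction with
  | H s ih =>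
  rcases s.eq_empty_or_nonempty with rfl | hne
  · refine reflectsNull_of_dist_le 1 fun x x' y y' hx hy => ?_
    have h1 : x' = x := funext fun k => hx.2 k (by simp)
    have h2 : y' = y := funext fun k => hy.2 k (by simp)
    rw [h1, h2, one_mul]
  obtain ⟨k, hk, hno⟩ := hs s subset_rfl hne
  refine ((ih (s.erase k) (Finset.erase_ssubset hk) fun t ht => hs t
    (ht.trans (Finset.erase_subset _ _))).comp
    (reflectsNull_isImplicitStep_singleton G hβ k)).mono ?_
  rintro x x' ⟨hcrit, hstay⟩
  refine ⟨Function.update x' k (x k), ⟨fun l hl => ?_, fun l hl => ?_⟩, fun l hl => ?_,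
    fun l hl => ?_⟩
  · rw [Function.update_of_ne (Finset.ne_of_mem_erase hl)]
    exact hcrit l (Finset.mem_of_mem_erase hl)
  · rcases eq_or_ne l k with rfl | hlk
    · simp
    · rw [Function.update_of_ne hlk]
      exact hstay l fun h => hl (Finset.mem_erase.2 ⟨hlk, h⟩)
  · obtain rfl := Finset.mem_singleton.1 hl
    rw [Function.update_self, hcrit l hk]
    refine Finset.sum_congr rfl fun j _ => ?_
    by_cases hj : j ∈ s
    · have : G.weight j l = 0 := not_not.1 (hno j hj)
      rw [this, zero_mul, zero_mul]
    · rw [Function.update_of_ne (by rintro rfl; exact hj hk), hstay j hj]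
  · rw [Function.update_of_ne (by simpa using hl)]

theorem reflectsNull_isLiftedStep (G : WeightedDigraph V) {β : ℝ} (hβ : 0 < β) (s : Set V)
    (hs : ∀ t : Finset V, (t : Set V) ⊆ s → t.Nonempty → ∃ k ∈ t, ∀ j ∈ t, ¬ G.Edge j k) :
    ReflectsNull (IsLiftedStep G β s) := by
  classical
  refine (reflectsNull_isImplicitStep G hβ s.toFinset fun t ht => hs t ?_).mono
    fun x x' h => ⟨fun k hk => h.critical k (by simpa using hk),
      fun k hk => h.eq_of_notMem k (by simpa using hk)⟩
  intro k hk
  simpa using ht hk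

end CircleSync

namespace CircleSync

/-! ### Estimates for the torque and the potential -/

variable {V : Type*} [Fintype V]

theorem norm_sq_le_sum_sq (u : V → ℝ) : ‖u‖ ^ 2 ≤ ∑ k, u k ^ 2 := by
  have h0 : 0 ≤ ∑ k, u k ^ 2 := Finset.sum_nonneg fun _ _ => sq_nonneg _
  have h : ‖u‖ ≤ Real.sqrt (∑ k, u k ^ 2) := by
    refine (pi_norm_le_iff_of_nonneg (Real.sqrt_nonneg _)).2 fun k => ?_
    rw [Real.norm_eq_abs]
    refine Real.abs_le_sqrt (Finset.single_le_sum (f := fun k => u k ^ 2)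
      (fun _ _ => sq_nonneg _) (Finset.mem_univ k))
  calc ‖u‖ ^ 2 ≤ Real.sqrt (∑ k, u k ^ 2) ^ 2 := pow_le_pow_left₀ (norm_nonneg _) h 2
    _ = _ := Real.sq_sqrt h0

/-- The difference of two sines, compared with its linearization at `a₀`. -/
theorem abs_sin_sub_sin_sub_le {a b a₀ r : ℝ} (ha : |a - a₀| ≤ r) (hb : |b - a₀| ≤ r) :
    |Real.sin a - Real.sin b - Real.cos a₀ * (a - b)| ≤ r * |a - b| := by
  have h := (convex_closedBall a₀ r).norm_image_sub_le_of_norm_hasDerivWithin_le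
    (f := fun t => Real.sin t - Real.cos a₀ * t) (f' := fun t => Real.cos t - Real.cos a₀ * 1)
    (C := r) (x := b) (y := a)
    (fun t _ => ((Real.hasDerivAt_sin t).sub ((hasDerivAt_id t).const_mul _)).hasDerivWithinAt)
    (fun t ht => by
      rw [mul_one, Real.norm_eq_abs]
      exact (Real.abs_cos_sub_cos_le t a₀).trans (by simpa [Real.dist_eq] using ht))
    (by simpa [Real.dist_eq] using hb) (by simpa [Real.dist_eq] using ha)
  rw [Real.norm_eq_abs, Real.norm_eq_abs] at h
  convert h using 2
  ring

namespace WeightedDigraph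

theorem inDegree_nonneg (G : WeightedDigraph V) (k : V) : 0 ≤ G.inDegree k :=
  Finset.sum_nonneg fun j _ => G.weight_nonneg j k

theorem inDegree_le_dSum (G : WeightedDigraph V) (k : V) : G.inDegree k ≤ G.dSum :=
  Finset.single_le_sum (f := G.inDegree) (fun k _ => G.inDegree_nonneg k) (Finset.mem_univ k)

theorem dSum_nonneg (G : WeightedDigraph V) : 0 ≤ G.dSum :=
  Finset.sum_nonneg fun k _ => G.inDegree_nonneg k

/-- A weighted sum over the neighbours, with terms bounded by `B`. -/
theorem abs_sum_weight_le (G : WeightedDigraph V) (k : V) {f : V → ℝ} {B : ℝ}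
    (hf : ∀ j, |f j| ≤ B) : |∑ j, G.weight j k * f j| ≤ G.inDegree k * B := by
  rw [inDegree, Finset.sum_mul]
  refine (Finset.abs_sum_le_sum_abs _ _).trans (Finset.sum_le_sum fun j _ => ?_)
  rw [abs_mul, abs_of_nonneg (G.weight_nonneg j k)]
  exact mul_le_mul_of_nonneg_left (hf j) (G.weight_nonneg j k)

theorem abs_torque_sub_le (G : WeightedDigraph V) (x y : V → ℝ) (k : V) :
    |G.torque x k - G.torque y k| ≤ 2 * G.dSum * ‖x - y‖ := by
  rw [torque, torque, ← Finset.sum_sub_distrib]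
  simp only [← mul_sub]
  refine (G.abs_sum_weight_le k (B := 2 * ‖x - y‖) fun j => ?_).trans ?_
  · refine (Real.abs_sin_sub_sin_le _ _).trans ?_
    rw [show x j - x k - (y j - y k) = (x - y) j - (x - y) k by simp only [Pi.sub_apply]; ring]
    refine (abs_sub _ _).trans ?_
    have h1 := norm_le_pi_norm (x - y) j
    have h2 := norm_le_pi_norm (x - y) k
    rw [Real.norm_eq_abs] at h1 h2
    linarith
  · have := mul_le_mul_of_nonneg_right (G.inDegree_le_dSum k)
      (by positivity : 0 ≤ 2 * ‖x - y‖)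
    linarith

theorem continuous_torque (G : WeightedDigraph V) (k : V) :
    Continuous fun x : V → ℝ => G.torque x k := by
  simp only [torque]
  fun_prop

theorem potential_le (G : WeightedDigraph V) (x : V → ℝ) : G.potential x ≤ G.dSum := by
  have h : ∑ k, ∑ j, G.weight j k * Real.cos (x j - x k) ≤ G.dSum :=
    Finset.sum_le_sum fun k _ => Finset.sum_le_sum fun j _ =>
      mul_le_of_le_one_right (G.weight_nonneg j k) (Real.cos_le_one _)
  rw [potential]
  linarith [G.dSum_nonneg]

theorem continuous_linTorque (G : WeightedDigraph V) (p : V → ℝ) :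
    Continuous fun u : V → ℝ => G.linTorque p u :=
  (G.linTorque p).continuous_of_finiteDimensional

/-- The Łojasiewicz inequality in terms of a bound for the torques on the single agents. -/
theorem HasSyncLandscape.lojasiewicz_norm {G : WeightedDigraph V} (hG : G.HasSyncLandscape) :
    ∃ (crit : Finset ℝ) (C : ℝ), ∀ (x : V → ℝ) (D : ℝ), (∀ k, |G.torque x k| ≤ D) →
      ∃ v ∈ crit, |G.potential x - v| ^ 3 ≤ C * D ^ 4 := by
  obtain ⟨crit, C, h⟩ := hG.lojasiewicz
  refine ⟨crit, |C| * Fintype.card V ^ 2, fun x D hD => ?_⟩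
  obtain ⟨v, hv, hle⟩ := h x
  refine ⟨v, hv, hle.trans ?_⟩
  have h1 : ∑ k, G.torque x k ^ 2 ≤ Fintype.card V * D ^ 2 := by
    calc ∑ k, G.torque x k ^ 2 ≤ ∑ _k : V, D ^ 2 := Finset.sum_le_sum fun k _ => by
          rw [← sq_abs]
          exact pow_le_pow_left₀ (abs_nonneg _) (hD k) 2
      _ = _ := by simp
  have h2 : 0 ≤ ∑ k, G.torque x k ^ 2 := Finset.sum_nonneg fun _ _ => sq_nonneg _
  calc C * (∑ k, G.torque x k ^ 2) ^ 2 ≤ |C| * (Fintype.card V * D ^ 2) ^ 2 :=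
        mul_le_mul (le_abs_self C) (pow_le_pow_left₀ h2 h1 2) (sq_nonneg _) (abs_nonneg _)
    _ = _ := by ring

end WeightedDigraph

/-- If every point of `P` has a neighbourhood in which only a null set of initial conditions remains
in the long run, then almost no initial condition leads to a limit in `P`. -/
theorem ae_forall_not_tendsto {ι : Type*} [Zero ι] [Preorder ι] {X : Set (ι → V → ℝ)}
    {P : Set (V → ℝ)} (h : ∀ p ∈ P, ∃ δ > 0,
      volume {x₀ | ∃ x ∈ X, x 0 = x₀ ∧ ∀ᶠ t in atTop, x t ∈ Metric.ball p δ} = 0) :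
    ∀ᵐ x₀ : V → ℝ, ∀ x ∈ X, x 0 = x₀ → ∀ p ∈ P, ¬ Tendsto x atTop (𝓝 p) := by
  choose! δ hδ hnull using h
  obtain ⟨A, hAP, hA, hcover⟩ := TopologicalSpace.countable_cover_nhdsWithin
    (f := fun p => Metric.ball p (δ p)) (s := P)
    fun p hp => mem_nhdsWithin_of_mem_nhds (Metric.ball_mem_nhds p (hδ p hp))
  have h1 : ∀ᵐ x₀ : V → ℝ, ∀ p ∈ A,
      ¬ ∃ x ∈ X, x 0 = x₀ ∧ ∀ᶠ t in atTop, x t ∈ Metric.ball p (δ p) := by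
    refine (ae_ball_iff hA).2 fun p hp => ?_
    rw [ae_iff]
    simpa using hnull p (hAP hp)
  filter_upwards [h1] with x₀ hx₀ x hx h0 p hp hlim
  obtain ⟨q, hq, hpq⟩ := Set.mem_iUnion₂.1 (hcover hp)
  exact hx₀ q hq ⟨x, hx, h0, hlim (Metric.isOpen_ball.mem_nhds hpq)⟩

end CircleSync

namespace CircleSync

/-! ### Ascent of the potential in discrete time -/

variable {V : Type*}

/-- The data of `UpdatesRegularly`: windows `[τ n, τ (n + 1))` of length less than `T`, in each of
which every agent is updated. -/
structure IsUpdateSchedule (σ : ℕ → Set V) (T : ℕ) (τ : ℕ → ℕ) : Prop where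
  zero : τ 0 = 0
  strictMono : StrictMono τ
  lt_add : ∀ n, τ (n + 1) < τ n + T
  exists_mem : ∀ k n, ∃ t, τ n ≤ t ∧ t < τ (n + 1) ∧ k ∈ σ t

theorem IsUpdateSchedule.pos {σ : ℕ → Set V} {T : ℕ} {τ : ℕ → ℕ} (h : IsUpdateSchedule σ T τ) :
    0 < T := by
  have h1 := h.lt_add 0
  have h2 := h.strictMono (Nat.lt_succ_self 0)
  simp only [Nat.succ_eq_add_one] at h2
  omega

theorem IsUpdateSchedule.tendsto {σ : ℕ → Set V} {T : ℕ} {τ : ℕ → ℕ}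
    (h : IsUpdateSchedule σ T τ) : Tendsto τ atTop atTop := h.strictMono.tendsto_atTop

variable [Fintype V]

/-- The two positivity conditions on the agents in `s`, updated simultaneously, under which a step
increases the potential (`ascent`) and, near a limit point `p`, the quadratic form of the linearized
torque (`expansion`). -/
structure IsCoerciveOn (G : WeightedDigraph V) (β c : ℝ) (s : Set V) : Prop where
  ascent : ∀ d : V → ℝ, (∀ k ∉ s, d k = 0) →
    c * ∑ k, d k ^ 2 ≤ β * ∑ k, d k ^ 2 + ∑ k, d k * ∑ j, G.weight j k * d j
  expansion : ∀ p : V → ℝ, (∀ k, 0 ≤ β + ∑ j, G.weight j k * Real.cos (p j - p k)) →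
    ∀ d : V → ℝ, (∀ k ∉ s, d k = 0) → c * ∑ k, d k ^ 2 ≤
      2 * ∑ k, (β + ∑ j, G.weight j k * Real.cos (p j - p k)) * d k ^ 2 + d ⬝ᵥ G.linTorque p d

theorem sum_mul_sum_weight_comm {G : WeightedDigraph V} (hG : G.IsUndirected) (d f : V → ℝ) :
    ∑ k, d k * ∑ j, G.weight j k * f j = ∑ k, f k * ∑ j, G.weight j k * d j := by
  simp only [Finset.mul_sum]
  rw [Finset.sum_comm]
  exact Finset.sum_congr rfl fun k _ => Finset.sum_congr rfl fun j _ => by rw [hG k j]; ring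

/-- The potential is a quadratic form of the positions in the complex plane. A step maximizes its
linearization plus the inertia term, and by the `ascent` condition the quadratic remainder does not
outweigh the latter. -/
theorem IsLiftedStep.potential_sub_ge {G : WeightedDigraph V} (hG : G.IsUndirected) {β c : ℝ}
    {s : Set V} (hs : IsCoerciveOn G β c s) (hc : 0 ≤ c) {x x' : V → ℝ}
    (h : IsLiftedStep G β s x x') :
    c * (2 / Real.pi ^ 2) * ‖x' - x‖ ^ 2 ≤ G.potential x' - G.potential x := by
  set C : V → ℝ := fun k => Real.cos (x' k) - Real.cos (x k) with hC
  set S : V → ℝ := fun k => Real.sin (x' k) - Real.sin (x k) with hS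
  have hCs : ∀ k ∉ s, C k = 0 := fun k hk => by simp [hC, h.eq_of_notMem k hk]
  have hSs : ∀ k ∉ s, S k = 0 := fun k hk => by simp [hS, h.eq_of_notMem k hk]
  have hpot : ∀ y : V → ℝ, G.potential y =
      1 / 2 * (∑ k, Real.cos (y k) * ∑ j, G.weight j k * Real.cos (y j) +
        ∑ k, Real.sin (y k) * ∑ j, G.weight j k * Real.sin (y j)) := by
    intro y
    rw [WeightedDigraph.potential, ← Finset.sum_add_distrib]
    congr 1
    refine Finset.sum_congr rfl fun k _ => ?_
    rw [Finset.mul_sum, Finset.mul_sum, ← Finset.sum_add_distrib]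
    exact Finset.sum_congr rfl fun j _ => by rw [Real.cos_sub]; ring
  have hexp : ∀ f f' : V → ℝ, ∑ k, f' k * ∑ j, G.weight j k * f' j
      - ∑ k, f k * ∑ j, G.weight j k * f j =
      2 * ∑ k, (f' k - f k) * ∑ j, G.weight j k * f j +
        ∑ k, (f' k - f k) * ∑ j, G.weight j k * (f' j - f j) := by
    intro f f'
    have e := sum_mul_sum_weight_comm hG f f'
    simp only [sub_mul, mul_sub, Finset.sum_sub_distrib]
    linarith
  have hlin : ∑ k, C k * ∑ j, G.weight j k * Real.cos (x j) +
      ∑ k, S k * ∑ j, G.weight j k * Real.sin (x j) ≥ ∑ k, β * (1 - Real.cos (x' k - x k)) := by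
    rw [← Finset.sum_add_distrib]
    refine Finset.sum_le_sum fun k _ => ?_
    by_cases hk : k ∈ s
    · have h1 := h.maximal k hk (x k)
      rw [sub_self, Real.cos_zero] at h1
      have h2 : C k * ∑ j, G.weight j k * Real.cos (x j) +
          S k * ∑ j, G.weight j k * Real.sin (x j) =
          ∑ j, G.weight j k * Real.cos (x j - x' k) - ∑ j, G.weight j k * Real.cos (x j - x k) := by
        rw [Finset.mul_sum, Finset.mul_sum, ← Finset.sum_add_distrib, ← Finset.sum_sub_distrib]
        refine Finset.sum_congr rfl fun j _ => ?_
        rw [Real.cos_sub, Real.cos_sub]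
        simp only [hC, hS]
        ring
      rw [h2, ← Real.cos_neg, neg_sub]
      linarith
    · simp [hCs k hk, hSs k hk, h.eq_of_notMem k hk]
  have hsq : ∑ k, C k ^ 2 + ∑ k, S k ^ 2 = ∑ k, 2 * (1 - Real.cos (x' k - x k)) := by
    rw [← Finset.sum_add_distrib]
    refine Finset.sum_congr rfl fun k _ => ?_
    rw [Real.cos_sub]
    simp only [hC, hS]
    linear_combination Real.sin_sq_add_cos_sq (x k) + Real.sin_sq_add_cos_sq (x' k)
  have h1 := hs.ascent C hCs
  have h2 := hs.ascent S hSs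
  rw [← Finset.mul_sum] at hlin hsq
  have hgain : c * ∑ k, (1 - Real.cos (x' k - x k)) ≤ G.potential x' - G.potential x := by
    have e1 := hexp (fun k => Real.cos (x k)) (fun k => Real.cos (x' k))
    have e2 := hexp (fun k => Real.sin (x k)) (fun k => Real.sin (x' k))
    rw [hpot, hpot]
    have e3 : c * (∑ k, C k ^ 2 + ∑ k, S k ^ 2) = c * (2 * ∑ k, (1 - Real.cos (x' k - x k))) := by
      rw [hsq]
    have e4 : β * (∑ k, C k ^ 2 + ∑ k, S k ^ 2) = β * (2 * ∑ k, (1 - Real.cos (x' k - x k))) := by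
      rw [hsq]
    simp only [hC, hS] at h1 h2 hlin e3 e4
    linarith
  refine le_trans ?_ hgain
  rw [mul_assoc]
  refine mul_le_mul_of_nonneg_left ?_ hc
  calc 2 / Real.pi ^ 2 * ‖x' - x‖ ^ 2 ≤ 2 / Real.pi ^ 2 * ∑ k, (x' - x) k ^ 2 :=
        mul_le_mul_of_nonneg_left (norm_sq_le_sum_sq _) (by positivity)
    _ ≤ _ := by
        rw [Finset.mul_sum]
        refine Finset.sum_le_sum fun k _ => ?_
        have := Real.cos_le_one_sub_mul_cos_sq (h.abs_sub_le k)
        rw [Pi.sub_apply]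
        linarith

theorem IsLiftedStep.abs_torque_le {G : WeightedDigraph V} {β : ℝ} (hβ : 0 < β) {s : Set V}
    {x x' : V → ℝ} (h : IsLiftedStep G β s x x') {k : V} (hk : k ∈ s) :
    |G.torque x k| ≤ (β + G.dSum) * ‖x' - x‖ := by
  have hd : |x' k - x k| ≤ ‖x' - x‖ := norm_le_pi_norm (x' - x) k
  have h1 : G.torque x k = β * Real.sin (x' k - x k) +
      ∑ j, G.weight j k * (Real.sin (x j - x k) - Real.sin (x j - x' k)) := by
    rw [h.critical k hk, ← Finset.sum_add_distrib, WeightedDigraph.torque]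
    exact Finset.sum_congr rfl fun j _ => by ring
  have h2 : |β * Real.sin (x' k - x k)| ≤ β * ‖x' - x‖ := by
    rw [abs_mul, abs_of_pos hβ]
    exact mul_le_mul_of_nonneg_left (Real.abs_sin_le_abs.trans hd) hβ.le
  have h3 : |∑ j, G.weight j k * (Real.sin (x j - x k) - Real.sin (x j - x' k))| ≤
      G.dSum * ‖x' - x‖ := by
    refine (G.abs_sum_weight_le k (B := ‖x' - x‖) fun j => ?_).trans
      (mul_le_mul_of_nonneg_right (G.inDegree_le_dSum k) (norm_nonneg _))
    refine (Real.abs_sin_sub_sin_le _ _).trans ?_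
    rwa [show x j - x k - (x j - x' k) = x' k - x k by ring]
  rw [h1]
  exact (abs_add_le _ _).trans (by linarith)

/-- The distance travelled in the `n`th time window. -/
noncomputable def windowLength (τ : ℕ → ℕ) (x : ℕ → V → ℝ) (n : ℕ) : ℝ :=
  ∑ t ∈ Finset.Ico (τ n) (τ (n + 1)), ‖x (t + 1) - x t‖

theorem windowLength_nonneg (τ : ℕ → ℕ) (x : ℕ → V → ℝ) (n : ℕ) : 0 ≤ windowLength τ x n :=
  Finset.sum_nonneg fun _ _ => norm_nonneg _

theorem norm_sub_le_windowLength {τ : ℕ → ℕ} (x : ℕ → V → ℝ) {n t : ℕ} (h₁ : τ n ≤ t)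
    (h₂ : t ≤ τ (n + 1)) : ‖x t - x (τ n)‖ ≤ windowLength τ x n := by
  rw [← dist_eq_norm, dist_comm]
  refine (dist_le_Ico_sum_dist x h₁).trans ?_
  refine (Finset.sum_le_sum_of_subset_of_nonneg (Finset.Ico_subset_Ico_right h₂)
    fun _ _ _ => dist_nonneg).trans (le_of_eq ?_)
  exact Finset.sum_congr rfl fun i _ => by rw [dist_comm, dist_eq_norm]

theorem norm_step_le_windowLength {τ : ℕ → ℕ} (x : ℕ → V → ℝ) {n t : ℕ} (h₁ : τ n ≤ t)
    (h₂ : t < τ (n + 1)) : ‖x (t + 1) - x t‖ ≤ windowLength τ x n :=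
  Finset.single_le_sum (f := fun t => ‖x (t + 1) - x t‖) (fun _ _ => norm_nonneg _)
    (Finset.mem_Ico.2 ⟨h₁, h₂⟩)

theorem windowLength_sq_le {τ : ℕ → ℕ} {T : ℕ} (x : ℕ → V → ℝ) {n : ℕ}
    (hT : τ (n + 1) < τ n + T) : windowLength τ x n ^ 2 ≤
      T * ∑ t ∈ Finset.Ico (τ n) (τ (n + 1)), ‖x (t + 1) - x t‖ ^ 2 := by
  refine sq_sum_le_card_mul_sum_sq.trans (mul_le_mul_of_nonneg_right ?_
    (Finset.sum_nonneg fun _ _ => sq_nonneg _))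
  rw [Nat.card_Ico]
  exact_mod_cast (by omega : τ (n + 1) - τ n ≤ T)

/-- A lifted solution converges to an equilibrium `p`, as it has finite length by the
Łojasiewicz inequality. At the limit the inertia dominates the pull of the neighbours, since each
agent keeps choosing the maximum and not the minimum. -/
theorem IsLiftedSolution.exists_tendsto {G : WeightedDigraph V} (hG : G.HasSyncLandscape) {β c : ℝ}
    (hβ : 0 < β) (hc : 0 < c) {σ : ℕ → Set V} (hσ : ∀ t, IsCoerciveOn G β c (σ t)) {T : ℕ}
    {τ : ℕ → ℕ} (hτ : IsUpdateSchedule σ T τ) {x : ℕ → V → ℝ} (hx : IsLiftedSolution G β σ x) :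
    ∃ p, Tendsto x atTop (𝓝 p) ∧ (∀ k, G.torque p k = 0) ∧
      ∀ k, 0 ≤ β + ∑ j, G.weight j k * Real.cos (p j - p k) := by
  set D := windowLength τ x with hD
  have hT : (0 : ℝ) < T := by exact_mod_cast hτ.pos
  have hπ : 0 < c * (2 / Real.pi ^ 2) := by positivity
  have hgain : ∀ n, c * (2 / Real.pi ^ 2) / T * D n ^ 2 ≤
      G.potential (x (τ (n + 1))) - G.potential (x (τ n)) := by
    intro n
    rw [← Finset.sum_Ico_sub (fun t => G.potential (x t)) (hτ.strictMono n.lt_succ_self).le,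
      div_mul_eq_mul_div, div_le_iff₀ hT, mul_comm _ (T : ℝ)]
    refine (mul_le_mul_of_nonneg_left (windowLength_sq_le x (hτ.lt_add n)) hπ.le).trans ?_
    rw [mul_left_comm, Finset.mul_sum]
    exact mul_le_mul_of_nonneg_left (Finset.sum_le_sum fun t _ =>
      (hx t).potential_sub_ge hG.isUndirected (hσ t) hc.le) hT.le
  have htorque : ∀ n k, |G.torque (x (τ n)) k| ≤ (β + 3 * G.dSum) * D n := by
    intro n k
    obtain ⟨t, ht₁, ht₂, hk⟩ := hτ.exists_mem k n
    have h1 := (hx t).abs_torque_le hβ hk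
    have h2 := G.abs_torque_sub_le (x (τ n)) (x t) k
    have h3 := mul_le_mul_of_nonneg_left (norm_step_le_windowLength x ht₁ ht₂)
      (by linarith [G.dSum_nonneg] : 0 ≤ β + G.dSum)
    have h4 := mul_le_mul_of_nonneg_left (norm_sub_le_windowLength x ht₁ ht₂.le)
      (by linarith [G.dSum_nonneg] : 0 ≤ 2 * G.dSum)
    rw [norm_sub_rev] at h4
    have h5 := abs_sub_abs_le_abs_sub (G.torque (x (τ n)) k) (G.torque (x t) k)
    simp only [hD]
    linarith
  have hsum : Summable D := by
    obtain ⟨crit, C, hŁ⟩ := hG.lojasiewicz_norm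
    refine summable_of_lojasiewicz (φ := fun n => G.potential (x (τ n))) (crit := crit)
      (c := c * (2 / Real.pi ^ 2) / T) (C := C * (β + 3 * G.dSum) ^ 4) (B := G.dSum)
      (by positivity) (windowLength_nonneg τ x) hgain (fun n => G.potential_le _) fun n => ?_
    obtain ⟨v, hv, hle⟩ := hŁ (x (τ n)) _ (htorque n)
    exact ⟨v, hv, hle.trans (le_of_eq (by ring))⟩
  have hcum : ∀ m, ∑ t ∈ Finset.range (τ m), ‖x (t + 1) - x t‖ = ∑ n ∈ Finset.range m, D n := by
    intro m
    induction m with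
    | zero => simp [hτ.zero]
    | succ m ih =>
      rw [Finset.sum_range_succ, ← ih, hD, windowLength,
        Finset.sum_range_add_sum_Ico _ (hτ.strictMono m.lt_succ_self).le]
  have hsteps : Summable fun t => ‖x (t + 1) - x t‖ := by
    refine summable_of_sum_range_le (fun _ => norm_nonneg _) (c := ∑' n, D n) fun m => ?_
    calc ∑ t ∈ Finset.range m, ‖x (t + 1) - x t‖
        ≤ ∑ t ∈ Finset.range (τ m), ‖x (t + 1) - x t‖ :=
          Finset.sum_le_sum_of_subset_of_nonneg
            (Finset.range_subset_range.2 (hτ.strictMono.id_le m)) fun _ _ _ => norm_nonneg _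
      _ = ∑ n ∈ Finset.range m, D n := hcum m
      _ ≤ ∑' n, D n := hsum.sum_le_tsum _ fun n _ => windowLength_nonneg τ x n
  have hcauchy : CauchySeq x := cauchySeq_of_summable_dist
    (hsteps.congr fun t => by rw [dist_comm, dist_eq_norm])
  obtain ⟨p, hp⟩ := cauchySeq_tendsto_of_complete hcauchy
  refine ⟨p, hp, fun k => ?_, fun k => ?_⟩
  · have h1 : Tendsto (fun n => G.torque (x (τ n)) k) atTop (𝓝 (G.torque p k)) :=
      ((G.continuous_torque k).tendsto p).comp (hp.comp hτ.tendsto)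
    have h2 : Tendsto (fun n => G.torque (x (τ n)) k) atTop (𝓝 0) := by
      refine squeeze_zero_norm (fun n => htorque n k) ?_
      simpa using hsum.tendsto_atTop_zero.const_mul (β + 3 * G.dSum)
    exact tendsto_nhds_unique h1 h2
  · choose t ht₁ ht₂ hk using hτ.exists_mem k
    have ht : Tendsto t atTop atTop := tendsto_atTop_mono ht₁ hτ.tendsto
    have h1 : Tendsto (fun n => ∑ j, G.weight j k * Real.cos (x (t n) j - x (t n + 1) k) +
        β * Real.cos (x (t n) k - x (t n + 1) k)) atTop
        (𝓝 (∑ j, G.weight j k * Real.cos (p j - p k) + β * Real.cos (p k - p k))) := by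
      have e1 : ∀ j, Tendsto (fun n => x (t n) j) atTop (𝓝 (p j)) := fun j =>
        ((continuous_apply j).tendsto p).comp (hp.comp ht)
      have e2 : Tendsto (fun n => x (t n + 1) k) atTop (𝓝 (p k)) :=
        ((continuous_apply k).tendsto p).comp (hp.comp ((tendsto_add_atTop_nat 1).comp ht))
      have e3 : ∀ j, Tendsto (fun n => Real.cos (x (t n) j - x (t n + 1) k)) atTop
          (𝓝 (Real.cos (p j - p k))) := fun j =>
        (Real.continuous_cos.tendsto _).comp ((e1 j).sub e2)
      exact (tendsto_finsetSum _ fun j _ => (e3 j).const_mul _).add ((e3 k).const_mul _)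
    rw [sub_self, Real.cos_zero, mul_one] at h1
    have h2 : ∀ n, 0 ≤ ∑ j, G.weight j k * Real.cos (x (t n) j - x (t n + 1) k) +
        β * Real.cos (x (t n) k - x (t n + 1) k) := by
      intro n
      have h3 := (hx (t n)).maximal k (hk n) (x (t n + 1) k + Real.pi)
      simp only [← sub_sub, Real.cos_sub_pi, mul_neg, Finset.sum_neg_distrib] at h3
      linarith
    have := ge_of_tendsto' h1 h2
    linarith

end CircleSync

namespace CircleSync

/-! ### Expansion at unstable equilibria in discrete time -/

variable {V : Type*} [Fintype V]

/-- The difference of two solutions near `p` satisfies the linearized equations. -/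
theorem IsLiftedStep.abs_linearization_le {G : WeightedDigraph V} {β : ℝ} (hβ : 0 < β) {s : Set V}
    {p x x' y y' : V → ℝ} {δ : ℝ} (hx : IsLiftedStep G β s x x') (hy : IsLiftedStep G β s y y')
    (h₁ : ‖x - p‖ ≤ δ) (h₂ : ‖x' - p‖ ≤ δ) (h₃ : ‖y - p‖ ≤ δ) (h₄ : ‖y' - p‖ ≤ δ) {k : V}
    (hk : k ∈ s) :
    |(β + ∑ j, G.weight j k * Real.cos (p j - p k)) * ((x' - y') - (x - y)) k -
      G.linTorque p (x - y) k| ≤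
      δ * (4 * G.dSum + 2 * β) * (‖x - y‖ + ‖(x' - y') - (x - y)‖) := by
  set u := x - y with hu
  set d := (x' - y') - (x - y) with hd
  have hδ : 0 ≤ δ := (norm_nonneg _).trans h₁
  have hcoord : ∀ {z : V → ℝ} (j : V), ‖z - p‖ ≤ δ → |z j - p j| ≤ δ := fun {z} j h =>
    (norm_le_pi_norm (z - p) j).trans h
  have hdk : |d k| ≤ ‖d‖ := norm_le_pi_norm d k
  have hud : ∀ j, |u j - u k - d k| ≤ 2 * ‖u‖ + ‖d‖ := by
    intro j
    have e1 : |u j| ≤ ‖u‖ := norm_le_pi_norm u j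
    have e2 : |u k| ≤ ‖u‖ := norm_le_pi_norm u k
    rw [abs_le] at *
    constructor <;> linarith [e1.1, e1.2, e2.1, e2.2, hdk.1, hdk.2]
  set e₀ := Real.sin (x' k - x k) - Real.sin (y' k - y k) - d k with he₀
  set e : V → ℝ := fun j => Real.sin (x j - x' k) - Real.sin (y j - y' k) -
    Real.cos (p j - p k) * (u j - u k - d k) with he
  have b₀ : |e₀| ≤ 2 * δ * ‖d‖ := by
    have h := abs_sin_sub_sin_sub_le (a := x' k - x k) (b := y' k - y k) (a₀ := 0) (r := 2 * δ)
      (by have e1 := abs_le.1 (hcoord k h₂); have e2 := abs_le.1 (hcoord k h₁)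
          rw [abs_le]; constructor <;> linarith [e1.1, e1.2, e2.1, e2.2])
      (by have e1 := abs_le.1 (hcoord k h₄); have e2 := abs_le.1 (hcoord k h₃)
          rw [abs_le]; constructor <;> linarith [e1.1, e1.2, e2.1, e2.2])
    have hdk' : x' k - x k - (y' k - y k) = d k := by
      simp only [hd, Pi.sub_apply]; ring
    rw [Real.cos_zero, one_mul, hdk'] at h
    exact h.trans (mul_le_mul_of_nonneg_left hdk (by positivity))
  have b : ∀ j, |e j| ≤ 2 * δ * (2 * ‖u‖ + ‖d‖) := by
    intro j
    have h := abs_sin_sub_sin_sub_le (a := x j - x' k) (b := y j - y' k) (a₀ := p j - p k)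
      (r := 2 * δ)
      (by have e1 := abs_le.1 (hcoord j h₁); have e2 := abs_le.1 (hcoord k h₂)
          rw [abs_le]; constructor <;> linarith [e1.1, e1.2, e2.1, e2.2])
      (by have e1 := abs_le.1 (hcoord j h₃); have e2 := abs_le.1 (hcoord k h₄)
          rw [abs_le]; constructor <;> linarith [e1.1, e1.2, e2.1, e2.2])
    have hjk : x j - x' k - (y j - y' k) = u j - u k - d k := by
      simp only [hd, hu, Pi.sub_apply]; ring
    rw [hjk] at h
    exact h.trans (mul_le_mul_of_nonneg_left (hud j) (by positivity))
  have key : (β + ∑ j, G.weight j k * Real.cos (p j - p k)) * d k - G.linTorque p u k =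
      ∑ j, G.weight j k * e j - β * e₀ := by
    have h1 := hx.critical k hk
    have h2 := hy.critical k hk
    have h3 : ∑ j, G.weight j k * e j = ∑ j, G.weight j k * Real.sin (x j - x' k) -
        ∑ j, G.weight j k * Real.sin (y j - y' k) - G.linTorque p u k +
        (∑ j, G.weight j k * Real.cos (p j - p k)) * d k := by
      rw [WeightedDigraph.linTorque_apply, Finset.sum_mul, ← Finset.sum_sub_distrib,
        ← Finset.sum_sub_distrib, ← Finset.sum_add_distrib]
      refine Finset.sum_congr rfl fun j _ => ?_
      simp only [he]
      ring
    rw [h3, he₀, ← h1, ← h2]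
    ring
  rw [key]
  have c1 := G.abs_sum_weight_le k b
  have c2 : |β * e₀| ≤ β * (2 * δ * ‖d‖) := by
    rw [abs_mul, abs_of_pos hβ]
    exact mul_le_mul_of_nonneg_left b₀ hβ.le
  have c3 := mul_le_mul_of_nonneg_right (G.inDegree_le_dSum k)
    (by positivity : 0 ≤ 2 * δ * (2 * ‖u‖ + ‖d‖))
  have c4 : 0 ≤ δ * G.dSum * ‖d‖ :=
    mul_nonneg (mul_nonneg hδ G.dSum_nonneg) (norm_nonneg _)
  have c5 : 0 ≤ δ * β * ‖u‖ := by positivity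
  refine (abs_sub _ _).trans ?_
  linarith

/-- The quadratic form of the linearized torque grows in a step, up to errors of higher order. -/
theorem IsLiftedStep.form_ge {G : WeightedDigraph V} (hG : G.IsUndirected) {β c : ℝ} (hβ : 0 < β)
    (hc : 0 ≤ c) {s : Set V} (hs : IsCoerciveOn G β c s) {p x x' y y' : V → ℝ}
    (hp : ∀ k, 0 ≤ β + ∑ j, G.weight j k * Real.cos (p j - p k)) {δ : ℝ}
    (hx : IsLiftedStep G β s x x') (hy : IsLiftedStep G β s y y')
    (h₁ : ‖x - p‖ ≤ δ) (h₂ : ‖x' - p‖ ≤ δ) (h₃ : ‖y - p‖ ≤ δ) (h₄ : ‖y' - p‖ ≤ δ) :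
    c * ‖(x' - y') - (x - y)‖ ^ 2 - 2 * Fintype.card V * ‖(x' - y') - (x - y)‖ *
      (δ * (4 * G.dSum + 2 * β) * (‖x - y‖ + ‖(x' - y') - (x - y)‖)) ≤
      (x' - y') ⬝ᵥ G.linTorque p (x' - y') - (x - y) ⬝ᵥ G.linTorque p (x - y) := by
  have herr := fun k (hk : k ∈ s) => hx.abs_linearization_le hβ hy h₁ h₂ h₃ h₄ hk
  have hds : ∀ k ∉ s, ((x' - y') - (x - y)) k = 0 := by
    intro k hk
    simp [hx.eq_of_notMem k hk, hy.eq_of_notMem k hk]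
  set u := x - y with hu
  set d := (x' - y') - u with hd
  set ε := δ * (4 * G.dSum + 2 * β) * (‖u‖ + ‖d‖) with hε
  have hu' : x' - y' = u + d := by rw [hd]; abel
  have hexp : (u + d) ⬝ᵥ G.linTorque p (u + d) - u ⬝ᵥ G.linTorque p u =
      2 * (d ⬝ᵥ G.linTorque p u) + d ⬝ᵥ G.linTorque p d := by
    rw [map_add, add_dotProduct, dotProduct_add, dotProduct_add,
      WeightedDigraph.dotProduct_linTorque_comm hG p u d]
    ring
  have hlin : ∑ k, (β + ∑ j, G.weight j k * Real.cos (p j - p k)) * d k ^ 2 -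
      Fintype.card V * (‖d‖ * ε) ≤ d ⬝ᵥ G.linTorque p u := by
    have h : ∀ k, (β + ∑ j, G.weight j k * Real.cos (p j - p k)) * d k ^ 2 - ‖d‖ * ε ≤
        d k * G.linTorque p u k := by
      intro k
      have hdk : |d k| ≤ ‖d‖ := norm_le_pi_norm d k
      by_cases hk : k ∈ s
      · have h1 := mul_le_mul hdk (herr k hk) (abs_nonneg _) (norm_nonneg _)
        rw [← abs_mul] at h1
        have h2 := (abs_le.1 h1).2
        linarith
      · rw [hds k hk]
        have : 0 ≤ ε := by
          have := (norm_nonneg _).trans h₁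
          have := G.dSum_nonneg
          positivity
        have := mul_nonneg (norm_nonneg d) this
        simpa using this
    have := Finset.sum_le_sum fun k (_ : k ∈ Finset.univ) => h k
    rw [Finset.sum_sub_distrib] at this
    simpa [dotProduct] using this
  have h5 := hs.expansion p hp d hds
  have h6 := mul_le_mul_of_nonneg_left (norm_sq_le_sum_sq d) hc
  rw [hu', hexp]
  linarith

/-- In one window, the quadratic form of the linearized torque grows by the square of the window
length up to errors controlled by `δ`, and the linearized torque is bounded by the window
length. -/
theorem exists_window_bounds {G : WeightedDigraph V} (hG : G.IsUndirected) {β c : ℝ}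
    (hβ : 0 < β) (hc : 0 < c) {σ : ℕ → Set V} (hσ : ∀ t, IsCoerciveOn G β c (σ t)) {T : ℕ}
    {τ : ℕ → ℕ} (hτ : IsUpdateSchedule σ T τ) {p : V → ℝ}
    (hp : ∀ k, 0 ≤ β + ∑ j, G.weight j k * Real.cos (p j - p k)) :
    ∃ K, 0 ≤ K ∧ ∀ δ, 0 ≤ δ → ∀ x y : ℕ → V → ℝ, IsLiftedSolution G β σ x →
      IsLiftedSolution G β σ y → ∀ n, (∀ t, τ n ≤ t → ‖x t - p‖ ≤ δ) →
      (∀ t, τ n ≤ t → ‖y t - p‖ ≤ δ) →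
      (x - y) (τ n) ⬝ᵥ G.linTorque p ((x - y) (τ n)) + c / T * windowLength τ (x - y) n ^ 2 -
        δ * K * windowLength τ (x - y) n * (‖(x - y) (τ n)‖ + windowLength τ (x - y) n) ≤
        (x - y) (τ (n + 1)) ⬝ᵥ G.linTorque p ((x - y) (τ (n + 1))) ∧
      ‖G.linTorque p ((x - y) (τ n))‖ ≤ K * (windowLength τ (x - y) n +
        δ * (‖(x - y) (τ n)‖ + windowLength τ (x - y) n)) := by
  obtain ⟨L, hL, hLle⟩ := exists_norm_linearMap_le (G.linTorque p)
  set N : ℝ := (Fintype.card V : ℝ)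
  set E := 4 * G.dSum + 2 * β with hE
  have hW := G.dSum_nonneg
  have hE0 : 0 ≤ E := by positivity
  have hN0 : 0 ≤ N := by positivity
  have hT : (0 : ℝ) < T := by exact_mod_cast hτ.pos
  have hK0 : 0 ≤ β + G.dSum + L + 2 * E + 4 * N * E := by positivity
  refine ⟨β + G.dSum + L + 2 * E + 4 * N * E, hK0, ?_⟩
  intro δ hδ x y hx hy n hxp hyp
  set u : ℕ → V → ℝ := x - y with hu
  set D := windowLength τ u n with hD
  have hD0 : 0 ≤ D := windowLength_nonneg τ u n
  have hle := (hτ.strictMono n.lt_succ_self).le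
  have hun : ∀ t, τ n ≤ t → t ≤ τ (n + 1) → ‖u t‖ ≤ ‖u (τ n)‖ + D := by
    intro t h1 h2
    have := norm_sub_le_windowLength u h1 h2
    have h3 := norm_le_norm_add_norm_sub' (u t) (u (τ n))
    linarith
  constructor
  · have hstep : ∀ t ∈ Finset.Ico (τ n) (τ (n + 1)), c * ‖u (t + 1) - u t‖ ^ 2 -
        2 * N * (δ * E * (‖u (τ n)‖ + 2 * D)) * ‖u (t + 1) - u t‖ ≤
        u (t + 1) ⬝ᵥ G.linTorque p (u (t + 1)) - u t ⬝ᵥ G.linTorque p (u t) := by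
      intro t ht
      obtain ⟨ht1, ht2⟩ := Finset.mem_Ico.1 ht
      have h1 := (hx t).form_ge hG hβ hc.le (hσ t) hp (hy t) (hxp t ht1) (hxp _ (by omega))
        (hyp t ht1) (hyp _ (by omega))
      have h2 := hun t ht1 ht2.le
      have h3 : ‖u (t + 1) - u t‖ ≤ D := norm_step_le_windowLength u ht1 ht2
      have h4 : δ * E * (‖u t‖ + ‖u (t + 1) - u t‖) ≤ δ * E * (‖u (τ n)‖ + 2 * D) :=
        mul_le_mul_of_nonneg_left (by linarith) (by positivity)
      have h5 := mul_le_mul_of_nonneg_left h4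
        (by positivity : 0 ≤ 2 * N * ‖u (t + 1) - u t‖)
      have h6 : c * ‖u (t + 1) - u t‖ ^ 2 - 2 * N * ‖u (t + 1) - u t‖ *
        (δ * E * (‖u t‖ + ‖u (t + 1) - u t‖)) ≤ u (t + 1) ⬝ᵥ G.linTorque p (u (t + 1)) -
          u t ⬝ᵥ G.linTorque p (u t) := h1
      linarith
    have hsum := Finset.sum_le_sum hstep
    rw [Finset.sum_Ico_sub (fun t => u t ⬝ᵥ G.linTorque p (u t)) hle, Finset.sum_sub_distrib,
      ← Finset.mul_sum, ← Finset.mul_sum] at hsum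
    have hCS : c / T * D ^ 2 ≤ c * ∑ t ∈ Finset.Ico (τ n) (τ (n + 1)), ‖u (t + 1) - u t‖ ^ 2 := by
      rw [div_mul_eq_mul_div, div_le_iff₀ hT, mul_assoc, mul_comm _ (T : ℝ)]
      exact mul_le_mul_of_nonneg_left (windowLength_sq_le u (hτ.lt_add n)) hc.le
    have hD' : ∑ t ∈ Finset.Ico (τ n) (τ (n + 1)), ‖u (t + 1) - u t‖ = D := rfl
    rw [hD'] at hsum
    have h7 : 2 * N * (δ * E * (‖u (τ n)‖ + 2 * D)) * D ≤
        δ * (β + G.dSum + L + 2 * E + 4 * N * E) * D * (‖u (τ n)‖ + D) := by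
      have e1 : 2 * N * (δ * E * (‖u (τ n)‖ + 2 * D)) * D ≤
          δ * (4 * N * E) * D * (‖u (τ n)‖ + D) := by
        have : 0 ≤ δ * N * E * D * ‖u (τ n)‖ := by positivity
        linarith
      have e2 : 0 ≤ δ * (β + G.dSum + L + 2 * E) * D * (‖u (τ n)‖ + D) := by positivity
      linarith
    linarith
  · refine (pi_norm_le_iff_of_nonneg (by positivity)).2 fun k => ?_
    obtain ⟨t, ht1, ht2, hk⟩ := hτ.exists_mem k n
    have h1 := (hx t).abs_linearization_le hβ (hy t) (hxp t ht1) (hxp _ (by omega))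
        (hyp t ht1) (hyp _ (by omega)) hk
    have h1' : |(β + ∑ j, G.weight j k * Real.cos (p j - p k)) * (u (t + 1) - u t) k -
      G.linTorque p (u t) k| ≤ δ * E * (‖u t‖ + ‖u (t + 1) - u t‖) := h1
    have h2 := hun t ht1 ht2.le
    have h3 : ‖u (t + 1) - u t‖ ≤ D := norm_step_le_windowLength u ht1 ht2
    have h4 : δ * E * (‖u t‖ + ‖u (t + 1) - u t‖) ≤ δ * E * (‖u (τ n)‖ + 2 * D) :=
      mul_le_mul_of_nonneg_left (by linarith) (by positivity)
    have h5 : |∑ j, G.weight j k * Real.cos (p j - p k)| ≤ G.dSum :=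
      (G.abs_sum_weight_le k (B := 1) fun j => Real.abs_cos_le_one _).trans
        (by rw [mul_one]; exact G.inDegree_le_dSum k)
    have h6 : |(β + ∑ j, G.weight j k * Real.cos (p j - p k)) * (u (t + 1) - u t) k| ≤
        (β + G.dSum) * D := by
      rw [abs_mul]
      refine mul_le_mul ?_ ((norm_le_pi_norm (u (t + 1) - u t) k).trans h3) (abs_nonneg _)
        (by positivity)
      rw [abs_of_nonneg (hp k)]
      linarith [(abs_le.1 h5).2]
    have h7 : |G.linTorque p (u t - u (τ n)) k| ≤ L * D :=
      (norm_le_pi_norm (G.linTorque p (u t - u (τ n))) k).trans ((hLle _).trans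
        (mul_le_mul_of_nonneg_left (norm_sub_le_windowLength u ht1 ht2.le) hL))
    have h8 : G.linTorque p (u t) k - G.linTorque p (u t - u (τ n)) k
        = G.linTorque p (u (τ n)) k := by
      rw [map_sub, Pi.sub_apply]; ring
    rw [Real.norm_eq_abs, ← h8]
    have h9 : 0 ≤ (2 * E + 4 * N * E) * D := by positivity
    have h10 : 0 ≤ (β + G.dSum + L + 4 * N * E) * (δ * (‖u (τ n)‖ + D)) := by positivity
    have h11 : 0 ≤ δ * E * ‖u (τ n)‖ := by positivity
    rw [abs_le] at h1' h6 h7 ⊢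
    constructor <;> linarith [h1'.1, h1'.2, h6.1, h6.2, h7.1, h7.2]

/-- Positions from which a solution stays close to an unstable equilibrium `p` differ by vectors
outside the cone `η ‖u‖² < u ⬝ H u`, in which differences grow; so they form a null set. -/
theorem exists_volume_window_eq_zero {G : WeightedDigraph V} (hG : G.IsUndirected) {β c : ℝ}
    (hβ : 0 < β) (hc : 0 < c) {σ : ℕ → Set V} (hσ : ∀ t, IsCoerciveOn G β c (σ t)) {T : ℕ}
    {τ : ℕ → ℕ} (hτ : IsUpdateSchedule σ T τ) {p : V → ℝ}
    (hp : ∀ k, 0 ≤ β + ∑ j, G.weight j k * Real.cos (p j - p k)) {v : V → ℝ}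
    (hv : 0 < v ⬝ᵥ G.linTorque p v) :
    ∃ δ > 0, ∀ n, volume {z | ∃ x, IsLiftedSolution G β σ x ∧ x (τ n) = z ∧
      ∀ t, τ n ≤ t → ‖x t - p‖ ≤ δ} = 0 := by
  obtain ⟨K, hK, hbound⟩ := exists_window_bounds hG hβ hc hσ hτ hp
  obtain ⟨L, hL, hLle⟩ := exists_norm_linearMap_le (G.linTorque p)
  have hT : (0 : ℝ) < T := by exact_mod_cast hτ.pos
  obtain ⟨η₀, hη₀, hcone⟩ := exists_cone_growth (G.linTorque p)
    (WeightedDigraph.dotProduct_linTorque_comm hG p) (by positivity : 0 < c / T) hK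
  set q : (V → ℝ) → ℝ := fun u => u ⬝ᵥ G.linTorque p u with hq
  obtain ⟨η, hη, hηη₀, hηv⟩ : ∃ η, 0 < η ∧ η ≤ η₀ ∧ η * ‖v‖ ^ 2 < q v := by
    refine ⟨min η₀ (q v / (‖v‖ ^ 2 + 1)), lt_min hη₀ (div_pos hv (by positivity)),
      min_le_left _ _, ?_⟩
    have h1 : min η₀ (q v / (‖v‖ ^ 2 + 1)) * (‖v‖ ^ 2 + 1) ≤ q v := by
      rw [← le_div_iff₀ (by positivity)]
      exact min_le_right _ _
    have h2 : 0 < min η₀ (q v / (‖v‖ ^ 2 + 1)) := lt_min hη₀ (div_pos hv (by positivity))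
    linarith
  obtain ⟨δ, hδ, κ, hκ, hgrow⟩ := hcone η hη hηη₀
  refine ⟨δ, hδ, fun n => ?_⟩
  refine volume_eq_zero_of_sub_mem (C := {u | q u ≤ η * ‖u‖ ^ 2}) (v := v) ?_ ?_ ?_
  · refine isClosed_le ?_ (by fun_prop)
    simp only [hq, dotProduct]
    have := G.continuous_linTorque p
    fun_prop
  · intro t ht hmem
    have h1 : q (t • v) = t ^ 2 * q v := by
      simp only [hq, map_smul, smul_dotProduct, dotProduct_smul, smul_eq_mul]
      ring
    have h2 : ‖t • v‖ ^ 2 = t ^ 2 * ‖v‖ ^ 2 := by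
      rw [norm_smul, mul_pow, Real.norm_eq_abs, sq_abs]
    have h3 : t ^ 2 * q v ≤ η * (t ^ 2 * ‖v‖ ^ 2) := by
      rw [← h1, ← h2]; exact hmem
    have h4 : 0 < t ^ 2 := by positivity
    have h5 := mul_lt_mul_of_pos_left hηv h4
    linarith
  · rintro _ ⟨x, hx, rfl, hxp⟩ _ ⟨y, hy, rfl, hyp⟩
    by_contra hnot
    have hnot' : η * ‖(x - y) (τ n)‖ ^ 2 < q ((x - y) (τ n)) := not_le.1 hnot
    refine not_bddAbove_of_growth
      (f := fun m => q ((x - y) (τ (n + m))) - η * ‖(x - y) (τ (n + m))‖ ^ 2)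
      (B := Fintype.card V * (2 * δ * (L * (2 * δ)))) hκ (by simpa using hnot') ?_ ?_
    · intro m hm
      have hmono : τ n ≤ τ (n + m) := hτ.strictMono.monotone (by omega)
      obtain ⟨b1, b2⟩ := hbound δ hδ.le x y hx hy (n + m)
        (fun t ht => hxp t (hmono.trans ht)) (fun t ht => hyp t (hmono.trans ht))
      exact hgrow δ _ _ (windowLength τ (x - y) (n + m)) hδ.le le_rfl
        (windowLength_nonneg _ _ _) b1 (norm_sub_le_windowLength _
          (hτ.strictMono (Nat.lt_succ_self _)).le le_rfl) b2 hm
    · intro m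
      have hmono : τ n ≤ τ (n + m) := hτ.strictMono.monotone (by omega)
      have h1 : ‖(x - y) (τ (n + m))‖ ≤ 2 * δ := by
        have : (x - y) (τ (n + m)) = (x (τ (n + m)) - p) - (y (τ (n + m)) - p) := by
          simp only [Pi.sub_apply]; abel
        rw [this]
        refine (norm_sub_le _ _).trans ?_
        linarith [hxp _ hmono, hyp _ hmono]
      have h2 : q ((x - y) (τ (n + m))) ≤ Fintype.card V * (2 * δ * (L * (2 * δ))) := by
        refine (le_abs_self _).trans ((abs_dotProduct_le _ _).trans ?_)
        refine mul_le_mul_of_nonneg_left (mul_le_mul h1 ((hLle _).trans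
          (mul_le_mul_of_nonneg_left h1 hL)) (norm_nonneg _) (by positivity)) (by positivity)
      have h3 : 0 ≤ η * ‖(x - y) (τ (n + m))‖ ^ 2 := by positivity
      linarith

/-- A trajectory converges to an equilibrium, almost surely not an unstable one. -/
theorem ae_lifted_synchronizes {G : WeightedDigraph V} (hV : G.verts = Set.univ)
    (hG : G.HasSyncLandscape) {β c : ℝ} (hβ : 0 < β) (hc : 0 < c) {σ : ℕ → Set V}
    (hσ : ∀ t, IsCoerciveOn G β c (σ t)) {T : ℕ} {τ : ℕ → ℕ} (hτ : IsUpdateSchedule σ T τ)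
    (hnull : ∀ t, ReflectsNull (IsLiftedStep G β (σ t))) :
    ∀ᵐ x₀ : V → ℝ, ∀ x : ℕ → V → ℝ, IsLiftedSolution G β σ x → x 0 = x₀ →
      ∃ φ : ℝ, ∀ k, Tendsto (fun t => Real.cos (x t k - φ)) atTop (𝓝 1) := by
  set P : Set (V → ℝ) := {p | (∀ k, 0 ≤ β + ∑ j, G.weight j k * Real.cos (p j - p k)) ∧
    ∃ v, 0 < v ⬝ᵥ G.linTorque p v} with hP
  have hae := ae_forall_not_tendsto (X := {x | IsLiftedSolution G β σ x}) (P := P) (by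
    rintro p ⟨hp, v, hv⟩
    obtain ⟨δ, hδ, hzero⟩ := exists_volume_window_eq_zero hG.isUndirected hβ hc hσ hτ hp hv
    refine ⟨δ, hδ, measure_mono_null (t := ⋃ n, {x₀ | ∃ x : ℕ → V → ℝ, x 0 = x₀ ∧
      (∀ t, IsLiftedStep G β (σ t) (x t) (x (t + 1))) ∧ x (τ n) ∈ {z | ∃ x,
        IsLiftedSolution G β σ x ∧ x (τ n) = z ∧ ∀ t, τ n ≤ t → ‖x t - p‖ ≤ δ}}) ?_
      (measure_iUnion_null fun n => volume_initial_eq_zero hnull (τ n) (hzero n))⟩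
    rintro x₀ ⟨x, hx, h0, hev⟩
    obtain ⟨n, hn⟩ := eventually_atTop.1 hev
    refine Set.mem_iUnion.2 ⟨n, x, h0, hx, x, hx, rfl, fun t ht => ?_⟩
    have := hn t ((hτ.strictMono.id_le n).trans ht)
    rw [← dist_eq_norm]
    exact (Metric.mem_ball.1 this).le)
  filter_upwards [hae] with x₀ hx₀ x hx h0
  obtain ⟨p, hlim, hp, hpβ⟩ := hx.exists_tendsto hG hβ hc hσ hτ
  have hsync : ∀ j k, Real.cos (p j - p k) = 1 := by
    by_contra hne
    push Not at hne
    obtain ⟨j, k, hjk⟩ := hne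
    exact hx₀ x hx h0 p ⟨hpβ, hG.saddle p hp ⟨j, by simp [hV], k, by simp [hV], hjk⟩⟩ hlim
  rcases isEmpty_or_nonempty V with hempty | ⟨⟨k₀⟩⟩
  · exact ⟨0, fun k => isEmptyElim k⟩
  · refine ⟨p k₀, fun k => ?_⟩
    rw [← hsync k k₀]
    exact (Real.continuous_cos.tendsto _).comp
      ((((continuous_apply k).tendsto p).comp hlim).sub_const _)

end CircleSync

namespace CircleSync

/-! ### Locally asynchronous updates -/

variable {V : Type*} [Fintype V]

theorem isCoerciveOn_of_forall_not_edge {G : WeightedDigraph V} {β : ℝ} {s : Set V}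
    (hs : ∀ j ∈ s, ∀ k ∈ s, ¬ G.Edge j k) : IsCoerciveOn G β β s := by
  have hzero : ∀ d : V → ℝ, (∀ k ∉ s, d k = 0) → ∀ j k, d k * (G.weight j k * d j) = 0 := by
    intro d hd j k
    by_cases hj : j ∈ s
    · by_cases hk : k ∈ s
      · have : G.weight j k = 0 := not_not.1 (hs j hj k hk)
        rw [this, zero_mul, mul_zero]
      · rw [hd k hk, zero_mul]
    · rw [hd j hj, mul_zero, mul_zero]
  refine ⟨fun d hd => ?_, fun p hp d hd => ?_⟩
  · have : ∑ k, d k * ∑ j, G.weight j k * d j = 0 := Finset.sum_eq_zero fun k _ => by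
      rw [Finset.mul_sum]
      exact Finset.sum_eq_zero fun j _ => hzero d hd j k
    rw [this, add_zero]
  · rw [dotProduct, Finset.mul_sum, Finset.mul_sum, ← Finset.sum_add_distrib]
    refine Finset.sum_le_sum fun k _ => ?_
    have h1 : d k * G.linTorque p d k =
        -((∑ j, G.weight j k * Real.cos (p j - p k)) * d k ^ 2) := by
      rw [WeightedDigraph.linTorque_apply, Finset.mul_sum, Finset.sum_mul,
        ← Finset.sum_neg_distrib]
      refine Finset.sum_congr rfl fun j _ => ?_
      linear_combination Real.cos (p j - p k) * hzero d hd j k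
    have h2 := mul_nonneg (hp k) (sq_nonneg (d k))
    rw [h1]
    linarith

/-! ### Synchronous updates with large inertia -/

theorem WeightedDigraph.inDegree_le_dMax (G : WeightedDigraph V) (k : V) :
    G.inDegree k ≤ G.dMax :=
  le_ciSup (Set.finite_range G.inDegree).bddAbove k

theorem WeightedDigraph.dMax_nonneg (G : WeightedDigraph V) : 0 ≤ G.dMax :=
  Real.iSup_nonneg G.inDegree_nonneg

/-- In an undirected graph each edge counts for two vertices. -/
theorem WeightedDigraph.two_mul_dMax_le_dSum {G : WeightedDigraph V} (hG : G.IsUndirected) :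
    2 * G.dMax ≤ G.dSum := by
  classical
  have h : ∀ k, G.inDegree k ≤ G.dSum / 2 := by
    intro k
    have h1 : G.inDegree k ≤ ∑ j ∈ Finset.univ.erase k, G.inDegree j := by
      rw [inDegree, ← Finset.add_sum_erase _ _ (Finset.mem_univ k), G.weight_self, zero_add]
      refine Finset.sum_le_sum fun j _ => ?_
      rw [hG j k]
      exact Finset.single_le_sum (f := fun i => G.weight i j)
        (fun i _ => G.weight_nonneg i j) (Finset.mem_univ k)
    have h2 : G.dSum = G.inDegree k + ∑ j ∈ Finset.univ.erase k, G.inDegree j :=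
      (Finset.add_sum_erase _ _ (Finset.mem_univ k)).symm
    linarith
  have : G.dMax ≤ G.dSum / 2 := Real.iSup_le h (by linarith [G.dSum_nonneg])
  linarith

/-- As `d_max / d_sum ≤ 1 / 2`, the number `M` in the inertia bound is less than `4 / 5`. -/
theorem WeightedDigraph.InertiaBound.seven_mul_dMax_lt {G : WeightedDigraph V}
    (hG : G.IsUndirected) {β : ℝ} (h : G.InertiaBound β) : 7 * G.dMax < 2 * β := by
  obtain ⟨hβ, M, hM, heq, hle⟩ := h
  have h1 := WeightedDigraph.two_mul_dMax_le_dSum hG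
  have h0 := G.dMax_nonneg
  rcases eq_or_lt_of_le h0 with h2 | h2
  · rw [← h2]
    linarith
  have hS : 0 < G.dSum := by linarith
  have h3 : Real.exp M - 1 ≤ 3 / 2 * M := by
    have : (Real.exp M - 1) * G.dSum ≤ 3 / 2 * M * G.dSum := by
      rw [heq]
      have := mul_le_mul_of_nonneg_left h1 hM.le
      linarith
    exact le_of_mul_le_mul_right this hS
  have h4 := Real.sum_le_exp_of_nonneg hM.le 4
  simp only [Finset.sum_range_succ, Finset.sum_range_zero, Nat.factorial] at h4
  norm_num at h4
  have h5 : M < 4 / 5 := by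
    by_contra hge
    push Not at hge
    have : M / 2 + M ^ 2 / 6 ≤ 1 / 2 := by
      refine le_of_mul_le_mul_left ?_ hM
      linarith
    nlinarith
  have h6 : 5 / 2 < 2 / M := by
    rw [lt_div_iff₀ hM]
    linarith
  have h7 := mul_lt_mul_of_pos_left h6 h2
  linarith

theorem sum_weight_sq_le {G : WeightedDigraph V} (hG : G.IsUndirected) (d : V → ℝ) :
    ∑ k, ∑ j, G.weight j k * (d j ^ 2 + d k ^ 2) ≤ 2 * (G.dMax * ∑ k, d k ^ 2) := by
  have h1 : ∑ k, ∑ j, G.weight j k * d k ^ 2 ≤ G.dMax * ∑ k, d k ^ 2 := by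
    rw [Finset.mul_sum]
    refine Finset.sum_le_sum fun k _ => ?_
    rw [← Finset.sum_mul]
    exact mul_le_mul_of_nonneg_right (G.inDegree_le_dMax k) (sq_nonneg _)
  have h2 : ∑ k, ∑ j, G.weight j k * d j ^ 2 = ∑ k, ∑ j, G.weight j k * d k ^ 2 := by
    rw [Finset.sum_comm]
    exact Finset.sum_congr rfl fun k _ => Finset.sum_congr rfl fun j _ => by rw [hG k j]
  simp only [mul_add, Finset.sum_add_distrib]
  linarith

/-- If the inertia exceeds `7 / 2` times all degrees, then it dominates all couplings. -/
theorem isCoerciveOn_univ {G : WeightedDigraph V} (hG : G.IsUndirected) {β : ℝ}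
    (h : 7 * G.dMax < 2 * β) : IsCoerciveOn G β (β / 7) Set.univ := by
  refine ⟨fun d _ => ?_, fun p _ d _ => ?_⟩
  · have h1 : -(2 * ∑ k, d k * ∑ j, G.weight j k * d j) ≤
        ∑ k, ∑ j, G.weight j k * (d j ^ 2 + d k ^ 2) := by
      rw [Finset.mul_sum, ← Finset.sum_neg_distrib]
      refine Finset.sum_le_sum fun k _ => ?_
      rw [Finset.mul_sum, Finset.mul_sum, ← Finset.sum_neg_distrib]
      refine Finset.sum_le_sum fun j _ => ?_
      have := mul_nonneg (G.weight_nonneg j k) (sq_nonneg (d j + d k))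
      linarith
    have h2 := sum_weight_sq_le hG d
    have h3 : 0 ≤ ∑ k, d k ^ 2 := Finset.sum_nonneg fun _ _ => sq_nonneg _
    have h4 := mul_le_mul_of_nonneg_right h.le h3
    have h5 := mul_nonneg G.dMax_nonneg h3
    linarith
  · have h1 := WeightedDigraph.two_mul_dotProduct_linTorque hG p d d
    have h2 : ∑ k, ∑ j, G.weight j k * (Real.cos (p j - p k) * ((d j - d k) * (d j - d k))) ≤
        ∑ k, ∑ j, 2 * (G.weight j k * (d j ^ 2 + d k ^ 2)) := by
      refine Finset.sum_le_sum fun k _ => Finset.sum_le_sum fun j _ => ?_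
      have e1 := mul_le_of_le_one_left (mul_self_nonneg (d j - d k)) (Real.cos_le_one (p j - p k))
      have e2 : Real.cos (p j - p k) * ((d j - d k) * (d j - d k)) ≤ 2 * (d j ^ 2 + d k ^ 2) := by
        nlinarith [sq_nonneg (d j + d k)]
      have := mul_le_mul_of_nonneg_left e2 (G.weight_nonneg j k)
      linarith
    simp only [← Finset.mul_sum] at h2
    have h3 := sum_weight_sq_le hG d
    have h4 : 0 ≤ ∑ k, d k ^ 2 := Finset.sum_nonneg fun _ _ => sq_nonneg _
    have h5 : (β - G.dMax) * ∑ k, d k ^ 2 ≤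
        ∑ k, (β + ∑ j, G.weight j k * Real.cos (p j - p k)) * d k ^ 2 := by
      rw [Finset.mul_sum]
      refine Finset.sum_le_sum fun k _ => mul_le_mul_of_nonneg_right ?_ (sq_nonneg _)
      have := (abs_le.1 (G.abs_sum_weight_le k (f := fun j => Real.cos (p j - p k)) (B := 1)
        fun j => Real.abs_cos_le_one _)).1
      linarith [G.inDegree_le_dMax k]
    have h6 := mul_le_mul_of_nonneg_right h.le h4
    have h7 := mul_nonneg G.dMax_nonneg h4
    linarith

theorem mul_abs_sub_le_abs_sin_sub_sin {a b m : ℝ} (ha : |a| ≤ Real.pi / 2)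
    (hb : |b| ≤ Real.pi / 2) (hma : m ≤ Real.cos a) (hmb : m ≤ Real.cos b) :
    m * |a - b| ≤ |Real.sin a - Real.sin b| := by
  wlog hab : b ≤ a generalizing a b
  · have := this hb ha hmb hma (le_of_not_ge hab)
    rwa [abs_sub_comm a b, abs_sub_comm (Real.sin a)]
  have hπ := Real.pi_pos
  rw [abs_le] at ha hb
  have h := (convex_Icc b a).mul_sub_le_image_sub_of_le_deriv (f := Real.sin) (C := m)
    Real.continuous_sin.continuousOn Real.differentiable_sin.differentiableOn (fun t ht => by
      rw [Real.deriv_sin]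
      rw [interior_Icc] at ht
      rcases le_total 0 t with h0 | h0
      · exact hma.trans (Real.cos_le_cos_of_nonneg_of_le_pi h0 (by linarith) ht.2.le)
      · refine hmb.trans ?_
        rw [← Real.cos_neg b, ← Real.cos_neg t]
        exact Real.cos_le_cos_of_nonneg_of_le_pi (by linarith) (by linarith) (by linarith [ht.1]))
    b (Set.left_mem_Icc.2 hab) a (Set.right_mem_Icc.2 hab) hab
  rw [abs_of_nonneg (by linarith)]
  exact h.trans (le_abs_self _)

/-- With large inertia, an updated agent moves by a small angle. -/
theorem IsLiftedStep.abs_sub_le_and_cos_ge {G : WeightedDigraph V} {β : ℝ}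
    (h : 7 * G.dMax < 2 * β) {x x' : V → ℝ} (hx : IsLiftedStep G β Set.univ x x') (k : V) :
    |x' k - x k| ≤ Real.pi / 2 ∧ 19 / 20 ≤ Real.cos (x' k - x k) := by
  have hd0 := G.dMax_nonneg
  have hβ : 0 < β := by linarith
  have hdeg := G.inDegree_le_dMax k
  have hpos : 0 < Real.cos (x' k - x k) := by
    by_contra hneg
    push Not at hneg
    have h1 := hx.maximal k (Set.mem_univ k) (x k)
    rw [sub_self, Real.cos_zero, mul_one, ← neg_sub (x' k), Real.cos_neg] at h1
    have h2 := (abs_le.1 (G.abs_sum_weight_le k (f := fun j => Real.cos (x j - x k)) (B := 1)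
        fun j => Real.abs_cos_le_one _)).1
    have h3 := (abs_le.1 (G.abs_sum_weight_le k (f := fun j => Real.cos (x j - x' k)) (B := 1)
        fun j => Real.abs_cos_le_one _)).2
    have h4 := mul_nonneg hβ.le (neg_nonneg.2 hneg)
    linarith
  have hsin : |Real.sin (x' k - x k)| ≤ 2 / 7 := by
    have h1 := hx.critical k (Set.mem_univ k)
    have h2 := G.abs_sum_weight_le k (f := fun j => Real.sin (x j - x' k)) (B := 1)
        fun j => Real.abs_sin_le_one _
    rw [← h1, abs_mul, abs_of_pos hβ] at h2
    refine le_of_mul_le_mul_left ?_ hβ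
    linarith
  constructor
  · by_contra hlt
    push Not at hlt
    have := Real.cos_nonpos_of_pi_div_two_le_of_le hlt.le
      (by linarith [hx.abs_sub_le k, Real.pi_pos])
    rw [Real.cos_abs] at this
    linarith
  · have h1 := Real.sin_sq_add_cos_sq (x' k - x k)
    have h2 : Real.sin (x' k - x k) ^ 2 ≤ (2 / 7) ^ 2 := by
      rw [← sq_abs]
      exact pow_le_pow_left₀ (abs_nonneg _) hsin 2
    nlinarith

/-- With large inertia, the displacements are a contraction, so the step is expanding from below. -/
theorem reflectsNull_isLiftedStep_univ {G : WeightedDigraph V} {β : ℝ}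
    (h : 7 * G.dMax < 2 * β) : ReflectsNull (IsLiftedStep G β Set.univ) := by
  have hd0 := G.dMax_nonneg
  have hβ : 0 < β := by linarith
  refine reflectsNull_of_dist_le 10 fun x x' y y' hx hy => ?_
  rw [dist_eq_norm, dist_eq_norm]
  set u := x - y with hu
  have hcontr : ‖(x' - y') - u‖ ≤ 9 / 10 * ‖u‖ := by
    refine (pi_norm_le_iff_of_nonneg (by positivity)).2 fun k => ?_
    rw [Real.norm_eq_abs]
    obtain ⟨a1, a2⟩ := hx.abs_sub_le_and_cos_ge h k
    obtain ⟨b1, b2⟩ := hy.abs_sub_le_and_cos_ge h k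
    have h1 := mul_abs_sub_le_abs_sin_sub_sin a1 b1 a2 b2
    have hd : x' k - x k - (y' k - y k) = ((x' - y') - u) k := by
      simp only [hu, Pi.sub_apply]; ring
    rw [hd] at h1
    set e := |((x' - y') - u) k| with he
    have h2 : β * |Real.sin (x' k - x k) - Real.sin (y' k - y k)| ≤
        G.inDegree k * (2 * ‖u‖ + e) := by
      rw [← abs_of_pos hβ, ← abs_mul, mul_sub, hx.critical k (Set.mem_univ k),
        hy.critical k (Set.mem_univ k), ← Finset.sum_sub_distrib]
      simp only [← mul_sub]
      refine G.abs_sum_weight_le k fun j => (Real.abs_sin_sub_sin_le _ _).trans ?_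
      have e1 : |u j| ≤ ‖u‖ := norm_le_pi_norm u j
      have e2 : |u k| ≤ ‖u‖ := norm_le_pi_norm u k
      have e3 : x j - x' k - (y j - y' k) = u j - u k - ((x' - y') - u) k := by
        simp only [hu, Pi.sub_apply]; ring
      rw [e3]
      refine (abs_sub _ _).trans ?_
      have := abs_sub (u j) (u k)
      linarith
    have h3 := mul_le_mul_of_nonneg_left h1 hβ.le
    have he0 : 0 ≤ e := abs_nonneg _
    have h4 := mul_le_mul_of_nonneg_right (G.inDegree_le_dMax k)
      (by positivity : 0 ≤ 2 * ‖u‖ + e)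
    have h5 := mul_le_mul_of_nonneg_right h.le (by positivity : 0 ≤ 2 * ‖u‖ + e)
    refine le_of_mul_le_mul_left ?_ hβ
    have h6 := mul_nonneg hβ.le (norm_nonneg u)
    have h7 := mul_nonneg hβ.le he0
    linarith
  have h1 := norm_sub_norm_le u (x' - y')
  rw [norm_sub_rev u] at h1
  linarith

/-! ### Synchronization in discrete time on undirected graphs -/

theorem ae_synchronizes_async {G : WeightedDigraph V} (hV : G.verts = Set.univ)
    (hG : G.HasSyncLandscape) {β : ℝ} (hβ : 0 < β) {σ : ℕ → Set V}
    (hσ : IsLocallyAsynchronous G σ) (hreg : UpdatesRegularly σ) :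
    ∀ᵐ θ₀ : V → S1, ∀ θ : ℕ → V → S1, IsDiscreteTimeSolution G β σ θ → θ 0 = θ₀ →
      Synchronizes atTop θ := by
  obtain ⟨T, τ, h1, h2, h3, h4⟩ := hreg
  refine ae_synchronizes_of_lifted (ae_lifted_synchronizes hV hG hβ hβ
    (fun t => isCoerciveOn_of_forall_not_edge (hσ t)) ⟨h1, h2, h3, h4⟩ fun t =>
    reflectsNull_isLiftedStep G hβ _ fun s hs ⟨k, hk⟩ => ⟨k, hk, fun j hj => ?_⟩)
  exact hσ t j (hs hj) k (hs hk)

theorem ae_synchronizes_sync {G : WeightedDigraph V} (hV : G.verts = Set.univ)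
    (hG : G.HasSyncLandscape) {β : ℝ} (hβ : G.InertiaBound β) :
    ∀ᵐ θ₀ : V → S1, ∀ θ : ℕ → V → S1, IsDiscreteTimeSolution G β (fun _ => Set.univ) θ →
      θ 0 = θ₀ → Synchronizes atTop θ := by
  have h7 := hβ.seven_mul_dMax_lt hG.isUndirected
  have hβ0 : 0 < β := hβ.1
  refine ae_synchronizes_of_lifted (ae_lifted_synchronizes (T := 2) (τ := id) hV hG hβ0
    (by positivity : 0 < β / 7) (fun _ => isCoerciveOn_univ hG.isUndirected h7)
    ⟨rfl, strictMono_id, fun n => by simp, fun k n => ⟨n, le_rfl, Nat.lt_succ_self n, trivial⟩⟩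
    fun _ => reflectsNull_isLiftedStep_univ h7)

end CircleSync

namespace CircleSync

/-! ### Solutions in continuous time -/

variable {V : Type*} [Fintype V]

namespace IsContinuousTimeSolution

theorem hasDerivWithinAt {G : WeightedDigraph V} {α : ℝ} {x : ℝ → V → ℝ}
    (hx : IsContinuousTimeSolution G α x) {t : ℝ} (ht : 0 ≤ t) :
    HasDerivWithinAt x ((2 * α) • G.torque (x t)) (Set.Ici 0) t :=
  hasDerivWithinAt_pi.2 fun k => hx k t ht

theorem hasDerivWithinAt_Ici {G : WeightedDigraph V} {α : ℝ} {x : ℝ → V → ℝ}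
    (hx : IsContinuousTimeSolution G α x) {t : ℝ} (ht : 0 ≤ t) :
    HasDerivWithinAt x ((2 * α) • G.torque (x t)) (Set.Ici t) t :=
  (hx.hasDerivWithinAt ht).mono (Set.Ici_subset_Ici.2 ht)

theorem continuousOn {G : WeightedDigraph V} {α : ℝ} {x : ℝ → V → ℝ}
    (hx : IsContinuousTimeSolution G α x) : ContinuousOn x (Set.Ici 0) := fun _ ht =>
  (hx.hasDerivWithinAt ht).continuousWithinAt

theorem continuousOn_Icc {G : WeightedDigraph V} {α : ℝ} {x : ℝ → V → ℝ}
    (hx : IsContinuousTimeSolution G α x) {a b : ℝ} (ha : 0 ≤ a) :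
    ContinuousOn x (Set.Icc a b) :=
  hx.continuousOn.mono fun _ ht => ha.trans ht.1

end IsContinuousTimeSolution

theorem norm_smul_torque_sub_le (G : WeightedDigraph V) {α : ℝ} (hα : 0 < α) (x y : V → ℝ) :
    ‖(2 * α) • G.torque x - (2 * α) • G.torque y‖ ≤ 4 * α * G.dSum * ‖x - y‖ := by
  have h := G.dSum_nonneg
  refine (pi_norm_le_iff_of_nonneg (by positivity)).2 fun k => ?_
  rw [Real.norm_eq_abs, Pi.sub_apply, Pi.smul_apply, Pi.smul_apply, smul_eq_mul, smul_eq_mul,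
    ← mul_sub, abs_mul, abs_of_pos (by positivity : 0 < 2 * α)]
  have := mul_le_mul_of_nonneg_left (G.abs_torque_sub_le x y k) (by positivity : 0 ≤ 2 * α)
  linarith

/-- By Grönwall's inequality in backward time, the initial condition is a Lipschitz function of the
position at time `T`. -/
theorem reflectsNull_continuousTime (G : WeightedDigraph V) {α : ℝ} (hα : 0 < α) {T : ℝ}
    (hT : 0 ≤ T) :
    ReflectsNull fun x₀ z => ∃ x, IsContinuousTimeSolution G α x ∧ x 0 = x₀ ∧ x T = z := by
  refine reflectsNull_of_dist_le (Real.exp (4 * α * G.dSum * T)) ?_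
  rintro _ _ _ _ ⟨x, hx, rfl, rfl⟩ ⟨y, hy, rfl, rfl⟩
  have hmap : Set.MapsTo (fun s => T - s) (Set.Icc 0 T) (Set.Ici 0) := fun s hs => by
    simpa using hs.2
  have hd : ∀ {z : ℝ → V → ℝ}, IsContinuousTimeSolution G α z → ∀ s ∈ Set.Ico 0 T,
      HasDerivAt (fun s => z (T - s)) (-((2 * α) • G.torque (z (T - s)))) s := by
    intro z hz s hs
    have h1 : 0 < T - s := by linarith [hs.2]
    exact HasDerivAt.comp_const_sub T s
      ((hz.hasDerivWithinAt h1.le).hasDerivAt (Ici_mem_nhds h1))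
  have h := norm_le_gronwallBound_of_norm_deriv_right_le
    (f := fun s => x (T - s) - y (T - s))
    (f' := fun s => -((2 * α) • G.torque (x (T - s))) - -((2 * α) • G.torque (y (T - s))))
    (δ := ‖x T - y T‖) (K := 4 * α * G.dSum) (ε := 0) (a := 0) (b := T)
    ((hx.continuousOn.comp (by fun_prop) hmap).sub (hy.continuousOn.comp (by fun_prop) hmap))
    (fun s hs => ((hd hx s hs).sub (hd hy s hs)).hasDerivWithinAt) (by simp)
    (fun s hs => by
      rw [add_zero, neg_sub_neg, norm_sub_rev]
      exact norm_smul_torque_sub_le G hα _ _)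
    T ⟨hT, le_rfl⟩
  rw [gronwallBound_ε0, sub_self, sub_zero, ← dist_eq_norm, ← dist_eq_norm] at h
  linarith

/-- It suffices to prove synchronization for almost all lifted initial conditions. -/
theorem ae_synchronizes_of_lifted_continuousTime {G : WeightedDigraph V} {α : ℝ}
    (h : ∀ᵐ x₀ : V → ℝ, ∀ x : ℝ → V → ℝ, IsContinuousTimeSolution G α x → x 0 = x₀ →
      ∃ φ : ℝ, ∀ k, Tendsto (fun t => Real.cos (x t k - φ)) atTop (𝓝 1)) :
    ∀ᵐ θ₀ : V → S1, ∀ θ : ℝ → V → ℝ, IsContinuousTimeSolution G α θ →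
      (∀ k, (θ 0 k : S1) = θ₀ k) → Synchronizes atTop (fun t k => (θ t k : S1)) := by
  refine ae_circle_of_ae_lift ?_
  filter_upwards [h] with x₀ hx₀ θ hθ h0
  have hshift : ∀ k, ∃ n : ℤ, n • (2 * Real.pi) = x₀ k - θ 0 k := fun k => by
    rw [← AddCircle.coe_eq_zero_iff, AddCircle.coe_sub, h0, sub_self]
  choose n hn using hshift
  have hn' : ∀ k, (n k : ℝ) * (2 * Real.pi) = x₀ k - θ 0 k := fun k => by
    rw [← hn, zsmul_eq_mul]
  have hsol : IsContinuousTimeSolution G α fun t k => θ t k + n k * (2 * Real.pi) := by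
    intro k t ht
    refine ((hθ k t ht).add_const _).congr_deriv ?_
    congr 1
    refine Finset.sum_congr rfl fun j _ => ?_
    rw [← Real.sin_add_int_mul_two_pi (θ t j - θ t k) (n j - n k)]
    push_cast
    congr 2
    ring
  obtain ⟨φ, hφ⟩ := hx₀ _ hsol (funext fun k => by rw [hn']; ring)
  refine ⟨φ, fun k => (tendsto_coe_of_tendsto_cos (hφ k)).congr fun t => ?_⟩
  rw [AddCircle.coe_add, ← zsmul_eq_mul, AddCircle.coe_zsmul, AddCircle.coe_period, smul_zero,
    add_zero]

/-- A limit in the long run excludes almost all initial conditions if, for every `n`, the points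
from which a solution stays near the limit after time `n` are a null set. -/
theorem ae_forall_not_tendsto_continuousTime (G : WeightedDigraph V) {α : ℝ} (hα : 0 < α)
    {P : Set (V → ℝ)} (h : ∀ p ∈ P, ∃ δ > 0, ∀ n : ℕ,
      volume {z | ∃ x, IsContinuousTimeSolution G α x ∧ x n = z ∧
        ∀ t : ℝ, n ≤ t → ‖x t - p‖ ≤ δ} = 0) :
    ∀ᵐ x₀ : V → ℝ, ∀ x, IsContinuousTimeSolution G α x → x 0 = x₀ →
      ∀ p ∈ P, ¬ Tendsto x atTop (𝓝 p) := by
  refine ae_forall_not_tendsto (X := {x | IsContinuousTimeSolution G α x}) (P := P) ?_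
  intro p hp
  obtain ⟨δ, hδ, hzero⟩ := h p hp
  refine ⟨δ, hδ, measure_mono_null (t := ⋃ n : ℕ, _) ?_ (measure_iUnion_null fun n =>
    reflectsNull_continuousTime G hα n.cast_nonneg _ (hzero n))⟩
  rintro x₀ ⟨x, hx, h0, hev⟩
  obtain ⟨t₀, ht₀⟩ := eventually_atTop.1 hev
  obtain ⟨n, hn⟩ := exists_nat_ge t₀
  refine Set.mem_iUnion.2 ⟨n, x n, ⟨x, hx, rfl, fun t ht => ?_⟩, x, hx, h0, rfl⟩
  rw [← dist_eq_norm]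
  exact (Metric.mem_ball.1 (ht₀ t (hn.trans ht))).le

end CircleSync

namespace CircleSync

/-! ### Convergence in continuous time on undirected graphs -/

variable {V : Type*} [Fintype V]

/-- The potential changes at the rate at which the torque does work. -/
theorem hasDerivWithinAt_potential {G : WeightedDigraph V} (hG : G.IsUndirected)
    {x : ℝ → V → ℝ} {v : V → ℝ} {s : Set ℝ} {t : ℝ} (hx : HasDerivWithinAt x v s t) :
    HasDerivWithinAt (fun t => G.potential (x t)) (∑ k, G.torque (x t) k * v k) s t := by
  have hx' := hasDerivWithinAt_pi.1 hx
  have h1 : HasDerivWithinAt (fun t => G.potential (x t))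
      (1 / 2 * ∑ k, ∑ j, G.weight j k * (-Real.sin (x t j - x t k) * (v j - v k))) s t := by
    refine HasDerivWithinAt.const_mul _ (HasDerivWithinAt.fun_sum fun k _ =>
      HasDerivWithinAt.fun_sum fun j _ => HasDerivWithinAt.const_mul _ ?_)
    exact ((hx' j).sub (hx' k)).cos
  refine h1.congr_deriv ?_
  have h2 : ∑ k, ∑ j, G.weight j k * (Real.sin (x t j - x t k) * v j) =
      -∑ k, ∑ j, G.weight j k * (Real.sin (x t j - x t k) * v k) := by
    rw [Finset.sum_comm, ← Finset.sum_neg_distrib]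
    refine Finset.sum_congr rfl fun k _ => ?_
    rw [← Finset.sum_neg_distrib]
    refine Finset.sum_congr rfl fun j _ => ?_
    rw [hG k j, ← neg_sub (x t j), Real.sin_neg]
    ring
  have h3 : ∑ k, G.torque (x t) k * v k =
      ∑ k, ∑ j, G.weight j k * (Real.sin (x t j - x t k) * v k) := by
    simp only [WeightedDigraph.torque, Finset.sum_mul, mul_assoc]
  have h4 : ∑ k, ∑ j, G.weight j k * (-Real.sin (x t j - x t k) * (v j - v k)) =
      ∑ k, ∑ j, G.weight j k * (Real.sin (x t j - x t k) * v k) -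
      ∑ k, ∑ j, G.weight j k * (Real.sin (x t j - x t k) * v j) := by
    simp only [← Finset.sum_sub_distrib]
    exact Finset.sum_congr rfl fun k _ => Finset.sum_congr rfl fun j _ => by ring
  rw [h4, h2, h3]
  ring

/-- On a short time interval, the distance from the initial point is at most twice what the initial
velocity gives. -/
theorem IsContinuousTimeSolution.norm_sub_le {G : WeightedDigraph V} {α : ℝ} (hα : 0 < α)
    {x : ℝ → V → ℝ} (hx : IsContinuousTimeSolution G α x) {K t s : ℝ}
    (hK : K = 4 * α * G.dSum + 1) (ht : 0 ≤ t) (hs : s ∈ Set.Icc t (t + 1 / (4 * K))) :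
    ‖x s - x t‖ ≤ 2 * (s - t) * ‖(2 * α) • G.torque (x t)‖ := by
  have hd := G.dSum_nonneg
  have hK0 : 0 < K := by rw [hK]; positivity
  set A := ‖(2 * α) • G.torque (x t)‖ with hA
  have h := norm_le_gronwallBound_of_norm_deriv_right_le
    (f := fun s => x s - x t) (f' := fun s => (2 * α) • G.torque (x s))
    (δ := 0) (K := K) (ε := A) (a := t) (b := t + 1 / (4 * K))
    ((hx.continuousOn_Icc ht).sub continuousOn_const)
    (fun s hs => (hx.hasDerivWithinAt_Ici (ht.trans hs.1)).sub_const _) (by simp)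
    (fun s hs => by
      have h1 := norm_smul_torque_sub_le G hα (x s) (x t)
      have h2 := norm_le_norm_add_norm_sub' ((2 * α) • G.torque (x s)) ((2 * α) • G.torque (x t))
      have h3 := norm_nonneg (x s - x t)
      rw [hK]
      linarith)
    s hs
  refine h.trans ?_
  rw [gronwallBound_of_K_ne_0 hK0.ne']
  have h0 : 0 ≤ s - t := by linarith [hs.1]
  have h1 : K * (s - t) ≤ 1 / 4 := by
    have : s - t ≤ 1 / (4 * K) := by linarith [hs.2]
    calc K * (s - t) ≤ K * (1 / (4 * K)) := mul_le_mul_of_nonneg_left this hK0.le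
      _ = 1 / 4 := by field_simp
  have h2 : |K * (s - t)| = K * (s - t) := abs_of_nonneg (by positivity)
  have h3 := Real.abs_exp_sub_one_le (x := K * (s - t)) (by rw [h2]; linarith)
  rw [h2] at h3
  have h4 := (le_abs_self _).trans h3
  calc 0 * Real.exp (K * (s - t)) + A / K * (Real.exp (K * (s - t)) - 1)
      ≤ 0 * Real.exp (K * (s - t)) + A / K * (2 * (K * (s - t))) := by gcongr
    _ = 2 * (s - t) * A := by field_simp; ring

/-- On a short time interval, the potential gains at least a multiple of the square of the initial
speed. -/
theorem IsContinuousTimeSolution.potential_gain {G : WeightedDigraph V} (hG : G.IsUndirected)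
    {α : ℝ} (hα : 0 < α) {x : ℝ → V → ℝ} (hx : IsContinuousTimeSolution G α x) {K t : ℝ}
    (hK : K = 4 * α * G.dSum + 1) (ht : 0 ≤ t) :
    1 / (32 * K * α) * ‖(2 * α) • G.torque (x t)‖ ^ 2 ≤
      G.potential (x (t + 1 / (4 * K))) - G.potential (x t) := by
  have hd := G.dSum_nonneg
  have hK0 : 0 < K := by rw [hK]; positivity
  set A := ‖(2 * α) • G.torque (x t)‖ with hA
  have hA0 : 0 ≤ A := norm_nonneg _
  set h := 1 / (4 * K) with hh
  have hh0 : 0 < h := by positivity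
  have hderiv : ∀ s, 0 ≤ s → HasDerivWithinAt (fun t => G.potential (x t))
      (∑ k, G.torque (x s) k * ((2 * α) • G.torque (x s)) k) (Set.Ici 0) s := fun s hs =>
    hasDerivWithinAt_potential hG (hx.hasDerivWithinAt hs)
  have hderiv' : ∀ s ∈ interior (Set.Icc t (t + h)), HasDerivAt (fun t => G.potential (x t))
      (∑ k, G.torque (x s) k * ((2 * α) • G.torque (x s)) k) s := by
    intro s hs
    rw [interior_Icc] at hs
    have h1 : 0 < s := ht.trans_lt hs.1
    exact (hderiv s h1.le).hasDerivAt (Ici_mem_nhds h1)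
  have hmain := (convex_Icc t (t + h)).mul_sub_le_image_sub_of_le_deriv
    (f := fun t => G.potential (x t)) (C := A ^ 2 / (8 * α))
    (fun s hs => ((hderiv s (ht.trans hs.1)).continuousWithinAt).mono
      fun r hr => ht.trans hr.1)
    (fun s hs => (hderiv' s hs).differentiableAt.differentiableWithinAt)
    (fun s hs => by
      rw [(hderiv' s hs).deriv]
      have hs' := interior_subset hs
      have h1 := hx.norm_sub_le hα hK ht hs'
      have h2 := norm_smul_torque_sub_le G hα (x t) (x s)
      rw [norm_sub_rev (x t)] at h2
      have h3 : 4 * α * G.dSum * ‖x s - x t‖ ≤ A / 2 := by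
        have e1 : s - t ≤ h := by linarith [hs'.2]
        have e2 : 4 * α * G.dSum ≤ K := by rw [hK]; linarith
        calc 4 * α * G.dSum * ‖x s - x t‖ ≤ K * (2 * h * A) := by
              refine mul_le_mul e2 (h1.trans ?_) (norm_nonneg _) hK0.le
              gcongr
          _ = A / 2 := by rw [hh]; field_simp; ring
      have h4 : A / 2 ≤ ‖(2 * α) • G.torque (x s)‖ := by
        have := norm_sub_norm_le ((2 * α) • G.torque (x t)) ((2 * α) • G.torque (x s))
        linarith
      have h5 := (pow_le_pow_left₀ (by positivity) h4 2).trans (norm_sq_le_sum_sq _)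
      have h6 : ∑ k, ((2 * α) • G.torque (x s)) k ^ 2 =
          2 * α * ∑ k, G.torque (x s) k * ((2 * α) • G.torque (x s)) k := by
        rw [Finset.mul_sum]
        refine Finset.sum_congr rfl fun k _ => ?_
        rw [Pi.smul_apply, smul_eq_mul]
        ring
      rw [h6] at h5
      rw [div_le_iff₀ (by positivity)]
      linarith)
    t (Set.left_mem_Icc.2 (by linarith)) (t + h) (Set.right_mem_Icc.2 (by linarith))
    (by linarith)
  refine le_trans (le_of_eq ?_) hmain
  rw [hh]
  field_simp
  ring

/-- The trajectories have finite length, and therefore converge to an equilibrium. -/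
theorem IsContinuousTimeSolution.exists_tendsto {G : WeightedDigraph V} (hG : G.HasSyncLandscape)
    {α : ℝ} (hα : 0 < α) {x : ℝ → V → ℝ} (hx : IsContinuousTimeSolution G α x) :
    ∃ p, Tendsto x atTop (𝓝 p) ∧ ∀ k, G.torque p k = 0 := by
  have hd := G.dSum_nonneg
  obtain ⟨K, hK⟩ : ∃ K, K = 4 * α * G.dSum + 1 := ⟨_, rfl⟩
  have hK0 : 0 < K := by rw [hK]; positivity
  obtain ⟨h, hh⟩ : ∃ h, h = 1 / (4 * K) := ⟨_, rfl⟩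
  have hh0 : 0 < h := by rw [hh]; positivity
  have hnh : ∀ n : ℕ, 0 ≤ (n : ℝ) * h := fun n => by positivity
  have hsucc : ∀ n : ℕ, ((n + 1 : ℕ) : ℝ) * h = n * h + 1 / (4 * K) := fun n => by
    push_cast
    rw [← hh]
    ring
  set y : ℕ → V → ℝ := fun n => x (n * h) with hy
  set A : ℕ → ℝ := fun n => ‖(2 * α) • G.torque (y n)‖ with hA
  obtain ⟨crit, C, hcrit⟩ := hG.lojasiewicz_norm
  have hsum : Summable A := by
    refine summable_of_lojasiewicz (φ := fun n => G.potential (y n)) (crit := crit)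
      (c := 1 / (32 * K * α)) (C := C * (1 / (2 * α)) ^ 4) (B := G.dSum) (by positivity)
      (fun n => norm_nonneg _) (fun n => ?_) (fun n => G.potential_le _) (fun n => ?_)
    · have := hx.potential_gain hG.isUndirected hα hK (hnh n)
      simp only [hy, hsucc]
      exact this
    · obtain ⟨v, hv, hle⟩ := hcrit (y n) (1 / (2 * α) * A n) fun k => by
        have h1 := norm_le_pi_norm ((2 * α) • G.torque (y n)) k
        rw [Pi.smul_apply, smul_eq_mul, Real.norm_eq_abs, abs_mul,
          abs_of_pos (by positivity : 0 < 2 * α)] at h1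
        rw [one_div, inv_mul_eq_div, le_div_iff₀ (by positivity), mul_comm]
        exact h1
      exact ⟨v, hv, hle.trans (le_of_eq (by ring))⟩
  have hdist : ∀ (n : ℕ) (s : ℝ), s ∈ Set.Icc (n * h) (n * h + 1 / (4 * K)) →
      ‖x s - y n‖ ≤ 2 * h * A n := by
    intro n s hs
    refine (hx.norm_sub_le hα hK (hnh n) hs).trans ?_
    have : s - n * h ≤ h := by rw [hh] at hs ⊢; linarith [hs.2]
    exact mul_le_mul_of_nonneg_right (by linarith) (norm_nonneg _)
  have hcauchy : CauchySeq y := by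
    refine cauchySeq_of_dist_le_of_summable _ (fun n => ?_) (hsum.mul_left (2 * h))
    rw [dist_comm, dist_eq_norm]
    have := hdist n (((n + 1 : ℕ) : ℝ) * h) (by
      rw [hsucc]
      exact Set.right_mem_Icc.2 (le_add_of_nonneg_right (by positivity)))
    exact this
  obtain ⟨p, hp⟩ := cauchySeq_tendsto_of_complete hcauchy
  refine ⟨p, ?_, fun k => ?_⟩
  · have hfloor : Tendsto (fun t : ℝ => ⌊t / h⌋₊) atTop atTop :=
      tendsto_nat_floor_atTop.comp (tendsto_id.atTop_div_const hh0)
    have h1 := hp.comp hfloor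
    have h2 := (hsum.tendsto_atTop_zero.const_mul (2 * h)).comp hfloor
    rw [mul_zero] at h2
    have h3 : Tendsto (fun t => x t - y ⌊t / h⌋₊) atTop (𝓝 0) := by
      refine squeeze_zero_norm' ?_ h2
      filter_upwards [eventually_ge_atTop 0] with t ht
      refine hdist _ t ⟨?_, ?_⟩
      · rw [← le_div_iff₀ hh0]
        exact Nat.floor_le (by positivity)
      · rw [← hsucc, ← div_le_iff₀ hh0]
        push_cast
        exact (Nat.lt_floor_add_one _).le
    have h4 := h3.add h1
    rw [zero_add] at h4
    exact h4.congr fun t => by simp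
  · have h1 : Tendsto (fun n => G.torque (y n) k) atTop (𝓝 (G.torque p k)) :=
      ((G.continuous_torque k).tendsto p).comp hp
    have h2 : Tendsto (fun n => G.torque (y n) k) atTop (𝓝 0) := by
      refine squeeze_zero_norm (fun n => ?_) (a := fun n => 1 / (2 * α) * A n) ?_
      · have h1 := norm_le_pi_norm ((2 * α) • G.torque (y n)) k
        rw [Pi.smul_apply, norm_smul, Real.norm_of_nonneg (by positivity : 0 ≤ 2 * α)] at h1
        rw [one_div, inv_mul_eq_div, le_div_iff₀ (by positivity), mul_comm]
        exact h1
      · have := hsum.tendsto_atTop_zero.const_mul (1 / (2 * α))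
        rwa [mul_zero] at this
    exact tendsto_nhds_unique h1 h2

end CircleSync

namespace CircleSync

/-! ### Expansion at unstable equilibria in continuous time -/

variable {V : Type*} [Fintype V]

/-- Along `u' = H u + e` with a small perturbation `e`, the quantity `u ⬝ H u - η ‖u‖²` grows
exponentially as long as it is nonnegative: the main term is `‖H u‖²`, which dominates `u ⬝ H u`,
hence also `‖u‖²` in the cone. -/
theorem exists_cone_rate (H : (V → ℝ) →ₗ[ℝ] (V → ℝ)) (hH : ∀ d u, d ⬝ᵥ H u = u ⬝ᵥ H d) :
    ∃ η₀ > 0, ∀ η, 0 < η → η ≤ η₀ → ∃ r > 0, ∃ κ > 0, ∀ u e : V → ℝ, (∀ k, |e k| ≤ r * ‖u‖) →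
      0 ≤ u ⬝ᵥ H u - η * (u ⬝ᵥ u) →
        κ * (u ⬝ᵥ H u - η * (u ⬝ᵥ u)) ≤ (H u + e) ⬝ᵥ H u - η * ((H u + e) ⬝ᵥ u) := by
  obtain ⟨C, hC, hq⟩ := exists_dotProduct_le_norm_sq H hH
  set N : ℝ := (Fintype.card V : ℝ) with hN
  refine ⟨1 / (4 * (C + 1)), by positivity, fun η hη hηle => ?_⟩
  set r := η / (4 * (N + 1) * (1 + η) * (C + 1)) with hr
  have hr0 : 0 < r := by positivity
  refine ⟨r, hr0, 1 / (4 * (C + 1)), by positivity, fun u e he hcone => ?_⟩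
  have hr1 : r ≤ 1 := by
    rw [hr, div_le_one (by positivity)]
    have : 0 ≤ N * η * (1 + C) + η * C + N * (1 + C) + (1 + C) := by positivity
    nlinarith
  set S := H u ⬝ᵥ H u with hS
  set W := u ⬝ᵥ u with hW
  have hSn : ‖H u‖ ^ 2 ≤ S := by
    simpa only [hS, dotProduct, sq] using norm_sq_le_sum_sq (H u)
  have hWn : ‖u‖ ^ 2 ≤ W := by
    simpa only [hW, dotProduct, sq] using norm_sq_le_sum_sq u
  have hW0 : 0 ≤ W := (sq_nonneg _).trans hWn
  have hS0 : 0 ≤ S := (sq_nonneg _).trans hSn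
  have hqS : u ⬝ᵥ H u ≤ C * S := (hq u).trans (mul_le_mul_of_nonneg_left hSn hC)
  -- in the cone, `‖u‖²` is bounded by `‖H u‖²`
  have hWS : η * W ≤ C * S := by linarith
  have hen : ‖e‖ ≤ r * ‖u‖ := (pi_norm_le_iff_of_nonneg (by positivity)).2 he
  have hee : e ⬝ᵥ e ≤ N * r ^ 2 * W := by
    have h1 : e ⬝ᵥ e ≤ N * (‖e‖ * ‖e‖) := (le_abs_self _).trans (abs_dotProduct_le e e)
    have h2 : ‖e‖ * ‖e‖ ≤ r ^ 2 * W := by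
      calc ‖e‖ * ‖e‖ ≤ (r * ‖u‖) * (r * ‖u‖) := mul_self_le_mul_self (norm_nonneg _) hen
        _ = r ^ 2 * ‖u‖ ^ 2 := by ring
        _ ≤ r ^ 2 * W := by gcongr
    calc e ⬝ᵥ e ≤ N * (‖e‖ * ‖e‖) := h1
      _ ≤ N * (r ^ 2 * W) := by gcongr
      _ = _ := by ring
  have heu : e ⬝ᵥ u ≤ N * r * W := by
    have h1 : e ⬝ᵥ u ≤ N * (‖e‖ * ‖u‖) := (le_abs_self _).trans (abs_dotProduct_le e u)
    calc e ⬝ᵥ u ≤ N * (‖e‖ * ‖u‖) := h1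
      _ ≤ N * (r * ‖u‖ * ‖u‖) := by gcongr
      _ = N * r * ‖u‖ ^ 2 := by ring
      _ ≤ _ := by gcongr
  have heH : -(S / 4 + e ⬝ᵥ e) ≤ e ⬝ᵥ H u := by
    have h : 0 ≤ ∑ k, (H u k / 2 + e k) ^ 2 := Finset.sum_nonneg fun _ _ => sq_nonneg _
    have h' : ∑ k, (H u k / 2 + e k) ^ 2 = S / 4 + e ⬝ᵥ e + e ⬝ᵥ H u := by
      simp only [hS, dotProduct, Finset.sum_div, ← Finset.sum_add_distrib]
      exact Finset.sum_congr rfl fun k _ => by ring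
    linarith
  have hηq : η * (u ⬝ᵥ H u) ≤ S / 4 := by
    have h1 : η * (u ⬝ᵥ H u) ≤ η * (C * S) := mul_le_mul_of_nonneg_left hqS hη.le
    have h2 : η * (C * S) ≤ 1 / (4 * (C + 1)) * (C * S) :=
      mul_le_mul_of_nonneg_right hηle (by positivity)
    have h3 : 1 / (4 * (C + 1)) * (C * S) ≤ S / 4 := by
      rw [div_mul_eq_mul_div, one_mul, div_le_iff₀ (by positivity)]
      linarith
    linarith
  have hsmall : N * r ^ 2 * W + η * (N * r * W) ≤ S / 4 := by
    have h1 : N * r ^ 2 * W ≤ N * r * W := by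
      have : r ^ 2 ≤ r := by nlinarith
      gcongr
    have h2 : N * r * (1 + η) * W * (4 * (N + 1) * (C + 1)) = N * (η * W) := by
      have : r * (4 * (N + 1) * (1 + η) * (C + 1)) = η := div_mul_cancel₀ _ (by positivity)
      linear_combination N * W * this
    have h3 : N * (η * W) ≤ N * (C * S) := by gcongr
    have h4 : N * r * (1 + η) * W ≤ S / 4 := by
      refine le_of_mul_le_mul_right ?_ (by positivity : 0 < 4 * (N + 1) * (C + 1))
      rw [h2]
      refine h3.trans ?_
      have : 0 ≤ N * S + C * S + S := by positivity
      linarith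
    linarith
  have hfin : 1 / (4 * (C + 1)) * (u ⬝ᵥ H u - η * W) ≤ S / 4 := by
    rw [div_mul_eq_mul_div, one_mul, div_le_iff₀ (by positivity)]
    have : 0 ≤ η * W := by positivity
    linarith
  have heu' := mul_le_mul_of_nonneg_left heu hη.le
  rw [add_dotProduct, add_dotProduct, dotProduct_comm (H u) u]
  linarith

theorem hasDerivWithinAt_dotProduct {f g : ℝ → V → ℝ} {f' g' : V → ℝ} {s : Set ℝ} {t : ℝ}
    (hf : HasDerivWithinAt f f' s t) (hg : HasDerivWithinAt g g' s t) :
    HasDerivWithinAt (fun t => f t ⬝ᵥ g t) (f' ⬝ᵥ g t + f t ⬝ᵥ g') s t := by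
  simp only [dotProduct, ← Finset.sum_add_distrib]
  exact HasDerivWithinAt.fun_sum fun k _ =>
    (hasDerivWithinAt_pi.1 hf k).mul (hasDerivWithinAt_pi.1 hg k)

/-- The difference of two torques near `p` is given by the linearized torque. -/
theorem abs_torque_sub_sub_linTorque_le (G : WeightedDigraph V) {p x y : V → ℝ} {δ : ℝ}
    (hx : ‖x - p‖ ≤ δ) (hy : ‖y - p‖ ≤ δ) (k : V) :
    |G.torque x k - G.torque y k - G.linTorque p (x - y) k| ≤ 4 * δ * G.dSum * ‖x - y‖ := by
  have hδ : 0 ≤ δ := (norm_nonneg _).trans hx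
  have hcoord : ∀ {z : V → ℝ} (j : V), ‖z - p‖ ≤ δ → |z j - p j| ≤ δ := fun {z} j h =>
    (norm_le_pi_norm (z - p) j).trans h
  have h : G.torque x k - G.torque y k - G.linTorque p (x - y) k =
      ∑ j, G.weight j k * (Real.sin (x j - x k) - Real.sin (y j - y k) -
        Real.cos (p j - p k) * ((x j - x k) - (y j - y k))) := by
    rw [WeightedDigraph.torque, WeightedDigraph.torque, WeightedDigraph.linTorque_apply,
      ← Finset.sum_sub_distrib, ← Finset.sum_sub_distrib]
    refine Finset.sum_congr rfl fun j _ => ?_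
    simp only [Pi.sub_apply]
    ring
  rw [h]
  refine (G.abs_sum_weight_le k (B := 2 * δ * (2 * ‖x - y‖)) fun j => ?_).trans ?_
  · refine (abs_sin_sub_sin_sub_le (r := 2 * δ) ?_ ?_).trans ?_
    · have e1 := abs_le.1 (hcoord j hx)
      have e2 := abs_le.1 (hcoord k hx)
      rw [abs_le]
      constructor <;> linarith [e1.1, e1.2, e2.1, e2.2]
    · have e1 := abs_le.1 (hcoord j hy)
      have e2 := abs_le.1 (hcoord k hy)
      rw [abs_le]
      constructor <;> linarith [e1.1, e1.2, e2.1, e2.2]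
    · refine mul_le_mul_of_nonneg_left ?_ (by positivity)
      rw [show x j - x k - (y j - y k) = (x - y) j - (x - y) k by simp only [Pi.sub_apply]; ring]
      refine (abs_sub _ _).trans ?_
      have h1 := norm_le_pi_norm (x - y) j
      have h2 := norm_le_pi_norm (x - y) k
      rw [Real.norm_eq_abs] at h1 h2
      linarith
  · have := mul_le_mul_of_nonneg_right (G.inDegree_le_dSum k)
      (by positivity : 0 ≤ 2 * δ * (2 * ‖x - y‖))
    linarith

/-- A bounded function on a half-line cannot start with a positive value and satisfy
`κ f ≤ f'` wherever it is nonnegative. -/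
theorem not_bddAbove_of_deriv_ge {f f' : ℝ → ℝ} {a κ B : ℝ} (hκ : 0 < κ) (h0 : 0 < f a)
    (hf : ∀ t, a ≤ t → HasDerivWithinAt f (f' t) (Set.Ici a) t)
    (hf' : ∀ t, a ≤ t → 0 ≤ f t → κ * f t ≤ f' t) (hB : ∀ t, a ≤ t → f t ≤ B) : False := by
  have hgrow : ∀ b, a ≤ b → f a + κ * f a / 2 * (b - a) ≤ f b := by
    intro b hb
    have h := image_le_of_deriv_right_lt_deriv_boundary' (f := fun t => -f t)
      (f' := fun t => -f' t) (a := a) (b := b) (B := fun t => -(f a + κ * f a / 2 * (t - a)))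
      (B' := fun _ => -(κ * f a / 2 * 1))
      (fun t ht => ((hf t ht.1).continuousWithinAt.mono fun _ hs => hs.1).neg)
      (fun t ht => ((hf t ht.1).mono (Set.Ici_subset_Ici.2 ht.1)).neg) (by simp)
      (by fun_prop)
      (fun t _ => ((((hasDerivAt_id t).sub_const a).const_mul _).const_add _).neg.hasDerivWithinAt)
      (fun t ht heq => by
        have h1 : f t = f a + κ * f a / 2 * (t - a) := by linarith
        have h2 : 0 ≤ κ * f a / 2 * (t - a) :=
          mul_nonneg (by positivity) (by linarith [ht.1])
        have h3 := hf' t ht.1 (by linarith)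
        have h4 : κ * f a ≤ κ * f t := mul_le_mul_of_nonneg_left (by linarith) hκ.le
        have h5 : 0 < κ * f a := by positivity
        linarith)
      (Set.right_mem_Icc.2 hb)
    linarith
  have hpos : 0 < κ * f a / 2 := by positivity
  have hBa := hB a le_rfl
  have hb : a ≤ a + B / (κ * f a / 2) := by
    have : 0 ≤ B / (κ * f a / 2) := div_nonneg (by linarith) hpos.le
    linarith
  have h1 := hgrow _ hb
  rw [add_sub_cancel_left, mul_div_cancel₀ _ hpos.ne'] at h1
  linarith [hB _ hb]

/-- Positions from which a solution stays close to an unstable equilibrium `p` differ by vectors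
outside a cone in which differences grow, and hence form a null set. -/
theorem exists_volume_continuousTime_eq_zero {G : WeightedDigraph V} (hG : G.IsUndirected)
    {α : ℝ} (hα : 0 < α) {p v : V → ℝ} (hv : 0 < v ⬝ᵥ G.linTorque p v) :
    ∃ δ > 0, ∀ n : ℕ, volume {z | ∃ x, IsContinuousTimeSolution G α x ∧ x n = z ∧
      ∀ t : ℝ, n ≤ t → ‖x t - p‖ ≤ δ} = 0 := by
  obtain ⟨L, hL, hLle⟩ := exists_norm_linearMap_le (G.linTorque p)
  obtain ⟨η₀, hη₀, hrate⟩ := exists_cone_rate (G.linTorque p)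
    (WeightedDigraph.dotProduct_linTorque_comm hG p)
  have hW := G.dSum_nonneg
  have hvv : 0 ≤ v ⬝ᵥ v := Finset.sum_nonneg fun k _ => mul_self_nonneg (v k)
  obtain ⟨η, hη, hηη₀, hηv⟩ : ∃ η, 0 < η ∧ η ≤ η₀ ∧ η * (v ⬝ᵥ v) < v ⬝ᵥ G.linTorque p v := by
    have h2 : 0 < min η₀ (v ⬝ᵥ G.linTorque p v / (v ⬝ᵥ v + 1)) :=
      lt_min hη₀ (div_pos hv (by positivity))
    refine ⟨min η₀ (v ⬝ᵥ G.linTorque p v / (v ⬝ᵥ v + 1)), h2, min_le_left _ _, ?_⟩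
    have h1 : min η₀ (v ⬝ᵥ G.linTorque p v / (v ⬝ᵥ v + 1)) * (v ⬝ᵥ v + 1) ≤
        v ⬝ᵥ G.linTorque p v := by
      rw [← le_div_iff₀ (by positivity)]
      exact min_le_right _ _
    linarith
  obtain ⟨r, hr, κ, hκ, hgrow⟩ := hrate η hη hηη₀
  obtain ⟨δ, hδ, hδr⟩ : ∃ δ > 0, 4 * δ * G.dSum ≤ r := by
    refine ⟨r / (4 * (G.dSum + 1)), by positivity, ?_⟩
    have : 4 * (r / (4 * (G.dSum + 1))) * (G.dSum + 1) = r := by field_simp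
    have h' : 0 < r / (4 * (G.dSum + 1)) := by positivity
    linarith
  refine ⟨δ, hδ, fun n => ?_⟩
  set q : (V → ℝ) → ℝ := fun u => u ⬝ᵥ G.linTorque p u - η * (u ⬝ᵥ u) with hq
  refine volume_eq_zero_of_sub_mem (C := {u | q u ≤ 0}) (v := v) ?_ ?_ ?_
  · refine isClosed_le ?_ continuous_const
    have := G.continuous_linTorque p
    simp only [hq, dotProduct]
    fun_prop
  · intro t ht hmem
    have h1 : q (t • v) = t ^ 2 * q v := by
      simp only [hq, map_smul, smul_dotProduct, dotProduct_smul, smul_eq_mul]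
      ring
    have h3 : t ^ 2 * q v ≤ 0 := by rw [← h1]; exact hmem
    have h4 : 0 < t ^ 2 := by positivity
    have h5 : 0 < q v := by simp only [hq]; linarith
    exact absurd h3 (not_le.2 (mul_pos h4 h5))
  · rintro _ ⟨x, hx, rfl, hxp⟩ _ ⟨y, hy, rfl, hyp⟩
    by_contra hnot
    have hn0 : ∀ t : ℝ, n ≤ t → 0 ≤ t := fun t ht => n.cast_nonneg.trans ht
    set u : ℝ → V → ℝ := fun t => x t - y t with hu
    set H' := LinearMap.toContinuousLinearMap (G.linTorque p)
    have hd : ∀ t : ℝ, n ≤ t → HasDerivWithinAt u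
        ((2 * α) • G.torque (x t) - (2 * α) • G.torque (y t)) (Set.Ici n) t := fun t ht =>
      ((hx.hasDerivWithinAt (hn0 t ht)).sub (hy.hasDerivWithinAt (hn0 t ht))).mono
        (Set.Ici_subset_Ici.2 n.cast_nonneg)
    set e : ℝ → V → ℝ := fun t => G.torque (x t) - G.torque (y t) - G.linTorque p (u t) with he
    have hd' : ∀ t, (2 * α) • G.torque (x t) - (2 * α) • G.torque (y t) =
        (2 * α) • (G.linTorque p (u t) + e t) := fun t => by
      simp only [he, add_sub_cancel, smul_sub]
    have heb : ∀ t : ℝ, n ≤ t → ∀ k, |e t k| ≤ r * ‖u t‖ := fun t ht k =>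
      (abs_torque_sub_sub_linTorque_le G (hxp t ht) (hyp t ht) k).trans
        (mul_le_mul_of_nonneg_right hδr (norm_nonneg _))
    refine not_bddAbove_of_deriv_ge (f := fun t => q (u t))
      (f' := fun t => 4 * α * ((G.linTorque p (u t) + e t) ⬝ᵥ G.linTorque p (u t) -
        η * ((G.linTorque p (u t) + e t) ⬝ᵥ u t))) (a := n) (κ := 4 * α * κ)
      (B := Fintype.card V * (2 * δ * (L * (2 * δ)))) (by positivity) (not_le.1 hnot) ?_ ?_ ?_
    · intro t ht
      have h1 := hd t ht
      rw [hd'] at h1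
      have h2 : HasDerivWithinAt (fun t => G.linTorque p (u t))
          (G.linTorque p ((2 * α) • (G.linTorque p (u t) + e t))) (Set.Ici n) t :=
        H'.hasFDerivAt.comp_hasDerivWithinAt t h1
      refine ((hasDerivWithinAt_dotProduct h1 h2).sub
        ((hasDerivWithinAt_dotProduct h1 h1).const_mul η)).congr_deriv ?_
      rw [WeightedDigraph.dotProduct_linTorque_comm hG p (u t), dotProduct_comm (u t)]
      simp only [smul_dotProduct, smul_eq_mul]
      ring
    · intro t ht h0
      have := mul_le_mul_of_nonneg_left (hgrow (u t) (e t) (heb t ht) h0)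
        (by positivity : 0 ≤ 4 * α)
      linarith
    · intro t ht
      have h1 : ‖u t‖ ≤ 2 * δ := by
        have : u t = (x t - p) - (y t - p) := by simp only [hu]; abel
        rw [this]
        refine (norm_sub_le _ _).trans ?_
        linarith [hxp _ ht, hyp _ ht]
      have h2 : u t ⬝ᵥ G.linTorque p (u t) ≤ Fintype.card V * (2 * δ * (L * (2 * δ))) := by
        refine (le_abs_self _).trans ((abs_dotProduct_le _ _).trans ?_)
        refine mul_le_mul_of_nonneg_left (mul_le_mul h1 ((hLle _).trans
          (mul_le_mul_of_nonneg_left h1 hL)) (norm_nonneg _) (by positivity)) (by positivity)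
      have h3 : 0 ≤ η * (u t ⬝ᵥ u t) :=
        mul_nonneg hη.le (Finset.sum_nonneg fun k _ => mul_self_nonneg (u t k))
      simp only [hq]
      linarith

/-- A trajectory converges to an equilibrium, almost surely not an unstable one. -/
theorem ae_synchronizes_continuousTime {G : WeightedDigraph V} (hV : G.verts = Set.univ)
    (hG : G.HasSyncLandscape) {α : ℝ} (hα : 0 < α) :
    ∀ᵐ θ₀ : V → S1, ∀ θ : ℝ → V → ℝ, IsContinuousTimeSolution G α θ →
      (∀ k, (θ 0 k : S1) = θ₀ k) → Synchronizes atTop (fun t k => (θ t k : S1)) := by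
  refine ae_synchronizes_of_lifted_continuousTime ?_
  have hae := ae_forall_not_tendsto_continuousTime G hα
    (P := {p | ∃ v, 0 < v ⬝ᵥ G.linTorque p v}) (by
      rintro p ⟨v, hv⟩
      exact exists_volume_continuousTime_eq_zero hG.isUndirected hα hv)
  filter_upwards [hae] with x₀ hx₀ x hx h0
  obtain ⟨p, hlim, hp⟩ := hx.exists_tendsto hG hα
  have hsync : ∀ j k, Real.cos (p j - p k) = 1 := by
    by_contra hne
    push Not at hne
    obtain ⟨j, k, hjk⟩ := hne
    exact hx₀ x hx h0 p (hG.saddle p hp ⟨j, by simp [hV], k, by simp [hV], hjk⟩) hlim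
  rcases isEmpty_or_nonempty V with hempty | ⟨⟨k₀⟩⟩
  · exact ⟨0, fun k => isEmptyElim k⟩
  · refine ⟨p k₀, fun k => ?_⟩
    rw [← hsync k k₀]
    exact (Real.continuous_cos.tendsto _).comp
      ((((continuous_apply k).tendsto p).comp hlim).sub_const _)

end CircleSync

namespace CircleSync

variable {V : Type*} [Fintype V]

/-! ### Directed trees -/

/-- `G` is a directed tree with root `r`, presented by the parent of each agent `k ≠ r` (the only
agent that sends information to `k`) and a function that increases away from the root. -/
structure WeightedDigraph.IsTreeRootedAt (G : WeightedDigraph V) (r : V) (parent : V → V)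
    (depth : V → ℕ) : Prop where
  weight_root : ∀ j, G.weight j r = 0
  weight_eq_zero : ∀ k ≠ r, ∀ j ≠ parent k, G.weight j k = 0
  weight_parent_pos : ∀ k ≠ r, 0 < G.weight (parent k) k
  depth_parent_lt : ∀ k ≠ r, depth (parent k) < depth k

theorem WeightedDigraph.IsDirectedTree.exists_isTreeRootedAt {V : Type*}
    {G : WeightedDigraph V}
    (hV : G.verts = Set.univ) (hG : G.IsDirectedTree) :
    ∃ r parent depth, G.IsTreeRootedAt r parent depth := by
  classical
  obtain ⟨r, -, h⟩ := hG
  choose path hpath huniq using fun k => h k (by simp [hV])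
  have hstep : ∀ j k, G.Edge j k → path k = path j ++ [k] := by
    intro j k hjk
    refine (huniq k _ ⟨?_, by simp⟩).symm
    have h1 : List.IsChain G.Edge ((r :: path j) ++ [k]) := by
      refine List.isChain_append.2 ⟨(hpath j).1, List.isChain_singleton k, ?_⟩
      intro x hx y hy
      have hx' : x = j := by
        rw [List.getLast?_eq_getLast_of_ne_nil (List.cons_ne_nil r (path j)), (hpath j).2] at hx
        simpa using hx.symm
      have hy' : y = k := by simpa using hy.symm
      rw [hx', hy']
      exact hjk
    exact h1
  have hroot : path r = [] := (huniq r [] ⟨List.isChain_singleton r, rfl⟩).symm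
  have hparent : ∀ k, ∃ j, k ≠ r → G.Edge j k := by
    intro k
    by_cases hk : k = r
    · exact ⟨k, fun h => absurd hk h⟩
    rcases List.eq_nil_or_concat (path k) with h0 | ⟨l, y, hl⟩
    · have := (hpath k).2
      simp only [h0, List.getLast_singleton] at this
      exact absurd this.symm hk
    · rw [List.concat_eq_append] at hl
      have h2 := hpath k
      have hy : y = k := by
        have := h2.2
        simpa [hl] using this
      have h3 : List.IsChain G.Edge ((r :: l) ++ [y]) := by
        have := h2.1
        rw [hl] at this
        exact this
      refine ⟨(r :: l).getLast (List.cons_ne_nil r l), fun _ => ?_⟩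
      rw [← hy]
      exact (List.isChain_append.1 h3).2.2 _
        (List.getLast?_eq_getLast_of_ne_nil (List.cons_ne_nil r l)) y (by simp)
  choose parent hpar using hparent
  have hinj : ∀ i j k, G.Edge i k → G.Edge j k → i = j := by
    intro i j k hi hj
    have h1 : path i = path j := by
      have := (hstep i k hi).symm.trans (hstep j k hj)
      exact List.append_cancel_right this
    rw [← (hpath i).2, ← (hpath j).2]
    simp only [h1]
  refine ⟨r, parent, fun k => (path k).length, fun j => ?_, fun k hk j hj => ?_, fun k hk => ?_,
    fun k hk => ?_⟩
  · by_contra hne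
    have := hstep j r hne
    rw [hroot] at this
    exact absurd this (by simp)
  · by_contra hne
    exact hj (hinj j (parent k) k hne (hpar k hk))
  · exact (G.weight_nonneg _ _).lt_of_ne' (hpar k hk)
  · simp [hstep _ k (hpar k hk)]

theorem WeightedDigraph.IsTreeRootedAt.sum_weight {G : WeightedDigraph V} {r : V}
    {parent : V → V} {depth : V → ℕ} (h : G.IsTreeRootedAt r parent depth) {k : V} (hk : k ≠ r)
    (f : V → ℝ) : ∑ j, G.weight j k * f j = G.weight (parent k) k * f (parent k) :=
  Finset.sum_eq_single_of_mem _ (Finset.mem_univ _) fun j _ hj => by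
    rw [h.weight_eq_zero k hk j hj, zero_mul]

theorem WeightedDigraph.IsTreeRootedAt.sum_weight_root {G : WeightedDigraph V} {r : V}
    {parent : V → V} {depth : V → ℕ} (h : G.IsTreeRootedAt r parent depth)
    (f : V → ℝ) : ∑ j, G.weight j r * f j = 0 :=
  Finset.sum_eq_zero fun j _ => by rw [h.weight_root, zero_mul]

/-- In the (lifted) position `z`, the agents above `k` are close to the root, and `k` itself is
close to the antipode of the root; `m` counts the turns of the lifts. -/
def IsAntipodalAt (r : V) (depth : V → ℕ) (k : V) (m : V → ℤ) (z : V → ℝ) : Prop :=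
  (∀ j, depth j < depth k → |z j - z r - m j * (2 * Real.pi)| ≤ 1 / 20) ∧
    |z k - z r - Real.pi - m k * (2 * Real.pi)| ≤ 1 / 20

/-- If every agent approaches the root or its antipode as soon as all agents above it approach the
root, then all agents approach the root, unless one of them is trapped near the antipode. -/
theorem tendsto_cos_of_forall_not_isAntipodalAt {ι : Type*} {l : Filter ι} {x : ι → V → ℝ}
    {r : V} {depth : V → ℕ}
    (hlim : ∀ k, (∀ j, depth j < depth k → Tendsto (fun t => Real.cos (x t j - x t r)) l (𝓝 1)) →
      Tendsto (fun t => Real.cos (x t k - x t r)) l (𝓝 1) ∨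
      Tendsto (fun t => Real.cos (x t k - x t r)) l (𝓝 (-1)))
    (hwell : ∀ k c, Tendsto (fun t => Real.cos (x t k - x t r - c)) l (𝓝 1) →
      ∃ m : ℤ, ∀ᶠ t in l, |x t k - x t r - c - m * (2 * Real.pi)| ≤ 1 / 20)
    (hnot : ∀ k m, ¬ ∀ᶠ t in l, IsAntipodalAt r depth k m (x t)) (k : V) :
    Tendsto (fun t => Real.cos (x t k - x t r)) l (𝓝 1) := by
  classical
  induction hd : depth k using Nat.strong_induction_on generalizing k with
  | _ d ih =>
  subst hd
  have hlow : ∀ j, depth j < depth k → Tendsto (fun t => Real.cos (x t j - x t r)) l (𝓝 1) :=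
    fun j hj => ih _ hj j rfl
  refine (hlim k hlow).resolve_right fun hanti => ?_
  obtain ⟨mk, hmk⟩ := hwell k Real.pi (by
    have := hanti.neg
    rw [neg_neg] at this
    simpa only [Real.cos_sub_pi] using this)
  have hj : ∀ j, ∃ m : ℤ, depth j < depth k →
      ∀ᶠ t in l, |x t j - x t r - m * (2 * Real.pi)| ≤ 1 / 20 := by
    intro j
    by_cases hjk : depth j < depth k
    · obtain ⟨m, hm⟩ := hwell j 0 (by simpa only [sub_zero] using hlow j hjk)
      exact ⟨m, fun _ => by simpa only [sub_zero] using hm⟩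
    · exact ⟨0, fun h => absurd h hjk⟩
  choose m hm using hj
  refine hnot k (Function.update m k mk) ?_
  have hall : ∀ᶠ t in l, ∀ j, depth j < depth k →
      |x t j - x t r - m j * (2 * Real.pi)| ≤ 1 / 20 := by
    refine eventually_all.2 fun j => ?_
    by_cases hjk : depth j < depth k
    · filter_upwards [hm j hjk] with t ht _ using ht
    · exact Eventually.of_forall fun _ h => absurd h hjk
  filter_upwards [hall, hmk] with t h1 h2
  refine ⟨fun j hj => ?_, ?_⟩
  · rw [Function.update_of_ne (by rintro rfl; exact lt_irrefl _ hj)]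
    exact h1 j hj
  · rw [Function.update_self]
    exact h2

/-- A large cosine forces the angle to be close to a multiple of `2π`. -/
theorem exists_abs_sub_int_mul_two_pi_le {ε : ℝ} (hε : 0 < ε) :
    ∃ c < 1, ∀ w : ℝ, c ≤ Real.cos w → ∃ m : ℤ, |w - m * (2 * Real.pi)| ≤ ε := by
  refine ⟨1 - 2 / Real.pi ^ 2 * min ε 1 ^ 2, ?_, fun w hw => ?_⟩
  · have : 0 < min ε 1 := lt_min hε one_pos
    have hπ := Real.pi_pos
    have : 0 < 2 / Real.pi ^ 2 * min ε 1 ^ 2 := by positivity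
    linarith
  have hπ := Real.pi_pos
  refine ⟨round (w / (2 * Real.pi)), ?_⟩
  set m := round (w / (2 * Real.pi))
  have h1 : |w - m * (2 * Real.pi)| ≤ Real.pi := by
    have h := abs_sub_round (w / (2 * Real.pi))
    have h2 : w - m * (2 * Real.pi) = (w / (2 * Real.pi) - m) * (2 * Real.pi) := by
      field_simp
    rw [h2, abs_mul, abs_of_pos Real.two_pi_pos]
    have := mul_le_mul_of_nonneg_right h Real.two_pi_pos.le
    linarith
  have h2 := Real.cos_le_one_sub_mul_cos_sq h1
  rw [Real.cos_sub_int_mul_two_pi] at h2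
  have h3 : 2 / Real.pi ^ 2 * (w - m * (2 * Real.pi)) ^ 2 ≤ 2 / Real.pi ^ 2 * min ε 1 ^ 2 := by
    linarith
  have h4 := le_of_mul_le_mul_left h3 (by positivity)
  rw [← sq_abs] at h4
  exact (le_of_pow_le_pow_left₀ two_ne_zero (lt_min hε one_pos).le h4).trans (min_le_left _ _)

/-- A sequence which is eventually nondecreasing and bounded jumps only finitely often. -/
theorem not_frequently_jump {c : ℕ → ℝ} {t₀ : ℕ} {B m : ℝ} (hm : 0 < m)
    (hmono : ∀ t, t₀ ≤ t → c t ≤ c (t + 1)) (hB : ∀ t, t₀ ≤ t → c t ≤ B) :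
    ¬ ∃ᶠ t in atTop, c t + m ≤ c (t + 1) := by
  have h1 : Monotone fun t => c (t₀ + t) := monotone_nat_of_le_succ fun t => hmono _ (by omega)
  obtain ⟨L, hL⟩ : ∃ L, Tendsto (fun t => c (t₀ + t)) atTop (𝓝 L) :=
    ⟨_, tendsto_atTop_ciSup h1 ⟨B, by rintro _ ⟨n, rfl⟩; exact hB _ (by omega)⟩⟩
  have hc : Tendsto c atTop (𝓝 L) := by
    refine (tendsto_add_atTop_iff_nat t₀).1 (hL.congr fun t => ?_)
    rw [add_comm]
  have h2 := ((tendsto_add_atTop_iff_nat 1).2 hc).sub hc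
  rw [sub_self] at h2
  rw [not_frequently]
  filter_upwards [h2.eventually_lt_const hm] with t ht h
  linarith

/-- A sequence in `[-1, 1]` which, up to vanishing errors, does not decrease, and increases when it
is updated away from `±1`, converges to `1` or to `-1`. -/
theorem tendsto_one_or_neg_one {c : ℕ → ℝ} {U : Set ℕ} (hU : ∃ᶠ t in atTop, t ∈ U)
    (hc : ∀ t, |c t| ≤ 1) (hstay : ∀ t ∉ U, c (t + 1) = c t)
    (hinc : ∀ δ > 0, ∃ m > 0, ∀ᶠ t in atTop, t ∈ U → c t - δ ≤ c (t + 1) ∧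
      (-1 + δ ≤ c t → c t ≤ 1 - δ → c t + m ≤ c (t + 1))) :
    Tendsto c atTop (𝓝 1) ∨ Tendsto c atTop (𝓝 (-1)) := by
  refine or_iff_not_imp_right.2 fun hnot => ?_
  have hfreq : ∃ δ₀ > 0, ∃ᶠ t in atTop, -1 + δ₀ ≤ c t := by
    by_contra! hcon
    refine hnot (tendsto_order.2 ⟨fun a ha => Eventually.of_forall fun t =>
      ha.trans_le (abs_le.1 (hc t)).1, fun a ha => ?_⟩)
    filter_upwards [hcon (a + 1) (by linarith)] with t ht
    linarith
  obtain ⟨δ₀, hδ₀, hfreq⟩ := hfreq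
  refine tendsto_order.2 ⟨fun a ha => ?_, fun a ha => Eventually.of_forall fun t =>
    (abs_le.1 (hc t)).2.trans_lt ha⟩
  obtain ⟨δ, hδ, hδ1, hδ2, hδ3⟩ : ∃ δ > 0, δ ≤ δ₀ ∧ δ ≤ 1 / 2 ∧ a < 1 - 2 * δ := by
    refine ⟨min δ₀ (min (1 / 2) ((1 - a) / 4)), lt_min hδ₀ (lt_min (by norm_num) (by linarith)),
      min_le_left _ _, (min_le_right _ _).trans (min_le_left _ _), ?_⟩
    have : min δ₀ (min (1 / 2) ((1 - a) / 4)) ≤ (1 - a) / 4 :=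
      (min_le_right _ _).trans (min_le_right _ _)
    linarith
  obtain ⟨m, hm, hev⟩ := hinc δ hδ
  obtain ⟨t₀, ht₀⟩ := eventually_atTop.1 hev
  -- once above `-1 + δ`, the sequence increases as long as it is at most `1 - δ`
  have hup : ∀ t, t₀ ≤ t → -1 + δ ≤ c t → c t ≤ 1 - δ → c t ≤ c (t + 1) := by
    intro t ht h1 h2
    by_cases hU : t ∈ U
    · linarith [(ht₀ t ht hU).2 h1 h2]
    · rw [hstay t hU]
  have htop : ∀ t, t₀ ≤ t → 1 - δ < c t → 1 - 2 * δ ≤ c (t + 1) := by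
    intro t ht h1
    by_cases hU : t ∈ U
    · linarith [(ht₀ t ht hU).1]
    · rw [hstay t hU]
      linarith
  obtain ⟨t₁, ht₁, hct₁⟩ := frequently_atTop.1 hfreq t₀
  have hlow : ∀ t, t₁ ≤ t → -1 + δ ≤ c t := by
    intro t ht
    induction t, ht using Nat.le_induction with
    | base => linarith
    | succ t ht ih =>
      rcases le_or_gt (c t) (1 - δ) with h | h
      · linarith [hup t (ht₁.trans ht) ih h]
      · linarith [htop t (ht₁.trans ht) h]
  obtain ⟨t₂, ht₂, hct₂⟩ : ∃ t₂, t₁ ≤ t₂ ∧ 1 - δ < c t₂ := by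
    by_contra! hcon
    refine not_frequently_jump hm (fun t ht => hup t (ht₁.trans ht) (hlow t ht) (hcon t ht))
      (fun t ht => (abs_le.1 (hc t)).2) ?_
    refine (hU.and_eventually (eventually_ge_atTop t₁)).mono fun t ht => ?_
    exact (ht₀ t (ht₁.trans ht.2) ht.1).2 (hlow t ht.2) (hcon t ht.2)
  filter_upwards [eventually_ge_atTop t₂] with t ht
  refine hδ3.trans_le ?_
  induction t, ht using Nat.le_induction with
  | base => linarith
  | succ t ht ih =>
    rcases le_or_gt (c t) (1 - δ) with h | h
    · linarith [hup t (ht₁.trans (ht₂.trans ht)) (hlow t (ht₂.trans ht)) h]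
    · exact htop t (ht₁.trans (ht₂.trans ht)) h

end CircleSync

namespace CircleSync

variable {V : Type*} [Fintype V]

/-! ### Steps of the algorithm on directed trees -/

theorem abs_cos_sub_cos_le_of_cos {u v : ℝ} :
    |Real.cos u - Real.cos v| ≤ Real.sqrt (2 * (1 - Real.cos (u - v))) := by
  refine Real.abs_le_sqrt ?_
  have h1 := Real.cos_sub u v
  have h2 := Real.sin_sq_add_cos_sq u
  have h3 := Real.sin_sq_add_cos_sq v
  rw [h1]
  linarith [sq_nonneg (Real.sin u - Real.sin v)]

theorem tendsto_sqrt_one_sub_cos {ι : Type*} {l : Filter ι} {w : ι → ℝ}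
    (h : Tendsto (fun t => Real.cos (w t)) l (𝓝 1)) :
    Tendsto (fun t => Real.sqrt (2 * (1 - Real.cos (w t)))) l (𝓝 0) := by
  have := (Real.continuous_sqrt.tendsto _).comp ((h.const_sub 1).const_mul 2)
  simpa [Function.comp_def] using this

/-- A difference of sines of two angles near a multiple of `2π`. -/
theorem exists_sin_sub_sin_eq_mul {a b r : ℝ} {m : ℤ} (hr : r ≤ 1 / 10)
    (ha : |a - m * (2 * Real.pi)| ≤ r) (hb : |b - m * (2 * Real.pi)| ≤ r) :
    ∃ c, 99 / 100 ≤ c ∧ c ≤ 1 ∧ Real.sin a - Real.sin b = c * (a - b) := by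
  have hcos : ∀ ξ, |ξ - m * (2 * Real.pi)| ≤ r → 99 / 100 ≤ Real.cos ξ := by
    intro ξ hξ
    rw [← Real.cos_sub_int_mul_two_pi ξ m]
    have h1 := Real.one_sub_sq_div_two_le_cos (x := ξ - m * (2 * Real.pi))
    have h2 := pow_le_pow_left₀ (abs_nonneg _) (hξ.trans hr) 2
    rw [sq_abs] at h2
    linarith
  wlog hab : b < a generalizing a b
  · rcases eq_or_lt_of_le (not_lt.1 hab) with rfl | hlt
    · exact ⟨1, by norm_num, le_rfl, by simp⟩
    · obtain ⟨c, h1, h2, h3⟩ := this hb ha hlt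
      exact ⟨c, h1, h2, by linear_combination -h3⟩
  obtain ⟨ξ, hξ, hs⟩ := exists_hasDerivAt_eq_slope Real.sin Real.cos hab
    Real.continuous_sin.continuousOn fun t _ => Real.hasDerivAt_sin t
  refine ⟨Real.cos ξ, hcos ξ ?_, Real.cos_le_one ξ, ?_⟩
  · rw [abs_le] at ha hb ⊢
    constructor <;> linarith [hξ.1, hξ.2]
  · rw [hs, div_mul_cancel₀ _ (sub_pos.2 hab).ne']

/-- The same near an odd multiple of `π`. -/
theorem exists_sin_sub_sin_eq_neg_mul {a b r : ℝ} {m : ℤ} (hr : r ≤ 1 / 10)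
    (ha : |a - Real.pi - m * (2 * Real.pi)| ≤ r) (hb : |b - Real.pi - m * (2 * Real.pi)| ≤ r) :
    ∃ c, 99 / 100 ≤ c ∧ c ≤ 1 ∧ Real.sin a - Real.sin b = -c * (a - b) := by
  obtain ⟨c, h1, h2, h3⟩ := exists_sin_sub_sin_eq_mul hr ha hb
  rw [Real.sin_sub_pi, Real.sin_sub_pi] at h3
  exact ⟨c, h1, h2, by linear_combination -h3⟩

namespace IsLiftedStep

variable {G : WeightedDigraph V} {r : V} {parent : V → V} {depth : V → ℕ} {β : ℝ} {s : Set V}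
  {x x' y y' : V → ℝ}

theorem root_eq (hx : IsLiftedStep G β s x x') (h : G.IsTreeRootedAt r parent depth)
    (hβ : 0 < β) : x' r = x r := by
  by_cases hr : r ∈ s
  · have h1 := hx.maximal r hr (x r)
    rw [h.sum_weight_root, h.sum_weight_root, sub_self, Real.cos_zero, zero_add, zero_add] at h1
    have h2 : Real.cos (x r - x' r) = 1 :=
      le_antisymm (Real.cos_le_one _) (le_of_mul_le_mul_left h1 hβ)
    have h3 := abs_le.1 (hx.abs_sub_le r)
    have hπ := Real.pi_pos
    have := (Real.cos_eq_one_iff_of_lt_of_lt (by linarith) (by linarith)).1 h2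
    linarith
  · exact hx.eq_of_notMem r hr

/-- An update brings an agent closer to its parent. -/
theorem cos_parent_ge (hx : IsLiftedStep G β s x x') (h : G.IsTreeRootedAt r parent depth)
    (hβ : 0 < β) {k : V} (hk : k ≠ r) (hks : k ∈ s) :
    Real.cos (x (parent k) - x k) + G.weight (parent k) k / (2 * (G.weight (parent k) k + β)) *
      (1 - Real.cos (x (parent k) - x k) ^ 2) ≤ Real.cos (x (parent k) - x' k) := by
  set a := G.weight (parent k) k with ha
  have ha0 : 0 < a := h.weight_parent_pos k hk
  set p := x (parent k) with hp
  set e := Real.cos (p - x k) with he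
  -- `R` is the modulus of the complex number whose argument is taken
  set R := a * Real.cos (p - x' k) + β * Real.cos (x k - x' k) with hR
  have hcrit : a * Real.sin (p - x' k) + β * Real.sin (x k - x' k) = 0 := by
    have := hx.critical k hks
    rw [h.sum_weight hk, ← neg_sub (x k), Real.sin_neg] at this
    linarith
  have hR0 : 0 ≤ R := by
    have := hx.maximal k hks (x' k + Real.pi)
    rw [h.sum_weight hk (fun j => Real.cos (x j - (x' k + Real.pi))),
      h.sum_weight hk (fun j => Real.cos (x j - x' k)), ← sub_sub, ← sub_sub, Real.cos_sub_pi,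
      Real.cos_sub_pi] at this
    linarith
  have hRR : R ^ 2 = a ^ 2 + β ^ 2 + 2 * a * β * e := by
    have h1 := Real.sin_sq_add_cos_sq (p - x' k)
    have h2 := Real.sin_sq_add_cos_sq (x k - x' k)
    have h3 : e = Real.cos (p - x' k) * Real.cos (x k - x' k) +
        Real.sin (p - x' k) * Real.sin (x k - x' k) := by
      rw [← Real.cos_sub, sub_sub_sub_cancel_right]
    rw [h3, hR]
    linear_combination a ^ 2 * h1 + β ^ 2 * h2 -
      (a * Real.sin (p - x' k) + β * Real.sin (x k - x' k)) * hcrit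
  have he1 : e ≤ 1 := Real.cos_le_one _
  have he2 : -1 ≤ e := Real.neg_one_le_cos _
  have hRle : R ≤ a + β := by
    have h1 := mul_le_mul_of_nonneg_left (Real.cos_le_one (p - x' k)) ha0.le
    have h2 := mul_le_mul_of_nonneg_left (Real.cos_le_one (x k - x' k)) hβ.le
    linarith
  have hprod : (R - (β + a * e)) * (R + (β + a * e)) = a ^ 2 * (1 - e ^ 2) := by
    linear_combination hRR
  have hesq : 0 ≤ 1 - e ^ 2 := by nlinarith
  have hge : β + a * e ≤ R := by
    refine le_of_sq_le_sq ?_ hR0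
    have : 0 ≤ a ^ 2 * (1 - e ^ 2) := by positivity
    linarith
  have hgain : a ^ 2 * (1 - e ^ 2) ≤ (R - (β + a * e)) * (2 * (a + β)) := by
    rw [← hprod]
    refine mul_le_mul_of_nonneg_left ?_ (by linarith)
    have := mul_le_mul_of_nonneg_left he1 ha0.le
    linarith
  have hfin : R - β ≤ a * Real.cos (p - x' k) := by
    have := mul_le_mul_of_nonneg_left (Real.cos_le_one (x k - x' k)) hβ.le
    linarith
  refine le_of_mul_le_mul_left ?_ ha0
  have h4 : a * (a / (2 * (a + β)) * (1 - e ^ 2)) ≤ R - (β + a * e) := by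
    have : a * (a / (2 * (a + β)) * (1 - e ^ 2)) = a ^ 2 * (1 - e ^ 2) / (2 * (a + β)) := by ring
    rw [this]
    exact div_le_of_le_mul₀ (by positivity) (by linarith) hgain
  linarith

/-- Up to the deviation of the parent from the direction `φ`, an update brings an agent closer
to `φ`. -/
theorem cos_sub_ge (hx : IsLiftedStep G β s x x') (h : G.IsTreeRootedAt r parent depth)
    (hβ : 0 < β) {k : V} (hk : k ≠ r) (hks : k ∈ s) (φ : ℝ) :
    Real.cos (x k - φ) + G.weight (parent k) k / (2 * (G.weight (parent k) k + β)) *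
      (1 - Real.cos (x k - φ) ^ 2) - 3 * Real.sqrt (2 * (1 - Real.cos (x (parent k) - φ))) ≤
      Real.cos (x' k - φ) := by
  have hmain := hx.cos_parent_ge h hβ hk hks
  set a := G.weight (parent k) k with ha
  have ha0 : 0 < a := h.weight_parent_pos k hk
  set κ := a / (2 * (a + β)) with hκ
  have hκ0 : 0 ≤ κ := by positivity
  have hκ1 : κ ≤ 1 / 2 := by
    rw [hκ, div_le_div_iff₀ (by positivity) two_pos]
    linarith
  set p := x (parent k) with hp
  set ε := Real.sqrt (2 * (1 - Real.cos (p - φ))) with hε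
  have h1 : |Real.cos (p - x k) - Real.cos (x k - φ)| ≤ ε := by
    rw [← Real.cos_neg (x k - φ), neg_sub]
    have := abs_cos_sub_cos_le_of_cos (u := p - x k) (v := φ - x k)
    rwa [sub_sub_sub_cancel_right] at this
  have h2 : |Real.cos (p - x' k) - Real.cos (x' k - φ)| ≤ ε := by
    rw [← Real.cos_neg (x' k - φ), neg_sub]
    have := abs_cos_sub_cos_le_of_cos (u := p - x' k) (v := φ - x' k)
    rwa [sub_sub_sub_cancel_right] at this
  set e := Real.cos (p - x k) with he
  set c := Real.cos (x k - φ) with hc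
  have h3 : |e ^ 2 - c ^ 2| ≤ ε * 2 := by
    rw [sq_sub_sq, mul_comm, abs_mul]
    refine mul_le_mul h1 ?_ (abs_nonneg _) (Real.sqrt_nonneg _)
    have e1 := Real.abs_cos_le_one (p - x k)
    have e2 := Real.abs_cos_le_one (x k - φ)
    exact (abs_add_le _ _).trans (by linarith)
  have h4 : κ * (e ^ 2 - c ^ 2) ≤ ε := by
    have hε0 : 0 ≤ ε := Real.sqrt_nonneg _
    calc κ * (e ^ 2 - c ^ 2) ≤ κ * (ε * 2) :=
          mul_le_mul_of_nonneg_left ((le_abs_self _).trans h3) hκ0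
      _ ≤ 1 / 2 * (ε * 2) := mul_le_mul_of_nonneg_right hκ1 (by positivity)
      _ = ε := by ring
  rw [abs_le] at h1 h2
  linarith [h1.1, h1.2, h2.1, h2.2]

/-- If the differences of the agents above `k` are bounded by `M`, they remain so. -/
theorem abs_sub_le_of_isAntipodalAt (hx : IsLiftedStep G β s x x') (hy : IsLiftedStep G β s y y')
    (h : G.IsTreeRootedAt r parent depth) (hβ : 0 < β) {k : V} {m : V → ℤ}
    (h₁ : IsAntipodalAt r depth k m x) (h₂ : IsAntipodalAt r depth k m x')
    (h₃ : IsAntipodalAt r depth k m y) (h₄ : IsAntipodalAt r depth k m y') {M : ℝ}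
    (hM : ∀ j, depth j < depth k → |x j - y j| ≤ M) :
    ∀ j, depth j < depth k → |x' j - y' j| ≤ M := by
  intro j hj
  by_cases hjs : j ∈ s
  swap
  · rw [hx.eq_of_notMem j hjs, hy.eq_of_notMem j hjs]
    exact hM j hj
  by_cases hjr : j = r
  · rw [hjr, hx.root_eq h hβ, hy.root_eq h hβ, ← hjr]
    exact hM j hj
  have hpj := (h.depth_parent_lt j hjr).trans hj
  have hxr := hx.root_eq h hβ
  have hyr := hy.root_eq h hβ
  have a0 : 0 < G.weight (parent j) j := h.weight_parent_pos j hjr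
  have a1 := abs_le.1 (h₁.1 j hj)
  have a2 := abs_le.1 (h₂.1 j hj)
  have a3 := abs_le.1 (h₃.1 j hj)
  have a4 := abs_le.1 (h₄.1 j hj)
  have p1 := abs_le.1 (h₁.1 _ hpj)
  have p3 := abs_le.1 (h₃.1 _ hpj)
  obtain ⟨c₁, hc₁, -, e₁⟩ := exists_sin_sub_sin_eq_mul (a := x' j - x j) (b := y' j - y j)
    (r := 1 / 10) (m := 0) le_rfl
    (by push_cast; rw [abs_le]; constructor <;> linarith [a1.1, a1.2, a2.1, a2.2])
    (by push_cast; rw [abs_le]; constructor <;> linarith [a3.1, a3.2, a4.1, a4.2])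
  obtain ⟨c₂, hc₂, -, e₂⟩ := exists_sin_sub_sin_eq_mul (a := x (parent j) - x' j)
    (b := y (parent j) - y' j) (r := 1 / 10) (m := m (parent j) - m j) le_rfl
    (by push_cast; rw [abs_le]; constructor <;> linarith [p1.1, p1.2, a2.1, a2.2])
    (by push_cast; rw [abs_le]; constructor <;> linarith [p3.1, p3.2, a4.1, a4.2])
  have hcx := hx.critical j hjs
  have hcy := hy.critical j hjs
  rw [h.sum_weight hjr (fun i => Real.sin (x i - x' j))] at hcx
  rw [h.sum_weight hjr (fun i => Real.sin (y i - y' j))] at hcy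
  -- the new difference is a weighted mean of the old one and that of the parent
  have key : (β * c₁ + G.weight (parent j) j * c₂) * (x' j - y' j) =
      β * c₁ * (x j - y j) + G.weight (parent j) j * c₂ * (x (parent j) - y (parent j)) := by
    linear_combination hcx - hcy - β * e₁ + G.weight (parent j) j * e₂
  have hA : 0 < β * c₁ := by positivity
  have hB : 0 < G.weight (parent j) j * c₂ := by positivity
  have m1 := abs_le.1 (hM j hj)
  have m2 := abs_le.1 (hM _ hpj)
  have n1 := mul_le_mul_of_nonneg_left m1.1 hA.le
  have n2 := mul_le_mul_of_nonneg_left m1.2 hA.le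
  have n3 := mul_le_mul_of_nonneg_left m2.1 hB.le
  have n4 := mul_le_mul_of_nonneg_left m2.2 hB.le
  rw [abs_le]
  constructor
  · refine le_of_mul_le_mul_left ?_ (add_pos hA hB)
    rw [key]
    linarith
  · refine le_of_mul_le_mul_left ?_ (add_pos hA hB)
    rw [key]
    linarith

/-- If the difference at the trapped agent `k` exceeds twice those of the agents above it, then it
grows with every update. -/
theorem abs_sub_growth_of_isAntipodalAt (hx : IsLiftedStep G β s x x')
    (hy : IsLiftedStep G β s y y') (h : G.IsTreeRootedAt r parent depth) (hβ : 0 < β) {k : V}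
    (hk : k ≠ r) (hks : k ∈ s) {m : V → ℤ}
    (h₁ : IsAntipodalAt r depth k m x) (h₂ : IsAntipodalAt r depth k m x')
    (h₃ : IsAntipodalAt r depth k m y) (h₄ : IsAntipodalAt r depth k m y')
    (hM : 2 * |x (parent k) - y (parent k)| ≤ |x k - y k|) :
    (1 + min (1 / 10) (G.weight (parent k) k / (4 * β))) * |x k - y k| ≤ |x' k - y' k| := by
  have hpk := h.depth_parent_lt k hk
  have hxr := hx.root_eq h hβ
  have hyr := hy.root_eq h hβ
  set a := G.weight (parent k) k with ha
  have a0 : 0 < a := h.weight_parent_pos k hk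
  have a1 := abs_le.1 h₁.2
  have a2 := abs_le.1 h₂.2
  have a3 := abs_le.1 h₃.2
  have a4 := abs_le.1 h₄.2
  have p1 := abs_le.1 (h₁.1 _ hpk)
  have p3 := abs_le.1 (h₃.1 _ hpk)
  have hb₁ : |x' k - x k - ((0 : ℤ) : ℝ) * (2 * Real.pi)| ≤ 1 / 10 := by
    push_cast; rw [abs_le]; constructor <;> linarith [a1.1, a1.2, a2.1, a2.2]
  have hb₂ : |x (parent k) - x' k - Real.pi - ((m (parent k) - m k - 1 : ℤ) : ℝ) *
      (2 * Real.pi)| ≤ 1 / 10 := by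
    push_cast; rw [abs_le]; constructor <;> linarith [p1.1, p1.2, a2.1, a2.2]
  obtain ⟨c₁, hc₁, hc₁', e₁⟩ := exists_sin_sub_sin_eq_mul (a := x' k - x k) (b := y' k - y k)
    le_rfl hb₁
    (by push_cast; rw [abs_le]; constructor <;> linarith [a3.1, a3.2, a4.1, a4.2])
  obtain ⟨c₂, hc₂, hc₂', e₂⟩ := exists_sin_sub_sin_eq_neg_mul (a := x (parent k) - x' k)
    (b := y (parent k) - y' k) le_rfl hb₂
    (by push_cast; rw [abs_le]; constructor <;> linarith [p3.1, p3.2, a4.1, a4.2])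
  have hcx := hx.critical k hks
  have hcy := hy.critical k hks
  rw [h.sum_weight hk (fun i => Real.sin (x i - x' k))] at hcx
  rw [h.sum_weight hk (fun i => Real.sin (y i - y' k))] at hcy
  have key : (β * c₁ - a * c₂) * (x' k - y' k) =
      β * c₁ * (x k - y k) - a * c₂ * (x (parent k) - y (parent k)) := by
    linear_combination hcx - hcy - β * e₁ + a * e₂
  -- the update does not move `k` from the antipode, so that `a` cannot be much larger than `β`
  have haβ : 99 / 100 * a ≤ β := by
    have hmax := hx.maximal k hks (x' k + Real.pi)
    rw [h.sum_weight hk (fun j => Real.cos (x j - (x' k + Real.pi))),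
      h.sum_weight hk (fun j => Real.cos (x j - x' k)), ← sub_sub, ← sub_sub, Real.cos_sub_pi,
      Real.cos_sub_pi] at hmax
    have hcos : 99 / 100 ≤ -Real.cos (x (parent k) - x' k) := by
      rw [← Real.cos_sub_pi, ← Real.cos_sub_int_mul_two_pi _ (m (parent k) - m k - 1)]
      have q1 := Real.one_sub_sq_div_two_le_cos (x := x (parent k) - x' k - Real.pi -
        ((m (parent k) - m k - 1 : ℤ) : ℝ) * (2 * Real.pi))
      have q2 := pow_le_pow_left₀ (abs_nonneg _) hb₂ 2
      rw [sq_abs] at q2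
      linarith
    have q3 := mul_le_mul_of_nonneg_left hcos a0.le
    have q4 := mul_le_mul_of_nonneg_left (Real.cos_le_one (x k - x' k)) hβ.le
    linarith
  set U := |x k - y k| with hU
  set c := min (1 / 10) (a / (4 * β)) with hc
  have hcle : c ≤ 1 / 10 := min_le_left _ _
  have hc0 : 0 ≤ c := by positivity
  have hca : c * (4 * β) ≤ a := by
    rw [← le_div_iff₀ (by positivity)]
    exact min_le_right _ _
  have hA : 0 < β * c₁ := by positivity
  have hB : 0 < a * c₂ := by positivity
  have hU0 : 0 ≤ U := abs_nonneg _
  have hlow : (β * c₁ - a * c₂ / 2) * U ≤ |β * c₁ - a * c₂| * |x' k - y' k| := by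
    rw [← abs_mul, key]
    have t1 := abs_sub_abs_le_abs_sub (β * c₁ * (x k - y k))
      (a * c₂ * (x (parent k) - y (parent k)))
    rw [abs_mul, abs_of_pos hA, abs_mul (a * c₂), abs_of_pos hB] at t1
    have t2 := mul_le_mul_of_nonneg_left hM hB.le
    linarith
  have hβ1 : 99 / 100 * β ≤ β * c₁ := by
    have := mul_le_mul_of_nonneg_left hc₁ hβ.le
    linarith
  have hβ2 : β * c₁ ≤ β := mul_le_of_le_one_right hβ.le hc₁'
  have ha1 : 99 / 100 * a ≤ a * c₂ := by
    have := mul_le_mul_of_nonneg_left hc₂ a0.le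
    linarith
  have ha2 : a * c₂ ≤ a := mul_le_of_le_one_right a0.le hc₂'
  have hfac : |β * c₁ - a * c₂| * (1 + c) ≤ β * c₁ - a * c₂ / 2 := by
    rcases le_total (a * c₂) (β * c₁) with hle | hle
    · rw [abs_of_nonneg (by linarith)]
      have t1 : (β * c₁ - a * c₂) * c ≤ β * c :=
        mul_le_mul_of_nonneg_right (by linarith) hc0
      linarith
    · rw [abs_of_nonpos (by linarith)]
      have t1 : -(β * c₁ - a * c₂) * (1 + c) ≤ -(β * c₁ - a * c₂) * (11 / 10) :=
        mul_le_mul_of_nonneg_left (by linarith) (by linarith)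
      linarith
  have hpos : 0 < β * c₁ - a * c₂ / 2 := by linarith
  have h5 : |β * c₁ - a * c₂| * ((1 + c) * U) ≤ |β * c₁ - a * c₂| * |x' k - y' k| := by
    have := mul_le_mul_of_nonneg_right hfac hU0
    linarith
  rcases (abs_nonneg (β * c₁ - a * c₂)).eq_or_lt with h0 | h0
  · -- degenerate case: the step determines the old difference to be zero
    rw [← h0, zero_mul] at hlow
    have : U ≤ 0 := by
      by_contra hcon
      exact absurd hlow (not_le.2 (mul_pos hpos (not_le.1 hcon)))
    have hU' : U = 0 := le_antisymm this hU0
    rw [hU', mul_zero]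
    exact abs_nonneg _
  · exact le_of_mul_le_mul_left h5 h0

end IsLiftedStep

end CircleSync

namespace CircleSync

/-! ### Synchronization on directed trees in discrete time -/

variable {V : Type*} [Fintype V]

open Classical in
/-- The cone condition by which trapped positions form a null set. -/
theorem volume_eq_zero_of_abs_sub_le_sum {S : Set (V → ℝ)} (depth : V → ℕ) (k : V)
    (hS : ∀ x ∈ S, ∀ y ∈ S,
      |x k - y k| ≤ 2 * ∑ j with depth j < depth k, |x j - y j|) : volume S = 0 := by
  refine volume_eq_zero_of_sub_mem
    (C := {u : V → ℝ | |u k| ≤ 2 * ∑ j with depth j < depth k, |u j|}) (v := Pi.single k 1)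
    (isClosed_le (by fun_prop) (by fun_prop)) ?_ fun x hx y hy => by
      simpa only [Set.mem_ofPred_eq, Pi.sub_apply] using hS x hx y hy
  intro t ht hmem
  have h0 : ∑ j with depth j < depth k, |(t • (Pi.single k (1 : ℝ) : V → ℝ)) j| = 0 := by
    refine Finset.sum_eq_zero fun j hj => ?_
    have hjk : j ≠ k := by
      rintro rfl
      exact lt_irrefl _ (Finset.mem_filter.1 hj).2
    simp [hjk]
  rw [Set.mem_ofPred_eq, h0, mul_zero] at hmem
  have : |t| ≤ 0 := by simpa using hmem
  exact ht (abs_nonpos_iff.1 this)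

theorem IsAntipodalAt.ne_root {V : Type*} {r : V} {depth : V → ℕ} {k : V} {m : V → ℤ} {z : V → ℝ}
    (h : IsAntipodalAt r depth k m z) : k ≠ r := by
  rintro rfl
  have h1 := h.2
  have h2 := Real.one_sub_sq_div_two_le_cos (x := z k - z k - Real.pi - m k * (2 * Real.pi))
  have h3 := pow_le_pow_left₀ (abs_nonneg _) h1 2
  rw [sq_abs] at h3
  rw [Real.cos_sub_int_mul_two_pi, Real.cos_sub_pi, sub_self, Real.cos_zero] at h2
  linarith

/-- In a set of agents, one of minimal depth does not receive information from the others. -/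
theorem WeightedDigraph.IsTreeRootedAt.reflectsNull {G : WeightedDigraph V} {r : V}
    {parent : V → V} {depth : V → ℕ} (h : G.IsTreeRootedAt r parent depth) {β : ℝ} (hβ : 0 < β)
    (s : Set V) : ReflectsNull (IsLiftedStep G β s) := by
  refine reflectsNull_isLiftedStep G hβ s fun t _ hne => ?_
  obtain ⟨k, hk, hmin⟩ := t.exists_min_image depth hne
  refine ⟨k, hk, fun j hj hjk => ?_⟩
  have hkr : k ≠ r := by
    rintro rfl
    exact hjk (h.weight_root j)
  have hjp : j = parent k := by
    by_contra hne
    exact hjk (h.weight_eq_zero k hkr j hne)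
  have h1 := h.depth_parent_lt k hkr
  rw [← hjp] at h1
  exact absurd (hmin j hj) (not_le.2 h1)

/-- A sequence that moves by at most `π` in a step and approaches the multiples of `2π` stays near
one of them. -/
theorem exists_int_eventually_abs_sub_le {w : ℕ → ℝ} (hstep : ∀ t, |w (t + 1) - w t| ≤ Real.pi)
    (hcos : Tendsto (fun t => Real.cos (w t)) atTop (𝓝 1)) :
    ∃ m : ℤ, ∀ᶠ t in atTop, |w t - m * (2 * Real.pi)| ≤ 1 / 20 := by
  obtain ⟨c, hc, hcw⟩ := exists_abs_sub_int_mul_two_pi_le (ε := 1 / 20) (by norm_num)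
  obtain ⟨t₀, ht₀⟩ := eventually_atTop.1 (hcos.eventually_const_le hc)
  obtain ⟨m, hm⟩ := hcw (w t₀) (ht₀ t₀ le_rfl)
  refine ⟨m, eventually_atTop.2 ⟨t₀, fun t ht => ?_⟩⟩
  induction t, ht using Nat.le_induction with
  | base => exact hm
  | succ t ht ih =>
    obtain ⟨m', hm'⟩ := hcw (w (t + 1)) (ht₀ _ (by omega))
    have h1 := abs_le.1 (hstep t)
    have h2 := abs_le.1 ih
    have h3 := abs_le.1 hm'
    have hπ := Real.pi_gt_three
    have e1 : (m' : ℝ) - m < 1 := by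
      refine lt_of_mul_lt_mul_right ?_ Real.two_pi_pos.le
      linarith
    have e2 : (-1 : ℝ) < (m' : ℝ) - m := by
      refine lt_of_mul_lt_mul_right ?_ Real.two_pi_pos.le
      linarith
    have : m' = m := by
      have e3 : m' - m < 1 := by exact_mod_cast e1
      have e4 : -1 < m' - m := by exact_mod_cast e2
      omega
    rwa [this] at hm'

namespace IsLiftedSolution

variable {G : WeightedDigraph V} {r : V} {parent : V → V} {depth : V → ℕ} {β : ℝ}
  {σ : ℕ → Set V}

theorem root_eq {x : ℕ → V → ℝ} (hx : IsLiftedSolution G β σ x)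
    (h : G.IsTreeRootedAt r parent depth) (hβ : 0 < β) (t : ℕ) : x t r = x 0 r := by
  induction t with
  | zero => rfl
  | succ t ih => rw [(hx t).root_eq h hβ, ih]

/-- If the agents above `k` approach the root, then `k` approaches the root or its antipode. -/
theorem tendsto_one_or_neg_one {x : ℕ → V → ℝ} (hx : IsLiftedSolution G β σ x)
    (h : G.IsTreeRootedAt r parent depth) (hβ : 0 < β) {k : V} (hU : ∃ᶠ t in atTop, k ∈ σ t)
    (hk : ∀ j, depth j < depth k → Tendsto (fun t => Real.cos (x t j - x t r)) atTop (𝓝 1)) :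
    Tendsto (fun t => Real.cos (x t k - x t r)) atTop (𝓝 1) ∨
      Tendsto (fun t => Real.cos (x t k - x t r)) atTop (𝓝 (-1)) := by
  by_cases hkr : k = r
  · left
    simp [hkr]
  have hp := hk _ (h.depth_parent_lt k hkr)
  simp only [hx.root_eq h hβ] at hp ⊢
  set φ := x 0 r
  set a := G.weight (parent k) k with ha
  have ha0 : 0 < a := h.weight_parent_pos k hkr
  have hε := (tendsto_sqrt_one_sub_cos hp).const_mul 3
  rw [mul_zero] at hε
  refine CircleSync.tendsto_one_or_neg_one (U := {t | k ∈ σ t}) hU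
    (fun t => Real.abs_cos_le_one _) (fun t ht => by rw [(hx t).eq_of_notMem k ht]) ?_
  intro δ hδ
  obtain ⟨κ, hκ⟩ : ∃ κ, κ = a / (2 * (a + β)) := ⟨_, rfl⟩
  have hκ0 : 0 < κ := by rw [hκ]; positivity
  refine ⟨κ * δ ^ 2 / 2, by positivity, ?_⟩
  filter_upwards [hε.eventually_le_const hδ,
    hε.eventually_le_const (by positivity : 0 < κ * δ ^ 2 / 2)] with t h1 h2 ht
  have hmain := (hx t).cos_sub_ge h hβ hkr ht φ
  rw [← ha, ← hκ] at hmain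
  have hsq : 0 ≤ 1 - Real.cos (x t k - φ) ^ 2 := by
    linarith [Real.sin_sq_add_cos_sq (x t k - φ), sq_nonneg (Real.sin (x t k - φ))]
  constructor
  · have := mul_nonneg hκ0.le hsq
    linarith
  · intro h3 h4
    have h5 : δ * δ ≤ (1 - Real.cos (x t k - φ)) * (1 + Real.cos (x t k - φ)) :=
      mul_le_mul (by linarith) (by linarith) hδ.le (by linarith)
    have h6 : κ * δ ^ 2 ≤ κ * (1 - Real.cos (x t k - φ) ^ 2) :=
      mul_le_mul_of_nonneg_left (by linarith) hκ0.le
    linarith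

open Classical in
/-- Two solutions in which `k` is trapped near the antipode differ at `k` by at most a multiple of
the differences above `k`; otherwise the difference at `k` would grow forever. -/
theorem abs_sub_le_of_isAntipodalAt {x y : ℕ → V → ℝ} (hx : IsLiftedSolution G β σ x)
    (hy : IsLiftedSolution G β σ y) (h : G.IsTreeRootedAt r parent depth) (hβ : 0 < β) {k : V}
    (hU : ∃ᶠ t in atTop, k ∈ σ t) {m : V → ℤ} {n : ℕ}
    (hxm : ∀ t, n ≤ t → IsAntipodalAt r depth k m (x t))
    (hym : ∀ t, n ≤ t → IsAntipodalAt r depth k m (y t)) :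
    |x n k - y n k| ≤ 2 * ∑ j with depth j < depth k, |x n j - y n j| := by
  have hkr := (hxm n le_rfl).ne_root
  by_contra! hcon
  set M := ∑ j with depth j < depth k, |x n j - y n j| with hM
  have hM0 : 0 ≤ M := Finset.sum_nonneg fun _ _ => abs_nonneg _
  have hbound : ∀ t, n ≤ t → ∀ j, depth j < depth k → |x t j - y t j| ≤ M := by
    intro t ht
    induction t, ht using Nat.le_induction with
    | base =>
      intro j hj
      exact Finset.single_le_sum (f := fun j => |x n j - y n j|) (fun _ _ => abs_nonneg _)
        (Finset.mem_filter.2 ⟨Finset.mem_univ j, hj⟩)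
    | succ t ht ih =>
      exact (hx t).abs_sub_le_of_isAntipodalAt (hy t) h hβ (hxm t ht) (hxm _ (by omega))
        (hym t ht) (hym _ (by omega)) ih
  set c := min (1 / 10) (G.weight (parent k) k / (4 * β)) with hc
  have hc0 : 0 < c := by
    have := h.weight_parent_pos k hkr
    exact lt_min (by norm_num) (by positivity)
  have hgrow : ∀ t, n ≤ t → |x n k - y n k| ≤ |x t k - y t k| → k ∈ σ t →
      (1 + c) * |x t k - y t k| ≤ |x (t + 1) k - y (t + 1) k| := by
    intro t ht hle hks
    refine (hx t).abs_sub_growth_of_isAntipodalAt (hy t) h hβ hkr hks (hxm t ht) (hxm _ (by omega))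
        (hym t ht) (hym _ (by omega)) ?_
    linarith [hbound t ht _ (h.depth_parent_lt k hkr)]
  have hstep : ∀ t, n ≤ t → |x n k - y n k| ≤ |x t k - y t k| →
      |x t k - y t k| ≤ |x (t + 1) k - y (t + 1) k| := by
    intro t ht hle
    by_cases hks : k ∈ σ t
    · have h1 := hgrow t ht hle hks
      have h2 := mul_nonneg hc0.le (abs_nonneg (x t k - y t k))
      linarith
    · rw [(hx t).eq_of_notMem k hks, (hy t).eq_of_notMem k hks]
  have hle : ∀ t, n ≤ t → |x n k - y n k| ≤ |x t k - y t k| := by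
    intro t ht
    induction t, ht using Nat.le_induction with
    | base => exact le_rfl
    | succ t ht ih => exact ih.trans (hstep t ht ih)
  have hpos : 0 < |x n k - y n k| := by linarith
  refine not_frequently_jump (c := fun t => |x t k - y t k|) (t₀ := n)
    (m := c * |x n k - y n k|) (B := 1 / 10 + |x 0 r - y 0 r|) (by positivity)
    (fun t ht => hstep t ht (hle t ht)) (fun t ht => ?_) ?_
  · have h1 := abs_le.1 (hxm t ht).2
    have h2 := abs_le.1 (hym t ht).2
    rw [hx.root_eq h hβ] at h1
    rw [hy.root_eq h hβ] at h2
    have h3 := abs_le.1 (le_refl |x 0 r - y 0 r|)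
    rw [abs_le]
    constructor <;> linarith [h1.1, h1.2, h2.1, h2.2, h3.1, h3.2]
  · refine (hU.and_eventually (eventually_ge_atTop n)).mono fun t ht => ?_
    have h1 := hgrow t ht.2 (hle t ht.2) ht.1
    have h2 := mul_le_mul_of_nonneg_left (hle t ht.2) hc0.le
    linarith

end IsLiftedSolution

theorem WeightedDigraph.IsTreeRootedAt.ae_synchronizes {G : WeightedDigraph V} {r : V}
    {parent : V → V} {depth : V → ℕ} (h : G.IsTreeRootedAt r parent depth) {β : ℝ} (hβ : 0 < β)
    {σ : ℕ → Set V} (hσ : ∀ k, ∃ᶠ t in atTop, k ∈ σ t) :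
    ∀ᵐ θ₀ : V → S1, ∀ θ : ℕ → V → S1, IsDiscreteTimeSolution G β σ θ → θ 0 = θ₀ →
      Synchronizes atTop θ := by
  refine ae_synchronizes_of_lifted ?_
  have hnull : ∀ (n : ℕ) (k : V) (m : V → ℤ), volume {z | ∃ x, IsLiftedSolution G β σ x ∧
      x n = z ∧ ∀ t, n ≤ t → IsAntipodalAt r depth k m (x t)} = 0 := by
    intro n k m
    refine volume_eq_zero_of_abs_sub_le_sum depth k ?_
    rintro _ ⟨x, hx, rfl, hxm⟩ _ ⟨y, hy, rfl, hym⟩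
    exact hx.abs_sub_le_of_isAntipodalAt hy h hβ (hσ k) hxm hym
  have hae : ∀ᵐ x₀ : V → ℝ, ∀ (n : ℕ) (k : V) (m : V → ℤ), ¬ ∃ x : ℕ → V → ℝ, x 0 = x₀ ∧
      (∀ t, IsLiftedStep G β (σ t) (x t) (x (t + 1))) ∧ x n ∈ {z | ∃ x,
        IsLiftedSolution G β σ x ∧ x n = z ∧ ∀ t, n ≤ t → IsAntipodalAt r depth k m (x t)} := by
    refine ae_all_iff.2 fun n => ae_all_iff.2 fun k => ae_all_iff.2 fun m => ?_
    rw [ae_iff]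
    simpa only [not_not] using
      volume_initial_eq_zero (fun t => h.reflectsNull hβ (σ t)) n (hnull n k m)
  filter_upwards [hae] with x₀ hx₀ x hx h0
  refine ⟨x 0 r, fun k => ?_⟩
  have hmain := tendsto_cos_of_forall_not_isAntipodalAt (x := x) (l := atTop) (r := r)
    (depth := depth)
    (fun k hk => hx.tendsto_one_or_neg_one h hβ (hσ k) hk) (fun k c hc => by
      refine exists_int_eventually_abs_sub_le (fun t => ?_) hc
      rw [hx.root_eq h hβ, hx.root_eq h hβ t, sub_sub_sub_cancel_right, sub_sub_sub_cancel_right]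
      exact (hx t).abs_sub_le k) (fun k m hev => by
      obtain ⟨n, hn⟩ := eventually_atTop.1 hev
      exact hx₀ n k m ⟨x, h0, hx, x, hx, rfl, hn⟩) k
  simpa only [hx.root_eq h hβ] using hmain

end CircleSync

namespace CircleSync

variable {V : Type*} [Fintype V]

/-! ### Synchronization on directed trees in continuous time -/

theorem abs_sin_sub_sin_le_of_cos {u v : ℝ} :
    |Real.sin u - Real.sin v| ≤ Real.sqrt (2 * (1 - Real.cos (u - v))) := by
  have h := abs_cos_sub_cos_le_of_cos (u := Real.pi / 2 - u) (v := Real.pi / 2 - v)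
  rwa [Real.cos_pi_div_two_sub, Real.cos_pi_div_two_sub, sub_sub_sub_cancel_left,
    ← Real.cos_neg (v - u), neg_sub] at h

/-- A continuous function that approaches the multiples of `2π` stays near one of them. -/
theorem exists_int_eventually_abs_sub_le_of_continuousOn {w : ℝ → ℝ}
    (hw : ContinuousOn w (Set.Ici 0)) (hcos : Tendsto (fun t => Real.cos (w t)) atTop (𝓝 1)) :
    ∃ m : ℤ, ∀ᶠ t in atTop, |w t - m * (2 * Real.pi)| ≤ 1 / 20 := by
  obtain ⟨c, hc, hcw⟩ := exists_abs_sub_int_mul_two_pi_le (ε := 1 / 20) (by norm_num)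
  obtain ⟨t₁, ht₁⟩ := eventually_atTop.1 (hcos.eventually_const_le hc)
  set t₀ := max t₁ 0
  have ht₀ : ∀ t, t₀ ≤ t → c ≤ Real.cos (w t) := fun t ht => ht₁ t ((le_max_left _ _).trans ht)
  obtain ⟨m, hm⟩ := hcw (w t₀) (ht₀ t₀ le_rfl)
  have hπ := Real.pi_gt_three
  -- by the intermediate value theorem, the distance from `2πm` would have to take the value `π`
  have hlt : ∀ t, t₀ ≤ t → |w t - m * (2 * Real.pi)| < Real.pi := by
    intro t ht
    by_contra! hge
    have hcont : ContinuousOn (fun t => |w t - m * (2 * Real.pi)|) (Set.Icc t₀ t) :=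
      ((hw.mono fun s hs => (le_max_right _ _).trans hs.1).sub continuousOn_const).abs
    obtain ⟨s, hs, hsπ⟩ := intermediate_value_Icc ht hcont ⟨hm.trans (by linarith), hge⟩
    obtain ⟨m', hm'⟩ := hcw (w s) (ht₀ s hs.1)
    have h1 : Real.cos (w s) = -1 := by
      have h2 : Real.cos |w s - m * (2 * Real.pi)| = -1 := by
        rw [show |w s - m * (2 * Real.pi)| = Real.pi from hsπ, Real.cos_pi]
      rwa [Real.cos_abs, Real.cos_sub_int_mul_two_pi] at h2
    have h3 := Real.one_sub_sq_div_two_le_cos (x := w s - m' * (2 * Real.pi))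
    have h4 := pow_le_pow_left₀ (abs_nonneg _) hm' 2
    rw [sq_abs] at h4
    rw [Real.cos_sub_int_mul_two_pi, h1] at h3
    linarith
  refine ⟨m, eventually_atTop.2 ⟨t₀, fun t ht => ?_⟩⟩
  obtain ⟨m', hm'⟩ := hcw (w t) (ht₀ t ht)
  have h2 := abs_lt.1 (hlt t ht)
  have h3 := abs_le.1 hm'
  have e1 : (m' : ℝ) - m < 1 := by
    refine lt_of_mul_lt_mul_right ?_ Real.two_pi_pos.le
    linarith
  have e2 : (-1 : ℝ) < (m' : ℝ) - m := by
    refine lt_of_mul_lt_mul_right ?_ Real.two_pi_pos.le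
    linarith
  have : m' = m := by
    have e3 : m' - m < 1 := by exact_mod_cast e1
    have e4 : -1 < m' - m := by exact_mod_cast e2
    omega
  rwa [this] at hm'

/-- The increase of a function whose derivative is bounded below. -/
theorem mul_sub_le_sub_of_le_deriv {f f' : ℝ → ℝ} {a b C : ℝ} (ha : 0 ≤ a) (hab : a ≤ b)
    (hf : ∀ t, 0 ≤ t → HasDerivWithinAt f (f' t) (Set.Ici 0) t)
    (hC : ∀ t ∈ Set.Icc a b, C ≤ f' t) : C * (b - a) ≤ f b - f a := by
  have hd : ∀ t ∈ interior (Set.Icc a b), HasDerivAt f (f' t) t := by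
    intro t ht
    rw [interior_Icc] at ht
    have h0 : 0 < t := ha.trans_lt ht.1
    exact (hf t h0.le).hasDerivAt (Ici_mem_nhds h0)
  exact (convex_Icc a b).mul_sub_le_image_sub_of_le_deriv
    (fun t ht => (hf t (ha.trans ht.1)).continuousWithinAt.mono fun s hs => ha.trans hs.1)
    (fun t ht => (hd t ht).differentiableAt.differentiableWithinAt)
    (fun t ht => by
      rw [(hd t ht).deriv]
      exact hC t (interior_subset ht))
    a (Set.left_mem_Icc.2 hab) b (Set.right_mem_Icc.2 hab) hab

/-- A function with values in `[-1, 1]` that satisfies `c' = κ (1 - c²)` up to vanishing errors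
converges to `1` or to `-1`. -/
theorem tendsto_one_or_neg_one_of_deriv {c c' ε : ℝ → ℝ} {κ : ℝ} (hκ : 0 < κ)
    (hc : ∀ t, |c t| ≤ 1) (hd : ∀ t, 0 ≤ t → HasDerivWithinAt c (c' t) (Set.Ici 0) t)
    (hε : Tendsto ε atTop (𝓝 0)) (hge : ∀ t, 0 ≤ t → κ * (1 - c t ^ 2 - ε t) ≤ c' t) :
    Tendsto c atTop (𝓝 1) ∨ Tendsto c atTop (𝓝 (-1)) := by
  have hsq : ∀ t, 0 ≤ 1 - c t ^ 2 := fun t => by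
    have h1 := pow_le_pow_left₀ (abs_nonneg _) (hc t) 2
    rw [sq_abs] at h1
    linarith
  have hdrop : ∀ γ > 0, ∀ᶠ t in atTop, 0 ≤ t ∧ ∀ s ∈ Set.Icc t (t + 1),
      ε s ≤ γ / κ ∧ ∀ s' ∈ Set.Icc s (t + 1), c s - γ ≤ c s' := by
    intro γ hγ
    obtain ⟨t₀, ht₀⟩ := eventually_atTop.1 (hε.eventually_le_const (by positivity : 0 < γ / κ))
    filter_upwards [eventually_ge_atTop (max t₀ 0)] with t ht
    have h0 : 0 ≤ t := (le_max_right _ _).trans ht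
    have h1 : ∀ s, t ≤ s → ε s ≤ γ / κ := fun s hs =>
      ht₀ s ((le_max_left _ _).trans (ht.trans hs))
    refine ⟨h0, fun s hs => ⟨h1 s hs.1, fun s' hs' => ?_⟩⟩
    have h2 := mul_sub_le_sub_of_le_deriv (C := -γ) (h0.trans hs.1) hs'.1 hd (fun τ hτ => by
      refine le_trans ?_ (hge τ (h0.trans (hs.1.trans hτ.1)))
      have h3 := mul_le_mul_of_nonneg_left (h1 τ (hs.1.trans hτ.1)) hκ.le
      rw [mul_div_cancel₀ _ hκ.ne'] at h3
      have h4 := mul_nonneg hκ.le (hsq τ)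
      linarith)
    have h3 : γ * (s' - s) ≤ γ * 1 :=
      mul_le_mul_of_nonneg_left (by linarith [hs.1, hs'.2]) hγ.le
    linarith
  have hnat : Tendsto (fun n : ℕ => (n : ℝ)) atTop atTop := tendsto_natCast_atTop_atTop
  have hseq := tendsto_one_or_neg_one (c := fun n : ℕ => c n) (U := Set.univ)
    (Frequently.of_forall fun n => Set.mem_univ n)
    (fun n => hc n) (fun n hn => absurd (Set.mem_univ n) hn) (by
      intro δ hδ
      have hγ : 0 < min (δ / 4) (κ * δ ^ 2 / 8) := lt_min (by positivity) (by positivity)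
      refine ⟨_, hγ, ?_⟩
      filter_upwards [hnat.eventually (hdrop _ hγ)] with n hn _
      obtain ⟨hn0, hn⟩ := hn
      set γ := min (δ / 4) (κ * δ ^ 2 / 8) with hγdef
      have hγ1 : γ ≤ δ / 4 := min_le_left _ _
      have hγ2 : γ ≤ κ * δ ^ 2 / 8 := min_le_right _ _
      have hmem : (n : ℝ) ∈ Set.Icc (n : ℝ) (n + 1) := Set.left_mem_Icc.2 (by linarith)
      have hmem' : (n : ℝ) + 1 ∈ Set.Icc (n : ℝ) (n + 1) := Set.right_mem_Icc.2 (by linarith)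
      push_cast
      refine ⟨by linarith [(hn n hmem).2 _ hmem'], fun h1 h2 => ?_⟩
      by_cases hall : ∀ s ∈ Set.Icc (n : ℝ) (n + 1), c s ≤ 1 - δ / 2
      · have h3 := mul_sub_le_sub_of_le_deriv (C := γ) hn0 hmem.2 hd (fun s hs => by
          refine le_trans ?_ (hge s (hn0.trans hs.1))
          have h4 := (hn n hmem).2 s hs
          have h5 := mul_le_mul_of_nonneg_left (hn s hs).1 hκ.le
          rw [mul_div_cancel₀ _ hκ.ne'] at h5
          have h6 : δ / 2 * (δ / 2) ≤ (1 - c s) * (1 + c s) :=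
            mul_le_mul (by linarith [hall s hs]) (by linarith) (by positivity)
              (by linarith [hall s hs])
          have h7 := mul_le_mul_of_nonneg_left h6 hκ.le
          linarith)
        linarith
      · push Not at hall
        obtain ⟨s, hs, hcs⟩ := hall
        have h3 := (hn s hs).2 (n + 1) ⟨hs.2, le_rfl⟩
        linarith)
  refine hseq.imp (fun h => ?_) fun h => ?_
  · refine tendsto_order.2 ⟨fun a ha => ?_, fun a ha => Eventually.of_forall fun t =>
      (abs_le.1 (hc t)).2.trans_lt ha⟩
    have hfl : Tendsto (fun t : ℝ => ⌊t⌋₊) atTop atTop := tendsto_nat_floor_atTop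
    filter_upwards [hfl.eventually (h.eventually_const_lt (by linarith : (a + 1) / 2 < 1)),
      hfl.eventually (hnat.eventually (hdrop ((1 - a) / 2) (by linarith))),
      eventually_ge_atTop 0] with t h1 h2 h0
    have h3 := Nat.floor_le h0
    have h4 := (h2.2 _ (Set.left_mem_Icc.2 (by linarith))).2 t
      ⟨h3, (Nat.lt_floor_add_one t).le⟩
    linarith
  · refine tendsto_order.2 ⟨fun a ha => Eventually.of_forall fun t =>
      ha.trans_le (abs_le.1 (hc t)).1, fun a ha => ?_⟩
    have hfl : Tendsto (fun t : ℝ => ⌊t⌋₊ + 1) atTop atTop :=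
      tendsto_atTop_mono (fun t => Nat.le_succ _) tendsto_nat_floor_atTop
    filter_upwards [hfl.eventually (h.eventually_lt_const (by linarith : -1 < (a - 1) / 2)),
      hdrop ((1 + a) / 2) (by linarith)] with t h1 h2
    have h3 := Nat.floor_le h2.1
    have h4 := (h2.2 t (Set.left_mem_Icc.2 (by linarith))).2 ((⌊t⌋₊ + 1 : ℕ) : ℝ)
      (by push_cast; exact ⟨(Nat.lt_floor_add_one t).le, by linarith⟩)
    linarith

/-- A function that does not increase while it exceeds `M` never exceeds `M`. -/
theorem le_of_deriv_nonpos_of_lt {f f' : ℝ → ℝ} {a M : ℝ}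
    (hf : ∀ t, a ≤ t → HasDerivWithinAt f (f' t) (Set.Ici a) t) (ha : f a ≤ M)
    (hf' : ∀ t, a ≤ t → M < f t → f' t ≤ 0) : ∀ t, a ≤ t → f t ≤ M := by
  intro b hb
  refine le_of_forall_pos_le_add fun ε hε => ?_
  have hη : 0 < ε / (1 + (b - a)) := div_pos hε (by linarith)
  have h := image_le_of_deriv_right_lt_deriv_boundary' (f := f) (f' := f') (a := a) (b := b)
    (B := fun t => M + ε / (1 + (b - a)) * (1 + (t - a))) (B' := fun _ => ε / (1 + (b - a)) * 1)
    (fun t ht => ((hf t ht.1).continuousWithinAt.mono fun _ hs => hs.1))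
    (fun t ht => (hf t ht.1).mono (Set.Ici_subset_Ici.2 ht.1)) (by simp; linarith)
    (by fun_prop)
    (fun t _ => (((((hasDerivAt_id t).sub_const a).const_add 1).const_mul _).const_add
      _).hasDerivWithinAt)
    (fun t ht heq => by
      have h1 : 0 < ε / (1 + (b - a)) * (1 + (t - a)) := mul_pos hη (by linarith [ht.1])
      linarith [hf' t ht.1 (by linarith)])
    (Set.right_mem_Icc.2 hb)
  rwa [div_mul_cancel₀ _ (by linarith)] at h

namespace IsContinuousTimeSolution

variable {G : WeightedDigraph V} {r : V} {parent : V → V} {depth : V → ℕ} {α : ℝ}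

theorem root_eq {x : ℝ → V → ℝ} (hx : IsContinuousTimeSolution G α x)
    (h : G.IsTreeRootedAt r parent depth) {t : ℝ} (ht : 0 ≤ t) : x t r = x 0 r := by
  have hd : ∀ s, 0 ≤ s → HasDerivWithinAt (fun s => x s r) 0 (Set.Ici 0) s := fun s hs => by
    have := hx r s hs
    rwa [h.sum_weight_root (fun j => Real.sin (x s j - x s r)), mul_zero] at this
  exact constant_of_has_deriv_right_zero (f := fun s => x s r) (a := 0) (b := t)
    (fun s hs => (hd s hs.1).continuousWithinAt.mono fun _ hs => hs.1)
    (fun s hs => (hd s hs.1).mono (Set.Ici_subset_Ici.2 hs.1)) t ⟨ht, le_rfl⟩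

theorem hasDerivWithinAt_tree {x : ℝ → V → ℝ} (hx : IsContinuousTimeSolution G α x)
    (h : G.IsTreeRootedAt r parent depth) {k : V} (hk : k ≠ r) {t : ℝ} (ht : 0 ≤ t) :
    HasDerivWithinAt (fun s => x s k) (2 * α * (G.weight (parent k) k *
      Real.sin (x t (parent k) - x t k))) (Set.Ici 0) t := by
  have := hx k t ht
  rwa [h.sum_weight hk (fun j => Real.sin (x t j - x t k))] at this

/-- If the agents above `k` approach the root, then `k` approaches the root or its antipode. -/
theorem tendsto_one_or_neg_one {x : ℝ → V → ℝ} (hx : IsContinuousTimeSolution G α x)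
    (h : G.IsTreeRootedAt r parent depth) (hα : 0 < α) {k : V}
    (hk : ∀ j, depth j < depth k → Tendsto (fun t => Real.cos (x t j - x t r)) atTop (𝓝 1)) :
    Tendsto (fun t => Real.cos (x t k - x t r)) atTop (𝓝 1) ∨
      Tendsto (fun t => Real.cos (x t k - x t r)) atTop (𝓝 (-1)) := by
  by_cases hkr : k = r
  · left
    simp [hkr]
  have hroot : ∀ j, (fun t => Real.cos (x t j - x t r)) =ᶠ[atTop]
      fun t => Real.cos (x t j - x 0 r) := fun j => by
    filter_upwards [eventually_ge_atTop 0] with t ht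
    rw [hx.root_eq h ht]
  have hp := (tendsto_congr' (hroot _)).1 (hk _ (h.depth_parent_lt k hkr))
  rw [tendsto_congr' (hroot k), tendsto_congr' (hroot k)]
  set φ := x 0 r
  set a := G.weight (parent k) k with ha
  have ha0 : 0 < a := h.weight_parent_pos k hkr
  refine tendsto_one_or_neg_one_of_deriv (κ := 2 * α * a) (by positivity)
    (fun t => Real.abs_cos_le_one _)
    (fun t ht => ((hx.hasDerivWithinAt_tree h hkr ht).sub_const φ).cos)
    (tendsto_sqrt_one_sub_cos hp) fun t _ => ?_
  set w := x t k - φ with hw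
  set v := x t (parent k) - φ with hv
  have h1 : |Real.sin (w - v) - Real.sin w| ≤ Real.sqrt (2 * (1 - Real.cos v)) := by
    have := abs_sin_sub_sin_le_of_cos (u := w - v) (v := w)
    rwa [sub_sub_cancel_left, Real.cos_neg] at this
  have h2 : Real.sin (x t (parent k) - x t k) = -Real.sin (w - v) := by
    rw [← Real.sin_neg]
    congr 1
    simp only [hw, hv]
    ring
  have h3 : -Real.sqrt (2 * (1 - Real.cos v)) ≤
      Real.sin w * (Real.sin (w - v) - Real.sin w) := by
    have h4 : |Real.sin w * (Real.sin (w - v) - Real.sin w)| ≤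
        1 * Real.sqrt (2 * (1 - Real.cos v)) := by
      rw [abs_mul]
      exact mul_le_mul (Real.abs_sin_le_one w) h1 (abs_nonneg _) zero_le_one
    linarith [(abs_le.1 h4).1]
  have h5 := Real.sin_sq_add_cos_sq w
  rw [h2]
  have h6 : 0 ≤ 2 * α * a := by positivity
  have h7 := mul_le_mul_of_nonneg_left h3 h6
  have h8 : 2 * α * a * (1 - Real.cos w ^ 2 - Real.sqrt (2 * (1 - Real.cos v))) =
      2 * α * a * Real.sin w ^ 2 + 2 * α * a * -Real.sqrt (2 * (1 - Real.cos v)) := by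
    rw [← h5]
    ring
  rw [h8]
  linarith

/-- The differences of two solutions do not grow above an agent trapped near the antipode. -/
theorem sub_le_of_isAntipodalAt_of_depth_lt {x y : ℝ → V → ℝ}
    (hx : IsContinuousTimeSolution G α x) (hy : IsContinuousTimeSolution G α y)
    (h : G.IsTreeRootedAt r parent depth) (hα : 0 < α) {k : V} {m : V → ℤ} {n M : ℝ} (hn : 0 ≤ n)
    (hxm : ∀ t, n ≤ t → IsAntipodalAt r depth k m (x t))
    (hym : ∀ t, n ≤ t → IsAntipodalAt r depth k m (y t))
    (hM : ∀ j, depth j < depth k → x n j - y n j ≤ M) (j : V) (hj : depth j < depth k) :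
    ∀ t, n ≤ t → x t j - y t j ≤ M := by
  induction hd : depth j using Nat.strong_induction_on generalizing j with
  | _ d ih =>
  subst hd
  by_cases hjr : j = r
  · subst hjr
    intro t ht
    rw [hx.root_eq h (hn.trans ht), hy.root_eq h (hn.trans ht), ← hx.root_eq h hn,
      ← hy.root_eq h hn]
    exact hM j hj
  have hlt := h.depth_parent_lt j hjr
  have hpj := ih _ hlt (parent j) (hlt.trans hj) rfl
  have a0 : 0 < G.weight (parent j) j := h.weight_parent_pos j hjr
  refine le_of_deriv_nonpos_of_lt (fun t ht => ((hx.hasDerivWithinAt_tree h hjr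
    (hn.trans ht)).sub (hy.hasDerivWithinAt_tree h hjr (hn.trans ht))).mono
    (Set.Ici_subset_Ici.2 hn)) (hM j hj) fun t ht hlt' => ?_
  have a1 := abs_le.1 ((hxm t ht).1 j hj)
  have a2 := abs_le.1 ((hxm t ht).1 _ (hlt.trans hj))
  have b1 := abs_le.1 ((hym t ht).1 j hj)
  have b2 := abs_le.1 ((hym t ht).1 _ (hlt.trans hj))
  obtain ⟨c, hc, -, e⟩ := exists_sin_sub_sin_eq_mul (a := x t (parent j) - x t j)
    (b := y t (parent j) - y t j) (r := 1 / 10) (m := m (parent j) - m j) le_rfl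
    (by push_cast; rw [abs_le]; constructor <;> linarith [a1.1, a1.2, a2.1, a2.2])
    (by push_cast; rw [abs_le]; constructor <;> linarith [b1.1, b1.2, b2.1, b2.2])
  have hneg : x t (parent j) - x t j - (y t (parent j) - y t j) ≤ 0 := by
    linarith [hpj t ht]
  rw [← mul_sub, ← mul_sub, e]
  exact mul_nonpos_of_nonneg_of_nonpos (by positivity)
    (mul_nonpos_of_nonneg_of_nonpos a0.le (mul_nonpos_of_nonneg_of_nonpos (by linarith) hneg))

/-- The difference of two solutions at a trapped agent is bounded by the differences above it, since
otherwise it would grow forever. -/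
theorem sub_le_of_isAntipodalAt {x y : ℝ → V → ℝ}
    (hx : IsContinuousTimeSolution G α x) (hy : IsContinuousTimeSolution G α y)
    (h : G.IsTreeRootedAt r parent depth) (hα : 0 < α) {k : V} {m : V → ℤ} {n M : ℝ} (hn : 0 ≤ n)
    (hxm : ∀ t, n ≤ t → IsAntipodalAt r depth k m (x t))
    (hym : ∀ t, n ≤ t → IsAntipodalAt r depth k m (y t))
    (hM : ∀ j, depth j < depth k → x n j - y n j ≤ M) : x n k - y n k ≤ M := by
  have hkr := (hxm n le_rfl).ne_root
  have hlt := h.depth_parent_lt k hkr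
  have hp := hx.sub_le_of_isAntipodalAt_of_depth_lt hy h hα hn hxm hym hM _ hlt
  have a0 : 0 < G.weight (parent k) k := h.weight_parent_pos k hkr
  by_contra! hcon
  refine not_bddAbove_of_deriv_ge (a := n) (f := fun t => x t k - y t k - M)
    (κ := 2 * α * G.weight (parent k) k * (99 / 100)) (B := 1 / 10 + (x 0 r - y 0 r) - M)
    (by positivity) (by linarith)
    (fun t ht => (((hx.hasDerivWithinAt_tree h hkr (hn.trans ht)).sub
      (hy.hasDerivWithinAt_tree h hkr (hn.trans ht))).sub_const M).mono
      (Set.Ici_subset_Ici.2 hn)) (fun t ht h0 => ?_) fun t ht => ?_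
  · have a1 := abs_le.1 (hxm t ht).2
    have a2 := abs_le.1 ((hxm t ht).1 _ hlt)
    have b1 := abs_le.1 (hym t ht).2
    have b2 := abs_le.1 ((hym t ht).1 _ hlt)
    obtain ⟨c, hc, -, e⟩ := exists_sin_sub_sin_eq_neg_mul (a := x t (parent k) - x t k)
      (b := y t (parent k) - y t k) (r := 1 / 10) (m := m (parent k) - m k - 1) le_rfl
      (by push_cast; rw [abs_le]; constructor <;> linarith [a1.1, a1.2, a2.1, a2.2])
      (by push_cast; rw [abs_le]; constructor <;> linarith [b1.1, b1.2, b2.1, b2.2])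
    rw [← mul_sub, ← mul_sub, e, mul_assoc, mul_assoc]
    refine mul_le_mul_of_nonneg_left (mul_le_mul_of_nonneg_left ?_ a0.le) (by positivity)
    calc 99 / 100 * (x t k - y t k - M) ≤ c * (x t k - y t k - M) :=
          mul_le_mul_of_nonneg_right hc h0
      _ ≤ c * -(x t (parent k) - x t k - (y t (parent k) - y t k)) :=
          mul_le_mul_of_nonneg_left (by linarith [hp t ht]) (by linarith)
      _ = _ := by ring
  · have a1 := abs_le.1 (hxm t ht).2
    have b1 := abs_le.1 (hym t ht).2
    rw [hx.root_eq h (hn.trans ht)] at a1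
    rw [hy.root_eq h (hn.trans ht)] at b1
    linarith [a1.2, b1.1]

end IsContinuousTimeSolution

theorem WeightedDigraph.IsTreeRootedAt.ae_synchronizes_continuousTime {G : WeightedDigraph V}
    {r : V} {parent : V → V} {depth : V → ℕ} (h : G.IsTreeRootedAt r parent depth) {α : ℝ}
    (hα : 0 < α) :
    ∀ᵐ θ₀ : V → S1, ∀ θ : ℝ → V → ℝ, IsContinuousTimeSolution G α θ →
      (∀ k, (θ 0 k : S1) = θ₀ k) → Synchronizes atTop (fun t k => (θ t k : S1)) := by
  classical
  refine ae_synchronizes_of_lifted_continuousTime ?_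
  have hnull : ∀ (n : ℕ) (k : V) (m : V → ℤ), volume {z | ∃ x, IsContinuousTimeSolution G α x ∧
      x n = z ∧ ∀ t : ℝ, n ≤ t → IsAntipodalAt r depth k m (x t)} = 0 := by
    intro n k m
    refine volume_eq_zero_of_abs_sub_le_sum depth k ?_
    rintro _ ⟨x, hx, rfl, hxm⟩ _ ⟨y, hy, rfl, hym⟩
    have hM0 : 0 ≤ ∑ j with depth j < depth k, |x n j - y n j| :=
      Finset.sum_nonneg fun _ _ => abs_nonneg _
    have hM : ∀ j, depth j < depth k →
        |x n j - y n j| ≤ ∑ j with depth j < depth k, |x n j - y n j| := fun j hj =>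
      Finset.single_le_sum (f := fun j => |x n j - y n j|) (fun _ _ => abs_nonneg _)
        (Finset.mem_filter.2 ⟨Finset.mem_univ j, hj⟩)
    have h1 := hx.sub_le_of_isAntipodalAt hy h hα n.cast_nonneg hxm hym
      fun j hj => (abs_le.1 (hM j hj)).2
    have h2 := hy.sub_le_of_isAntipodalAt hx h hα n.cast_nonneg hym hxm
      (M := ∑ j with depth j < depth k, |x n j - y n j|) fun j hj => by
        linarith [(abs_le.1 (hM j hj)).1]
    rw [abs_le]
    constructor <;> linarith
  have hae : ∀ᵐ x₀ : V → ℝ, ∀ (n : ℕ) (k : V) (m : V → ℤ), ¬ ∃ z ∈ {z | ∃ x,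
      IsContinuousTimeSolution G α x ∧ x n = z ∧
        ∀ t : ℝ, n ≤ t → IsAntipodalAt r depth k m (x t)},
      ∃ x, IsContinuousTimeSolution G α x ∧ x 0 = x₀ ∧ x n = z := by
    refine ae_all_iff.2 fun n => ae_all_iff.2 fun k => ae_all_iff.2 fun m => ?_
    rw [ae_iff]
    simpa only [not_not] using reflectsNull_continuousTime G hα n.cast_nonneg _ (hnull n k m)
  filter_upwards [hae] with x₀ hx₀ x hx h0
  refine ⟨x 0 r, fun k => ?_⟩
  have hmain := tendsto_cos_of_forall_not_isAntipodalAt (x := x) (l := atTop) (r := r)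
    (depth := depth)
    (fun k hk => hx.tendsto_one_or_neg_one h hα hk) (fun k c hc => by
      have hcont : ∀ j, ContinuousOn (fun t => x t j) (Set.Ici 0) := fun j =>
        (continuous_apply j).comp_continuousOn hx.continuousOn
      exact exists_int_eventually_abs_sub_le_of_continuousOn
        (((hcont k).sub (hcont r)).sub continuousOn_const) hc) (fun k m hev => by
      obtain ⟨t₀, ht₀⟩ := eventually_atTop.1 hev
      obtain ⟨n, hn⟩ := exists_nat_ge t₀
      exact hx₀ n k m ⟨x n, ⟨x, hx, rfl, fun t ht => ht₀ t (hn.trans ht)⟩, x, hx, h0, rfl⟩) k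
  refine hmain.congr' ?_
  filter_upwards [eventually_ge_atTop 0] with t ht
  rw [hx.root_eq h ht]

end CircleSync

namespace CircleSync

/-! ### Synchronization for almost all initial conditions -/

theorem UpdatesRegularly.frequently_mem {V : Type*} {σ : ℕ → Set V} (h : UpdatesRegularly σ)
    (k : V) : ∃ᶠ t in atTop, k ∈ σ t := by
  obtain ⟨-, τ, -, hτ, -, hk⟩ := h
  refine frequently_atTop.2 fun n => ?_
  obtain ⟨t, h1, -, h3⟩ := hk k n
  exact ⟨t, (hτ.id_le n).trans h1, h3⟩

end CircleSync

theorem mainTheorem6 {V : Type*} [Fintype V] (G : CircleSync.WeightedDigraph V)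
    (hV : G.verts = Set.univ)
    (hG : G.IsDirectedTree ∨ G.IsTreeCompleteInterconnection) :
    -- continuous time
    (∀ α : ℝ, 0 < α → ∀ᵐ θ₀ : V → CircleSync.S1, ∀ θ : ℝ → V → ℝ,
      CircleSync.IsContinuousTimeSolution G α θ → (∀ k, (θ 0 k : CircleSync.S1) = θ₀ k) →
        CircleSync.Synchronizes atTop (fun t k => (θ t k : CircleSync.S1))) ∧
    -- discrete time, synchronous update
    (∀ β : ℝ, 0 < β → (G.IsDirectedTree ∨ G.InertiaBound β) →
      ∀ᵐ θ₀ : V → CircleSync.S1, ∀ θ : ℕ → V → CircleSync.S1,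
        CircleSync.IsDiscreteTimeSolution G β (fun _ => Set.univ) θ → θ 0 = θ₀ →
          CircleSync.Synchronizes atTop θ) ∧
    -- discrete time, locally asynchronous update
    (∀ β : ℝ, 0 < β → ∀ σ : ℕ → Set V, CircleSync.IsLocallyAsynchronous G σ →
      CircleSync.UpdatesRegularly σ →
      ∀ᵐ θ₀ : V → CircleSync.S1, ∀ θ : ℕ → V → CircleSync.S1,
        CircleSync.IsDiscreteTimeSolution G β σ θ → θ 0 = θ₀ →
          CircleSync.Synchronizes atTop θ) := by
  have htree : G.IsDirectedTree → ∃ r parent depth, G.IsTreeRootedAt r parent depth :=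
    fun h => h.exists_isTreeRootedAt hV
  refine ⟨fun α hα => ?_, fun β hβ hG' => ?_, fun β hβ σ hσ hreg => ?_⟩
  · rcases hG with h | h
    · obtain ⟨r, parent, depth, h⟩ := htree h
      exact h.ae_synchronizes_continuousTime hα
    · exact CircleSync.ae_synchronizes_continuousTime hV h.hasSyncLandscape hα
  -- the bound on the inertia is available only if `G` is not a directed tree
  · by_cases hdir : G.IsDirectedTree
    · obtain ⟨r, parent, depth, h⟩ := htree hdir
      exact h.ae_synchronizes hβ fun k => Frequently.of_forall fun _ => Set.mem_univ k
    · exact CircleSync.ae_synchronizes_sync hV (hG.resolve_left hdir).hasSyncLandscape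
        (hG'.resolve_left hdir)
  · rcases hG with h | h
    · obtain ⟨r, parent, depth, h⟩ := htree h
      exact h.ae_synchronizes hβ hreg.frequently_mem
    · exact CircleSync.ae_synchronizes_async hV h.hasSyncLandscape hβ hσ hreg
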